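/- **Notation.** Let $N\ge 1$ be an integer and let $L=N\mathbb{Z}^2$ with the quadratic form $Q\binom{x_1}{x_2}=\frac{x_1x_2}{N}$ and bilinear form $B(X,Y)=\frac{x_1y_2+x_2y_1}{N}$. Its dual lattice is $L^*=\mathbb{Z}^2$, with $L^*/L=(\mathbb{Z}/N\mathbb{Z})^2$. Let $\mathfrak{e}_h$ ($h\in L^*/L$) be the canonical basis of $\mathbb{C}[L^*/L]$, $\mathbf{e}(a)=e^{2\pi i a}$, $\tau=u+iv$ in the upper half-plane $\mathcal{H}$, and $q^r=\mathbf{e}(r\tau)$. Let $\rho_{-L}$ be the Weil representation of $\mathrm{SL}_2(\mathbb{Z})$ on $\mathbb{C}[L^*/L]$, i.e. the unique representation with $$\rho_{-L}(T)\mathfrak{e}_h=\mathbf{e}(-Q(h))\mathfrak{e}_h,\qquad \rho_{-L}(S)\mathfrak{e}_h=\frac1N\sum_{\delta\in L^*/L}\mathbf{e}(B(\delta,h))\,\mathfrak{e}_\delta ,$$ where $T=\left(\begin{smallmatrix}1&1\\0&1\end{smallmatrix}\right)$ and $S=\left(\begin{smallmatrix}0&-1\\1&0\end{smallmatrix}\right)$.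 For $t>0$ put $W_t=\sqrt{N/2}\binom{t}{1/t}$, $Z_t=\sqrt{N/2}\binom{t}{-1/t}$ and $\iota_t(X)=(B(X,W_t),B(X,Z_t))$. For $(x,y)\in\mathbb{R}^2$ put, with $\mathrm{sgn}(0)=0$, $$\varphi_\tau(x,y)=\sqrt{2v}\,x\,\mathbf{e}\!\left(\tfrac{x^2}{2}\tau-\tfrac{y^2}{2}\overline\tau\right),\qquad \tilde\varphi_\tau(x,y)=\mathbf{e}\!\left(\tfrac{y^2-x^2}{2}\tau\right)\Big(\mathrm{sgn}(x)\mathbf{1}_{y^2>x^2}-\mathrm{sgn}(x)+\mathrm{erf}(\sqrt{2\pi v}\,x)\Big).$$ For $x\in\mathbb{R}$ let $\langle x\rangle\in(0,1]$ be such that $x-\langle x\rangle\in\mathbb{Z}$. For $h=\binom{h_1}{h_2}$ define $c_h(0)=\frac12-\langle\frac{h_1}{N}\rangle$ if $N\nmid h_1$ and $N\mid h_2$, $c_h(0)=\frac12-\langle\frac{h_2}{N}\rangle$ if $N\mid h_1$ and $N\nmid h_2$, and $c_h(0)=0$ otherwise; for rational $n>0$ let $c_h(n)=\sum_{X\in L+h,\;Q(X)=n}\mathrm{sgn}(x_1)$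 (a finite sum). Define the theta kernels $$\Theta_h(\tau,t)=\sum_{X\in L+h}\varphi_\tau(\iota_t(X)),\qquad \tilde\Theta_h(\tau,t)=c_h(0)+\sum_{X\in L+h}\tilde\varphi_\tau(\iota_t(X)),$$ and the integrals $$\vartheta_h(\tau,s)=\int_0^1\Theta_h(\tau,t)\,t^s\frac{dt}{t}+\int_1^\infty\Theta_h(\tau,t)\,t^{-s}\frac{dt}{t},\qquad \tilde\vartheta_h(\tau,s)=\int_0^1\tilde\Theta_h(\tau,t)\,t^s\frac{dt}{t}+\int_1^\infty\tilde\Theta_h(\tau,t)\,t^{-s}\frac{dt}{t}.$$ Let $\xi_k(f)=2iv^k\,\overline{\partial f/\partial\overline\tau}$ and $\Delta_k=-\xi_{2-k}\circ\xi_k$. A harmonic Maass form of weight $k$ for a representation $\rho$ of $\mathrm{SL}_2(\mathbb{Z})$ is a real-analytic vector-valued function $F$ on $\mathcal{H}$ such that $F(\gamma\tau)=(c\tau+d)^k\rho(\gamma)F(\tau)$ for all $\gamma=\left(\begin{smallmatrix}a&b\\c&d\end{smallmatrix}\right)\in\mathrm{SL}_2(\mathbb{Z})$, $\Delta_kF=0$,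 and for some $C$ one has $F(\tau)=O(e^{Cv})$ as $v\to\infty$, uniformly in $u$. **Theorem.** For all $\tau\in\mathcal{H}$, $t>0$ and $h\in L^*/L$, the series $\Theta_h(\tau,t)$ and $\tilde\Theta_h(\tau,t)$ converge absolutely. The integrals $\vartheta_h(\tau,s)$ and $\tilde\vartheta_h(\tau,s)$ converge absolutely for $\mathrm{Re}(s)>0$ and continue analytically to $s\in\mathbb{C}$. Let $\vartheta_h(\tau)$ (Hecke's Eisenstein series of weight one) and $\tilde\vartheta_h(\tau)$ be the constant terms at $s=0$ of these continuations. Then: 1. $\tilde\vartheta(\tau)=\sum_{h\in L^*/L}\tilde\vartheta_h(\tau)\mathfrak{e}_h$ is a harmonic Maass form of weight $1$ for $\rho_{-L}$. 2. $\xi_1(\tilde\vartheta_h)=\vartheta_h$ for every $h\in L^*/L$. 3. For every $h\in L^*/L$, with absolutely convergent series, $$\tilde\vartheta_h(\tau)=\sum_{n\in\mathbb{Q}_{\ge0}}\tilde c_h(n)q^n+c_h(0)\log v-\sum_{n\in\mathbb{Q}_{>0}}c_h(n)\,\Gamma(0,4\pi nv)\,q^{-n},$$ where $\Gamma(0,x)=\int_x^\infty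 e^{-r}\frac{dr}{r}$, and for $n>0$ $$\tilde c_h(n)=\sum_{X\in L+h,\;-Q(X)=n}\mathrm{sgn}(x_1)\log\left|\frac{x_1}{x_2}\right|,$$ and, with $j=1$ if $N\mid h_2$ and $j=2$ if $N\mid h_1$ (both give the value $0$ if $N\mid h_1$ and $N\mid h_2$), $$\tilde c_h(0)=c_h(0)\left(\log(\pi N)-\frac{\Gamma'(1/2)}{\Gamma(1/2)}\right)-\log\Gamma\!\left(\left\langle\tfrac{h_j}{N}\right\rangle\right)+\log\Gamma\!\left(\left\langle-\tfrac{h_j}{N}\right\rangle\right),$$ while $\tilde c_h(0)=0$ if $N\nmid h_1$ and $N\nmid h_2$. -/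

import Mathlib

open scoped MatrixGroups

/-- The discriminant group `L^*/L = (ℤ/Nℤ)²` of the lattice `L = Nℤ²` (so that `L^* = ℤ²`). -/
abbrev DiscGroup (N : ℕ) : Type := ZMod N × ZMod N

/-- `ρ` acts on the canonical basis `𝔢_h` of `ℂ[L^*/L]` through the generators
`T = (1 1; 0 1)` and `S = (0 -1; 1 0)` by
`ρ(T) 𝔢_h = e(-Q(h)) 𝔢_h` and `ρ(S) 𝔢_h = (1/N) ∑_δ e((δ, h)) 𝔢_δ`,
where `Q(h) = h₁h₂/N` and `(δ, h) = (δ₁h₂ + δ₂h₁)/N` modulo `1`.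
Here `ZMod.stdAddChar j = e(j/N)`. -/
def IsWeilRepNeg (N : ℕ) [NeZero N] (ρ : Representation ℂ SL(2, ℤ) (DiscGroup N → ℂ)) : Prop :=
  (∀ h : DiscGroup N, ρ ModularGroup.T (Pi.single h 1) =
    ZMod.stdAddChar (-(h.1 * h.2)) • (Pi.single h 1 : DiscGroup N → ℂ)) ∧
  (∀ h : DiscGroup N, ρ ModularGroup.S (Pi.single h 1) =
    (N : ℂ)⁻¹ • ∑ δ : DiscGroup N,
      ZMod.stdAddChar (δ.1 * h.2 + δ.2 * h.1) • (Pi.single δ 1 : DiscGroup N → ℂ))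

/-- Partial Fourier transform in the second variable. -/
noncomputable def partialDFT (N : ℕ) [NeZero N] :
    (DiscGroup N → ℂ) ≃ₗ[ℂ] (DiscGroup N → ℂ) where
  toFun f := fun x => ZMod.dft (fun j => f (x.1, j)) x.2
  invFun f := fun x => ZMod.dft.symm (fun j => f (x.1, j)) x.2
  map_add' f g := by
    ext x
    exact congrFun (map_add ZMod.dft (fun j => f (x.1, j)) (fun j => g (x.1, j))) x.2
  map_smul' c f := by
    ext x
    exact congrFun (map_smul ZMod.dft c (fun j => f (x.1, j))) x.2
  left_inv f := by
    ext x
    exact congrFun (ZMod.dft.symm_apply_apply (fun j => f (x.1, j))) x.2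
  right_inv f := by
    ext x
    exact congrFun (ZMod.dft.apply_symm_apply (fun j => f (x.1, j))) x.2

/-- The right translation action of `SL₂(ℤ)` on functions on `(ℤ/Nℤ)²`. -/
def translationRep (N : ℕ) : Representation ℂ SL(2, ℤ) (DiscGroup N → ℂ) where
  toFun γ :=
    { toFun := fun f x => f (x.1 * (γ 0 0 : ℤ) + x.2 * (γ 1 0 : ℤ),
        x.1 * (γ 0 1 : ℤ) + x.2 * (γ 1 1 : ℤ))
      map_add' := fun _ _ => rfl
      map_smul' := fun _ _ => rfl }
  map_one' := by
    ext f x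
    simp
  map_mul' γ δ := by
    refine LinearMap.ext fun f => funext fun x => ?_
    simp only [LinearMap.coe_mk, AddHom.coe_mk, Module.End.mul_apply,
      Matrix.SpecialLinearGroup.coe_mul, Matrix.mul_apply, Fin.sum_univ_two]
    congr 1
    push_cast
    ext <;> ring

theorem partialDFT_single (N : ℕ) [NeZero N] (h x : DiscGroup N) :
    partialDFT N (Pi.single h 1) x =
      if x.1 = h.1 then (ZMod.stdAddChar (-(h.2 * x.2)) : ℂ) else 0 := by
  have h1 : partialDFT N (Pi.single h 1) x =
      ∑ j : ZMod N, ZMod.stdAddChar (-(j * x.2)) • (Pi.single h 1 : DiscGroup N → ℂ) (x.1, j) := rfl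
  rw [h1, Finset.sum_eq_single h.2]
  · by_cases hx : x.1 = h.1
    · have : (x.1, h.2) = h := Prod.ext hx rfl
      simp [hx]
    · have : (x.1, h.2) ≠ h := fun e => hx (by rw [← e])
      simp [hx, this]
  · intro j _ hj
    have : (x.1, j) ≠ h := fun e => hj (congrArg Prod.snd e)
    simp [this]
  · simp

/-- A representation of `SL₂(ℤ)` is determined by its values on `S` and `T`. -/
theorem IsWeilRepNeg.unique {N : ℕ} [NeZero N]
    {ρ ρ' : Representation ℂ SL(2, ℤ) (DiscGroup N → ℂ)}
    (hρ : IsWeilRepNeg N ρ) (hρ' : IsWeilRepNeg N ρ') : ρ = ρ' := by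
  refine MonoidHom.eq_of_eqOn_dense SpecialLinearGroup.SL2Z_generators ?_
  rintro γ (rfl | rfl)
  · refine LinearMap.pi_ext' fun h => LinearMap.ext_ring ?_
    exact (hρ.2 h).trans (hρ'.2 h).symm
  · refine LinearMap.pi_ext' fun h => LinearMap.ext_ring ?_
    exact (hρ.1 h).trans (hρ'.1 h).symm

/-- There is exactly one representation of `SL₂(ℤ)` with these values on the generators. -/
theorem existsUnique_weilRepNeg (N : ℕ) [NeZero N] :
    ∃! ρ : Representation ℂ SL(2, ℤ) (DiscGroup N → ℂ), IsWeilRepNeg N ρ := by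
  have hN : (N : ℂ) ≠ 0 := NeZero.ne _
  refine existsUnique_of_exists_of_unique ?_ fun ρ ρ' h h' => h.unique h'
  refine ⟨((partialDFT N).symm.conjRingEquiv : _ →* _).comp (translationRep N), ⟨?_, ?_⟩⟩
  · intro h
    apply (partialDFT N).injective
    change partialDFT N ((partialDFT N).symm
      (translationRep N ModularGroup.T (partialDFT N (Pi.single h 1)))) = _
    rw [LinearEquiv.apply_symm_apply]
    ext x
    rw [map_smul, Pi.smul_apply, partialDFT_single]
    change partialDFT N (Pi.single h 1) (_, _) = _
    rw [partialDFT_single]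
    by_cases hx : x.1 = h.1
    · simp only [ModularGroup.coe_T, hx]
      simp only [Matrix.of_apply, Matrix.cons_val', Matrix.cons_val_zero, Matrix.cons_val_one,
        Matrix.cons_val_fin_one, Int.cast_one, Int.cast_zero, mul_one, mul_zero, add_zero, if_true,
        smul_eq_mul, ← AddChar.map_add_eq_mul]
      congr 1
      ring
    · simp [ModularGroup.coe_T, hx]
  · intro h
    apply (partialDFT N).injective
    change partialDFT N ((partialDFT N).symm
      (translationRep N ModularGroup.S (partialDFT N (Pi.single h 1)))) = _
    rw [LinearEquiv.apply_symm_apply]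
    ext x
    rw [map_smul, map_sum, Pi.smul_apply, Finset.sum_apply]
    simp only [map_smul, Pi.smul_apply, partialDFT_single]
    change partialDFT N (Pi.single h 1) (_, _) = _
    rw [partialDFT_single, Fintype.sum_prod_type, Finset.sum_eq_single x.1]
    · have key : ∀ y : ZMod N,
          (ZMod.stdAddChar (x.1 * h.2 + y * h.1) : ℂ) * ZMod.stdAddChar (-(y * x.2)) =
            ZMod.stdAddChar (x.1 * h.2) * ZMod.stdAddChar (y * (h.1 - x.2)) := by
        intro y
        rw [← AddChar.map_add_eq_mul, ← AddChar.map_add_eq_mul]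
        congr 1
        ring
      simp only [if_true, smul_eq_mul, key, ← Finset.mul_sum]
      rw [AddChar.sum_mulShift _ (ZMod.isPrimitive_stdAddChar N)]
      by_cases hx : x.2 = h.1
      · simp [ModularGroup.coe_S, hx, ZMod.card]
        field_simp
        rw [mul_comm]
      · have : h.1 - x.2 ≠ 0 := fun e => hx (sub_eq_zero.mp e).symm
        simp [ModularGroup.coe_S, hx, this]
    · intro y _ hy
      simp [Ne.symm hy]
    · simp

/-- The Weil representation `ρ_{-L}` of `SL₂(ℤ)` on `ℂ[L^*/L]`. -/
noncomputable def weilRepNeg (N : ℕ) [NeZero N] :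
    Representation ℂ SL(2, ℤ) (DiscGroup N → ℂ) :=
  (existsUnique_weilRepNeg N).choose

theorem weilRepNeg_spec (N : ℕ) [NeZero N] : IsWeilRepNeg N (weilRepNeg N) :=
  (existsUnique_weilRepNeg N).choose_spec.1

/-! ### The lattice, the quadratic space, and the kernel functions -/

/-- `e(a) = exp(2πia)`. -/
noncomputable def expTwoPiI (a : ℂ) : ℂ := Complex.exp (2 * Real.pi * Complex.I * a)

/-- The bilinear form `B(X, Y)` on `V_ℝ = ℝ²` with `B(X, X) / 2 = Q(X) = x₁x₂/N`. -/
noncomputable def bilin (N : ℕ) (X Y : ℝ × ℝ) : ℝ := (X.1 * Y.2 + X.2 * Y.1) / N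

/-- `W_t = √(N/2) (t, 1/t)`. -/
noncomputable def vecW (N : ℕ) (t : ℝ) : ℝ × ℝ := (√(N / 2) * t, √(N / 2) * (1 / t))

/-- `Z_t = √(N/2) (t, -1/t)`, a point of the hyperbola `B(Z, Z) = -1`. -/
noncomputable def vecZ (N : ℕ) (t : ℝ) : ℝ × ℝ := (√(N / 2) * t, √(N / 2) * (-1 / t))

/-- The isometry `ι_t : V_ℝ → ℝ^{1,1}`, `X ↦ (B(X, W_t), B(X, Z_t))`. -/
noncomputable def iota (N : ℕ) (t : ℝ) (X : ℝ × ℝ) : ℝ × ℝ :=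
  (bilin N X (vecW N t), bilin N X (vecZ N t))

/-- The error function. -/
noncomputable def erf (x : ℝ) : ℝ := 2 / √Real.pi * ∫ r in (0 : ℝ)..x, Real.exp (-r ^ 2)

/-- The incomplete Gamma function `Γ(s, x) = ∫_x^∞ r^{s-1} e^{-r} dr`. -/
noncomputable def incompleteGamma (s x : ℝ) : ℝ :=
  ∫ r in Set.Ioi x, r ^ (s - 1) * Real.exp (-r)

/-- `φ_τ(x, y) = √(2v) x e(x²τ/2 - y²τ̄/2)`, where `v = Im τ`. -/
noncomputable def phi (τ : ℂ) (p : ℝ × ℝ) : ℂ :=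
  (√(2 * τ.im) : ℝ) * (p.1 : ℂ) *
    expTwoPiI ((p.1 : ℂ) ^ 2 / 2 * τ - (p.2 : ℂ) ^ 2 / 2 * (starRingEnd ℂ) τ)

/-- `φ*_τ(x, y) = e((y² - x²)τ/2) (sgn(x) - erf(√(2πv) x))`. -/
noncomputable def phiStar (τ : ℂ) (p : ℝ × ℝ) : ℂ :=
  expTwoPiI (((p.2 : ℂ) ^ 2 - (p.1 : ℂ) ^ 2) / 2 * τ) *
    ((Real.sign p.1 - erf (√(2 * Real.pi * τ.im) * p.1) : ℝ) : ℂ)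

open Classical in
/-- `φ⁺_τ(x, y) = e((y² - x²)τ/2) sgn(x) 1_{y² > x²}`. -/
noncomputable def phiPlus (τ : ℂ) (p : ℝ × ℝ) : ℂ :=
  expTwoPiI (((p.2 : ℂ) ^ 2 - (p.1 : ℂ) ^ 2) / 2 * τ) * ((Real.sign p.1 : ℝ) : ℂ) *
    (if p.1 ^ 2 < p.2 ^ 2 then 1 else 0)

/-- `φ̃_τ = φ⁺_τ - φ*_τ`. -/
noncomputable def phiTilde (τ : ℂ) (p : ℝ × ℝ) : ℂ := phiPlus τ p - phiStar τ p

/-- The coset `L + h ⊆ L^* = ℤ²`. -/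
def latticeCoset {N : ℕ} (h : DiscGroup N) : Set (ℤ × ℤ) :=
  {X | (X.1 : ZMod N) = h.1 ∧ (X.2 : ZMod N) = h.2}

/-- The inclusion `L^* = ℤ² ⊆ V_ℝ = ℝ²`. -/
def toRealVec (X : ℤ × ℤ) : ℝ × ℝ := ((X.1 : ℝ), (X.2 : ℝ))

/-! ### Fourier coefficients -/

/-- The vectors `X` of `L + h` with `Q(X) = n`. -/
def vectorsOfNorm {N : ℕ} (h : DiscGroup N) (n : ℚ) : Set (ℤ × ℤ) :=
  {X | X ∈ latticeCoset h ∧ ((X.1 : ℚ) * (X.2 : ℚ)) / (N : ℚ) = n}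

/-- For `n ≠ 0` there are only finitely many vectors in `L + h` of norm `n`, so that the sums
over them below are finite sums. -/
theorem finite_vectorsOfNorm {N : ℕ} [NeZero N] (h : DiscGroup N) {n : ℚ} (hn : n ≠ 0) :
    (vectorsOfNorm h n).Finite := by
  have hN : (N : ℚ) ≠ 0 := NeZero.ne _
  have hb : ∀ {a b : ℤ}, (a : ℚ) * b / N = n → |a| ≤ ⌊|n * N|⌋ := by
    intro a b hab
    have e : (a : ℚ) * b = n * N := by
      rw [← hab]
      field_simp
    have hb0 : b ≠ 0 := by
      rintro rfl
      simp at hab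
      exact hn hab.symm
    have h1 : (1 : ℚ) ≤ |(b : ℚ)| := by exact_mod_cast Int.one_le_abs hb0
    rw [Int.le_floor, ← e, abs_mul]
    push_cast
    nlinarith [abs_nonneg (a : ℚ)]
  refine ((Set.finite_Icc (-⌊|n * N|⌋) ⌊|n * N|⌋).prod
    (Set.finite_Icc (-⌊|n * N|⌋) ⌊|n * N|⌋)).subset ?_
  rintro ⟨a, b⟩ ⟨-, hX⟩
  exact ⟨abs_le.mp (hb hX), abs_le.mp (hb (by rw [mul_comm]; exact hX))⟩

/-- `⟨x⟩ ∈ (0, 1]` with `x - ⟨x⟩ ∈ ℤ`. -/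
noncomputable def fracPart (x : ℚ) : ℚ := toIocMod (zero_lt_one (α := ℚ)) 0 x

/-- `⟨x / N⟩ ∈ (0, 1]` for a residue class `x` modulo `N`. -/
noncomputable def fracDiv {N : ℕ} (x : ZMod N) : ℚ := fracPart ((x.val : ℚ) / (N : ℚ))

open Classical in
/-- The coefficients `c_h(n)`, for rational `n ≥ 0`. -/
noncomputable def coeffC {N : ℕ} (h : DiscGroup N) (n : ℚ) : ℚ :=
  if n = 0 then
    if h.1 ≠ 0 ∧ h.2 = 0 then 1 / 2 - fracDiv h.1
    else if h.1 = 0 ∧ h.2 ≠ 0 then 1 / 2 - fracDiv h.2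
    else 0
  else ∑ᶠ X ∈ vectorsOfNorm h n, ((Int.sign X.1 : ℤ) : ℚ)

open Classical in
/-- The coefficients `c̃_h(n)`, for rational `n ≥ 0`. -/
noncomputable def coeffCTilde {N : ℕ} (h : DiscGroup N) (n : ℚ) : ℝ :=
  if n = 0 then
    if h.2 = 0 then
      (coeffC h 0 : ℝ) * (Real.log (Real.pi * N) - deriv Real.Gamma (1 / 2) / Real.Gamma (1 / 2))
        - Real.log (Real.Gamma (fracDiv h.1)) + Real.log (Real.Gamma (fracDiv (-h.1)))
    else if h.1 = 0 then
      (coeffC h 0 : ℝ) * (Real.log (Real.pi * N) - deriv Real.Gamma (1 / 2) / Real.Gamma (1 / 2))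
        - Real.log (Real.Gamma (fracDiv h.2)) + Real.log (Real.Gamma (fracDiv (-h.2)))
    else 0
  else ∑ᶠ X ∈ vectorsOfNorm h (-n),
    ((Int.sign X.1 : ℤ) : ℝ) * Real.log |(X.1 : ℝ) / (X.2 : ℝ)|

/-! ### Theta kernels and their regularized integrals -/

/-- `Θ_h(τ, t) = ∑_{X ∈ L + h} φ_τ(ι_t(X))`. -/
noncomputable def thetaKernel (N : ℕ) (τ : ℂ) (t : ℝ) (h : DiscGroup N) : ℂ :=
  ∑' X : latticeCoset h, phi τ (iota N t (toRealVec X))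

/-- `Θ̃_h(τ, t) = c_h(0) + ∑_{X ∈ L + h} φ̃_τ(ι_t(X))`. -/
noncomputable def thetaKernelTilde (N : ℕ) (τ : ℂ) (t : ℝ) (h : DiscGroup N) : ℂ :=
  (coeffC h 0 : ℂ) + ∑' X : latticeCoset h, phiTilde τ (iota N t (toRealVec X))

/-- `∫_0^1 f(t) t^s dt/t + ∫_1^∞ f(t) t^{-s} dt/t`. -/
noncomputable def regIntegral (f : ℝ → ℂ) (s : ℂ) : ℂ :=
  (∫ t in Set.Ioc (0 : ℝ) 1, f t * (t : ℂ) ^ s / (t : ℂ)) +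
    ∫ t in Set.Ioi (1 : ℝ), f t * (t : ℂ) ^ (-s) / (t : ℂ)

/-- Absolute convergence of the two integrals in `regIntegral f s`. -/
def RegIntegralConverges (f : ℝ → ℂ) (s : ℂ) : Prop :=
  MeasureTheory.IntegrableOn (fun t : ℝ => f t * (t : ℂ) ^ s / (t : ℂ)) (Set.Ioc 0 1) ∧
    MeasureTheory.IntegrableOn (fun t : ℝ => f t * (t : ℂ) ^ (-s) / (t : ℂ)) (Set.Ioi 1)

/-- `a` is the constant term at `s = 0` of (the meromorphic continuation to `ℂ` of) the function
`g`, given on a right half-plane: for some polynomial `P` without constant term (`P(1/s)` being the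
principal part at `0` of the continuation `F`), `F(s) - P(1/s) → a` for `s → 0`. -/
def IsConstTermAtZero (g : ℂ → ℂ) (a : ℂ) : Prop :=
  ∃ F : ℂ → ℂ, MeromorphicOn F Set.univ ∧ (∃ σ : ℝ, ∀ s : ℂ, σ < s.re → F s = g s) ∧
    ∃ P : Polynomial ℂ, P.coeff 0 = 0 ∧
      Filter.Tendsto (fun s : ℂ => F s - P.eval s⁻¹) (nhdsWithin 0 {0}ᶜ) (nhds a)

/-- The constant term is unique. -/
theorem IsConstTermAtZero.unique {g : ℂ → ℂ} {a b : ℂ} (ha : IsConstTermAtZero g a)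
    (hb : IsConstTermAtZero g b) : a = b := by
  obtain ⟨F, hF, ⟨σ, hσ⟩, P, hP, hPa⟩ := ha
  obtain ⟨G, hG, ⟨σ', hσ'⟩, R, hR, hRb⟩ := hb
  have hD : MeromorphicOn (F - G) Set.univ := hF.sub hG
  have h0 : ∀ᶠ s in nhdsWithin (0 : ℂ) {0}ᶜ, (F - G) s = 0 := by
    rw [← meromorphicOrderAt_eq_top_iff]
    by_contra hne
    have h1 := hD.meromorphicOrderAt_ne_top_of_isPreconnected (x := 0)
      (y := ((max σ σ' + 1 : ℝ) : ℂ)) isPreconnected_univ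
      (Set.mem_univ _) (Set.mem_univ _) hne
    apply h1
    rw [meromorphicOrderAt_eq_top_iff]
    apply Filter.Eventually.filter_mono nhdsWithin_le_nhds
    have ho : IsOpen {s : ℂ | max σ σ' < s.re} := isOpen_lt continuous_const Complex.continuous_re
    have hm : ((max σ σ' + 1 : ℝ) : ℂ) ∈ {s : ℂ | max σ σ' < s.re} := by
      change max σ σ' < ((max σ σ' + 1 : ℝ) : ℂ).re
      rw [Complex.ofReal_re]
      linarith
    filter_upwards [ho.mem_nhds hm] with s hs
    have hs' : max σ σ' < s.re := hs
    simp [hσ s (lt_of_le_of_lt (le_max_left _ _) hs'),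
      hσ' s (lt_of_le_of_lt (le_max_right _ _) hs')]
  have hT : Filter.Tendsto (fun s : ℂ => (R - P).eval s⁻¹) (nhdsWithin 0 {0}ᶜ)
      (nhds (a - b)) := by
    refine (hPa.sub hRb).congr' ?_
    filter_upwards [h0] with s hs
    have : F s = G s := sub_eq_zero.mp hs
    simp [this]
  have hdeg : ¬ 0 < (R - P).degree := by
    intro hd
    have h2 := Polynomial.tendsto_norm_atTop (R - P) hd
      (tendsto_norm_cobounded_atTop.comp (Filter.tendsto_inv₀_nhdsNE_zero (α := ℂ)))
    exact not_tendsto_nhds_of_tendsto_atTop h2 _ hT.norm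
  have hC : R - P = 0 := by
    rw [Polynomial.eq_C_of_degree_le_zero (not_lt.mp hdeg)]
    simp [hP, hR]
  rw [hC] at hT
  simp only [Polynomial.eval_zero] at hT
  exact (sub_eq_zero.mp (tendsto_nhds_unique tendsto_const_nhds hT).symm)

/-- The constant term `Const_{s=0} g(s)`. -/
noncomputable def constTermAtZero (g : ℂ → ℂ) : ℂ := Classical.epsilon (IsConstTermAtZero g)

/-- `ϑ_h(τ) = Const_{s=0} ϑ_h(τ, s)`. -/
noncomputable def vartheta (N : ℕ) (τ : ℂ) (h : DiscGroup N) : ℂ :=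
  constTermAtZero (regIntegral fun t => thetaKernel N τ t h)

/-- `ϑ̃_h(τ) = Const_{s=0} ϑ̃_h(τ, s)`. -/
noncomputable def varthetaTilde (N : ℕ) (τ : ℂ) (h : DiscGroup N) : ℂ :=
  constTermAtZero (regIntegral fun t => thetaKernelTilde N τ t h)

/-! ### Harmonic Maass forms

Functions on the upper half-plane are written as functions on `ℂ` that are only considered at
points with positive imaginary part. -/

/-- `∂f/∂τ̄ = (∂f/∂u + i ∂f/∂v) / 2`. -/
noncomputable def dbar (f : ℂ → ℂ) (τ : ℂ) : ℂ :=
  (fderiv ℝ f τ 1 + Complex.I * fderiv ℝ f τ Complex.I) / 2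

/-- `ξ_k(f) = 2i v^k conj(∂f/∂τ̄)`. -/
noncomputable def xiOp (k : ℤ) (f : ℂ → ℂ) (τ : ℂ) : ℂ :=
  2 * Complex.I * (τ.im : ℂ) ^ k * (starRingEnd ℂ) (dbar f τ)

/-- The weight `k` hyperbolic Laplacian `Δ_k = -ξ_{2-k} ∘ ξ_k`. -/
noncomputable def hypLaplacian (k : ℤ) (f : ℂ → ℂ) (τ : ℂ) : ℂ :=
  -xiOp (2 - k) (xiOp k f) τ

/-- Vector-valued harmonic Maass forms of weight `k` for a representation `ρ` of `SL₂(ℤ)`. -/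
structure IsHarmonicMaassForm {ι : Type*} (k : ℤ) (ρ : Representation ℂ SL(2, ℤ) (ι → ℂ))
    (F : ℂ → ι → ℂ) : Prop where
  realAnalytic : ∀ h, AnalyticOnNhd ℝ (fun τ => F τ h) {τ : ℂ | 0 < τ.im}
  modular : ∀ (γ : SL(2, ℤ)) (τ : UpperHalfPlane),
    F ((γ • τ : UpperHalfPlane) : ℂ) =
      (((γ 1 0 : ℤ) : ℂ) * (τ : ℂ) + ((γ 1 1 : ℤ) : ℂ)) ^ k • ρ γ (F (τ : ℂ))
  harmonic : ∀ h, ∀ τ : ℂ, 0 < τ.im → hypLaplacian k (fun z => F z h) τ = 0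
  /-- At most linear exponential growth at the cusp: `F_h(τ) = O(e^{Cv})` as `v → ∞`, uniformly
  in `u`. -/
  growth : ∃ C : ℝ, ∀ h,
    Asymptotics.IsBigO (Filter.comap Complex.im Filter.atTop) (fun τ => F τ h)
      (fun τ : ℂ => Real.exp (C * τ.im))

section

open MeasureTheory Set Filter Topology Asymptotics

/-! ### Mellin transforms of rapidly decaying functions and regularized integrals -/

/-! Put `κ = √(πv/N)`. Along `ι_t` both kernels split into a unimodular phase `e(±x₁x₂u/N)` and a
real function of `κ, x, y, t` (`phi_iota`, `phiTilde_iota`). The real factor of `φ̃` is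
`e^{2κ²xy}(erf(κ(x/t + yt)) - σ)`, where the sign `σ` depends on `x, y` but not on `t`. Hence `t
∂/∂t` removes the sign and leaves a linear form times a Gaussian (`hasDerivAt_tildeTerm`). The
results on `ϑ̃` rest on the smooth kernel `Ψ = t ∂Θ̃/∂t` (`psiKernel`).

Regularization. Suppose that `f` tends rapidly to `E` at `0` and to `-E` at `∞`. The pieces over
`(0,1]` and `(1,∞)` then contribute `E/s` and `-E/s`, which cancel. So the continuation is entire,
and its value at `0` is a convergent integral. Integration by parts against `log t` turns this value
into `-∫ log t · (t f'(t)) dt/t` (`hasRegConst_of_hasDerivAt`). The constant `c_h(0)` is what makes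
the limits of `Θ̃_h` at `0` and `∞` opposite. The outcome is `ϑ̃_h = -∫ log t · Ψ_h dt/t`
(`varthetaTilde_eq`), while `Θ_h` itself decays rapidly at both ends.

Modularity. Poisson summation in `x₂` alone turns `Ψ` into a sum over pairs `(c,d)` of `conj(cτ+d)
exp(-π|cτ+d|²/(Nvt²))`, up to a factor `-2i/(Nvt²)` (`psiKernel_eq_sum_eisKernel`). In this form
`SL₂(ℤ)` only permutes the pairs and produces a factor of weight one (`eisTerm_smul`). A partial
Fourier transform on `(ℤ/N)²` conjugates the translation action into the Weil representation
(`isWeilRepNeg_conj`). For each `t` the vector `Ψ` therefore transforms with weight one, and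
integration against `log t dt/t` preserves this (`varthetaTilde_smul`).

Fourier expansion. The integral is computed term by term after the substitution `t = √|x/y| e^s`.
Vectors with `xy < 0` give `log|x/y| q^{-Q}`, those with `xy > 0` give an incomplete Gamma function
(`mellin_log_psiTerm`). Vectors on the axes give the odd Hurwitz zeta function and its derivative at
`0` (`axisConst_eq`), hence the Gamma values and the term `c_h(0) log v`. Grouping by the norm gives
the `q`-series.

The operator `ξ`. In the expansion only `log v` and the incomplete Gamma terms are non-holomorphic.
Their `∂/∂τ̄` sums to `i/(2v)` times the conjugate of the `q`-expansion of `ϑ_h`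
(`dbar_varthetaTilde`), so `ξ₁ ϑ̃_h = ϑ_h`. Since `ϑ_h` is holomorphic, `Δ₁ ϑ̃_h = 0`. Real
analyticity is obtained by writing the non-holomorphic series as an inner product of two analytic
`ℓ²`-valued maps (`analyticAt_tsum_mul`). -/

/-- Local integrability on `(0, ∞)` and decay at `0` and at `∞` faster than every power. -/
structure RapidDecay (f : ℝ → ℂ) : Prop where
  locallyIntegrableOn : LocallyIntegrableOn f (Ioi 0)
  atTop : ∀ r : ℝ, f =O[atTop] fun t => t ^ (-r)
  zero : ∀ r : ℝ, f =O[𝓝[>] 0] fun t => t ^ (-r)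

namespace RapidDecay

variable {f g : ℝ → ℂ}

theorem add (hf : RapidDecay f) (hg : RapidDecay g) : RapidDecay (fun t => f t + g t) :=
  ⟨hf.1.add hg.1, fun r => (hf.2 r).add (hg.2 r), fun r => (hf.3 r).add (hg.3 r)⟩

theorem const_mul (hf : RapidDecay f) (c : ℂ) : RapidDecay (fun t => c * f t) :=
  ⟨fun x hx => by
    obtain ⟨s, hs, h⟩ := hf.1 x hx
    exact ⟨s, hs, h.const_mul c⟩, fun r => (hf.2 r).const_mul_left c,
    fun r => (hf.3 r).const_mul_left c⟩

theorem congr (hf : RapidDecay f) (h : ∀ t, 0 < t → f t = g t) : RapidDecay g := by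
  refine ⟨fun x hx => ?_, fun r => (hf.2 r).congr' ?_ EventuallyEq.rfl,
    fun r => (hf.3 r).congr' ?_ EventuallyEq.rfl⟩
  · obtain ⟨s, hs, hi⟩ := hf.1 x hx
    refine ⟨s ∩ Ioi 0, inter_mem hs self_mem_nhdsWithin, ?_⟩
    have h1 : IntegrableOn f (s ∩ Ioi 0) := hi.mono_set inter_subset_left
    refine h1.congr ?_
    have : ∀ᵐ x ∂volume.restrict (Ioi (0 : ℝ)), f x = g x :=
      (ae_restrict_mem measurableSet_Ioi).mono fun x hx => h x hx
    exact ae_mono (Measure.restrict_mono inter_subset_right le_rfl) this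
  · filter_upwards [eventually_gt_atTop 0] with t ht using h t ht
  · filter_upwards [self_mem_nhdsWithin] with t ht using h t ht

theorem mellinConvergent (hf : RapidDecay f) (s : ℂ) : MellinConvergent f s :=
  mellinConvergent_of_isBigO_rpow hf.1 (hf.2 (s.re + 1)) (by linarith) (hf.3 (s.re - 1))
    (by linarith)

theorem differentiable_mellin (hf : RapidDecay f) : Differentiable ℂ (mellin f) := fun s =>
  mellin_differentiableAt_of_isBigO_rpow hf.1 (hf.2 (s.re + 1)) (by linarith) (hf.3 (s.re - 1))
    (by linarith)

theorem hasDerivAt_mellin (hf : RapidDecay f) (s : ℂ) :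
    HasDerivAt (mellin f) (mellin (fun t => Real.log t • f t) s) s :=
  (mellin_hasDerivAt_of_isBigO_rpow hf.1 (hf.2 (s.re + 1)) (by linarith) (hf.3 (s.re - 1))
    (by linarith)).2

theorem log_smul (hf : RapidDecay f) : RapidDecay (fun t => Real.log t • f t) := by
  refine ⟨?_, fun r => isBigO_rpow_top_log_smul (lt_add_one r) (hf.2 _),
    fun r => isBigO_rpow_zero_log_smul (sub_one_lt r) (hf.3 _)⟩
  exact hf.1.continuousOn_smul isOpen_Ioi.isLocallyClosed
    (Real.continuousOn_log.mono fun x hx => ne_of_gt hx)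

theorem integrableOn_div (hf : RapidDecay f) : IntegrableOn (fun t => f t / (t : ℂ)) (Ioi 0) := by
  refine (hf.mellinConvergent 0).congr_fun (fun t ht => ?_) measurableSet_Ioi
  simp only [zero_sub, Complex.cpow_neg_one, smul_eq_mul]
  rw [div_eq_inv_mul]

theorem comp_inv (hf : RapidDecay f) (hc : ContinuousOn f (Ioi 0)) :
    RapidDecay (fun t => f t⁻¹) := by
  refine ⟨ContinuousOn.locallyIntegrableOn (hc.comp (continuousOn_inv₀.mono fun x hx => ?_) ?_)
    measurableSet_Ioi, fun r => ?_, fun r => ?_⟩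
  · exact ne_of_gt hx
  · intro x hx
    exact inv_pos.2 (mem_Ioi.1 hx)
  · refine ((hf.3 (-r)).comp_tendsto tendsto_inv_atTop_nhdsGT_zero).congr' (by rfl) ?_
    filter_upwards [eventually_gt_atTop 0] with t ht
    simp [Real.inv_rpow ht.le, Real.rpow_neg ht.le]
  · refine ((hf.2 (-r)).comp_tendsto tendsto_inv_nhdsGT_zero).congr' (by rfl) ?_
    filter_upwards [self_mem_nhdsWithin] with t ht
    simp [Real.inv_rpow (le_of_lt ht), Real.rpow_neg (le_of_lt ht)]

theorem indicator (hf : RapidDecay f) {s : Set ℝ} (hs : MeasurableSet s) :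
    RapidDecay (s.indicator f) := by
  refine ⟨fun x hx => ?_, fun r => ?_, fun r => ?_⟩
  · obtain ⟨u, hu, h⟩ := hf.1 x hx
    exact ⟨u, hu, h.indicator hs⟩
  · exact (IsBigO.of_bound 1 (Eventually.of_forall fun t => by
      simpa using norm_indicator_le_norm_self f t)).trans (hf.2 r)
  · exact (IsBigO.of_bound 1 (Eventually.of_forall fun t => by
      simpa using norm_indicator_le_norm_self f t)).trans (hf.3 r)

end RapidDecay

theorem mellin_zero_eq (f : ℝ → ℂ) : mellin f 0 = ∫ t in Ioi (0 : ℝ), f t / (t : ℂ) := by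
  rw [mellin]
  refine setIntegral_congr_fun measurableSet_Ioi fun t _ => ?_
  simp only [zero_sub, Complex.cpow_neg_one, smul_eq_mul]
  rw [div_eq_inv_mul]

/-- The function with value `E` on `(-∞, 1]` and `-E` on `(1, ∞)`. -/
noncomputable def signStep (E : ℂ) (t : ℝ) : ℂ := if t ≤ 1 then E else -E

/-- `f` tends rapidly to `E` at `0` and to `-E` at `∞`, and its regularized integral has the
value `a` at `s = 0`. -/
structure HasRegConst (f : ℝ → ℂ) (E a : ℂ) : Prop where
  rapidDecay : RapidDecay (fun t => f t - signStep E t)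
  eq : mellin (fun t => f t - signStep E t) 0 = a

namespace HasRegConst

variable {f g : ℝ → ℂ} {E E' a b : ℂ}

theorem add (hf : HasRegConst f E a) (hg : HasRegConst g E' b) :
    HasRegConst (fun t => f t + g t) (E + E') (a + b) := by
  have e : ∀ t, (f t - signStep E t) + (g t - signStep E' t) =
      f t + g t - signStep (E + E') t := by
    intro t; unfold signStep; split_ifs <;> ring
  refine ⟨(hf.1.add hg.1).congr fun t _ => e t, ?_⟩
  rw [← hf.2, ← hg.2, ← (hasMellin_add (hf.1.mellinConvergent 0) (hg.1.mellinConvergent 0)).2]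
  simp only [e]

theorem congr (hf : HasRegConst f E a) (h : ∀ t, 0 < t → f t = g t) : HasRegConst g E a := by
  refine ⟨hf.1.congr fun t ht => by rw [h t ht], ?_⟩
  rw [← hf.2, mellin, mellin]
  refine setIntegral_congr_fun measurableSet_Ioi fun t ht => ?_
  simp only [h t ht]

theorem _root_.RapidDecay.hasRegConst (hf : RapidDecay f) : HasRegConst f 0 (mellin f 0) := by
  have e : ∀ t, f t - signStep 0 t = f t := by intro t; simp [signStep]
  exact ⟨hf.congr fun t _ => (e t).symm, by simp only [e]⟩

/-- The step function contributes `E ∫_0^1 t^{s-1} dt = E/s`; what remains decays rapidly and is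
entire in `s`. -/
theorem integrableOn_Ioc (hf : HasRegConst f E a) {s : ℂ} (hs : 0 < s.re) :
    IntegrableOn (fun t : ℝ => f t * (t : ℂ) ^ s / (t : ℂ)) (Ioc 0 1) ∧
    (∫ t in Ioc (0 : ℝ) 1, f t * (t : ℂ) ^ s / (t : ℂ)) =
      mellin ((Ioc 0 1).indicator fun t => f t - signStep E t) s + E / s := by
  have h1 := (hf.1.indicator (measurableSet_Ioc (a := (0:ℝ)) (b := 1))).mellinConvergent s
  have h2 := hasMellin_const_smul (hasMellin_one_Ioc hs).1 E
  have h3 := hasMellin_add h1 h2.1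
  have key : ∀ t : ℝ, (t : ℂ) ^ (s - 1) • ((Ioc 0 1).indicator (fun t => f t - signStep E t) t +
      E • (Ioc (0:ℝ) 1).indicator (fun _ => (1:ℂ)) t) =
      (Ioc (0:ℝ) 1).indicator (fun t : ℝ => f t * (t : ℂ) ^ s / (t : ℂ)) t := by
    intro t
    by_cases ht : t ∈ Ioc (0:ℝ) 1
    · have : (t : ℂ) ≠ 0 := by exact_mod_cast ht.1.ne'
      simp only [indicator_of_mem ht, signStep, if_pos ht.2, smul_eq_mul,
        Complex.cpow_sub _ _ this, Complex.cpow_one]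
      ring
    · simp [indicator_of_notMem ht]
  constructor
  · have := h3.1
    simp only [MellinConvergent, key] at this
    rw [IntegrableOn, integrable_indicator_iff measurableSet_Ioc, IntegrableOn,
      Measure.restrict_restrict_of_subset Ioc_subset_Ioi_self] at this
    exact this
  · have := h3.2
    rw [h2.2, (hasMellin_one_Ioc hs).2, mellin] at this
    simp only [key] at this
    rw [integral_indicator measurableSet_Ioc,
      Measure.restrict_restrict_of_subset Ioc_subset_Ioi_self] at this
    rw [this, smul_eq_mul, mul_one_div]

/-- Here the limit is `-E`, so that the polar part is `-E/s`, the opposite of the one over `(0, 1]`.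
-/
theorem integrableOn_Ioi (hf : HasRegConst f E a) {s : ℂ} (hs : 0 < s.re) :
    IntegrableOn (fun t : ℝ => f t * (t : ℂ) ^ (-s) / (t : ℂ)) (Ioi 1) ∧
    (∫ t in Ioi (1 : ℝ), f t * (t : ℂ) ^ (-s) / (t : ℂ)) =
      mellin ((Ioi 1).indicator fun t => f t - signStep E t) (-s) - E / s := by
  have h1 := (hf.1.indicator (measurableSet_Ioi (a := (1:ℝ)))).mellinConvergent (-s)
  have hre : (-s - 1).re < -1 := by simp; linarith
  have h2 : IntegrableOn (fun t : ℝ => (t : ℂ) ^ (-s - 1)) (Ioi 1) :=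
    integrableOn_Ioi_cpow_of_lt hre one_pos
  have h2' := integral_Ioi_cpow_of_lt hre one_pos
  have h1' : IntegrableOn (fun t : ℝ => (t : ℂ) ^ (-s - 1) * (f t - signStep E t)) (Ioi 1) := by
    simp only [MellinConvergent, ← indicator_smul] at h1
    rw [IntegrableOn, integrable_indicator_iff measurableSet_Ioi, IntegrableOn,
      Measure.restrict_restrict_of_subset (Ioi_subset_Ioi zero_le_one)] at h1
    exact h1
  have key : ∀ t ∈ Ioi (1 : ℝ), (t : ℂ) ^ (-s - 1) * (f t - signStep E t) +
      (t : ℂ) ^ (-s - 1) * (-E) = f t * (t : ℂ) ^ (-s) / (t : ℂ) := by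
    intro t ht
    have ht' : (1 : ℝ) < t := ht
    have : (t : ℂ) ≠ 0 := by exact_mod_cast (by linarith : t ≠ 0)
    simp only [signStep, if_neg (not_le.2 ht'), Complex.cpow_sub _ _ this, Complex.cpow_one]
    ring
  have hs0 : s ≠ 0 := by rintro rfl; simp at hs
  refine ⟨(h1'.add (h2.mul_const (-E))).congr_fun key measurableSet_Ioi, ?_⟩
  rw [← setIntegral_congr_fun measurableSet_Ioi key, integral_add h1' (h2.mul_const (-E)),
    integral_mul_const, h2', mellin]
  simp only [← indicator_smul]
  rw [integral_indicator measurableSet_Ioi,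
      Measure.restrict_restrict_of_subset (Ioi_subset_Ioi zero_le_one)]
  simp only [smul_eq_mul, Complex.ofReal_one, Complex.one_cpow, sub_add_cancel]
  field_simp
  ring

theorem converges (hf : HasRegConst f E a) {s : ℂ} (hs : 0 < s.re) : RegIntegralConverges f s :=
  ⟨(hf.integrableOn_Ioc hs).1, (hf.integrableOn_Ioi hs).1⟩

/-- The two polar parts `±E/s` cancel. At `s = 0` the two truncated Mellin transforms recombine into
one integral over `(0, ∞)`. -/
theorem exists_continuation (hf : HasRegConst f E a) :
    ∃ F : ℂ → ℂ, Differentiable ℂ F ∧ (∀ s : ℂ, 0 < s.re → F s = regIntegral f s) ∧ F 0 = a := by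
  have d1 := hf.1.indicator (measurableSet_Ioc (a := (0:ℝ)) (b := 1))
  have d2 := hf.1.indicator (measurableSet_Ioi (a := (1:ℝ)))
  refine ⟨fun s => mellin ((Ioc 0 1).indicator fun t => f t - signStep E t) s +
    mellin ((Ioi 1).indicator fun t => f t - signStep E t) (-s), ?_, fun s hs => ?_, ?_⟩
  · exact d1.differentiable_mellin.add (d2.differentiable_mellin.comp differentiable_neg)
  · rw [regIntegral, (hf.integrableOn_Ioc hs).2, (hf.integrableOn_Ioi hs).2]
    ring
  · simp only [neg_zero]
    rw [← (hasMellin_add (d1.mellinConvergent 0) (d2.mellinConvergent 0)).2, ← hf.2, mellin, mellin]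
    refine setIntegral_congr_fun measurableSet_Ioi fun t ht => ?_
    have ht' : (0 : ℝ) < t := ht
    by_cases h : t ≤ 1
    · simp [indicator, h, ht']
    · simp [indicator, h, not_le.1 h]

theorem isConstTermAtZero (hf : HasRegConst f E a) : IsConstTermAtZero (regIntegral f) a := by
  obtain ⟨F, hF, hs, h0⟩ := hf.exists_continuation
  refine ⟨F, fun z _ => (hF.analyticAt z).meromorphicAt, ⟨0, hs⟩, 0, by simp, ?_⟩
  simp only [Polynomial.eval_zero, sub_zero, ← h0]
  exact (hF 0).continuousAt.tendsto.mono_left nhdsWithin_le_nhds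

theorem constTermAtZero_eq (hf : HasRegConst f E a) : constTermAtZero (regIntegral f) = a :=
  (Classical.epsilon_spec ⟨a, hf.isConstTermAtZero⟩ :
    IsConstTermAtZero _ (constTermAtZero (regIntegral f))).unique hf.isConstTermAtZero

end HasRegConst

/-- If `t f'(t)` decays rapidly at `0`, then `f` converges rapidly at `0`. -/
theorem isBigO_zero_of_hasDerivAt {f k : ℝ → ℂ} {E : ℂ}
    (hd : ∀ t, 0 < t → HasDerivAt f (k t / t) t)
    (hk : ∀ r : ℝ, k =O[𝓝[>] 0] fun t => t ^ (-r)) (hE : Tendsto f (𝓝[>] 0) (𝓝 E)) (r : ℝ) :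
    (fun t => f t - E) =O[𝓝[>] 0] fun t => t ^ (-r) := by
  -- The exponent is kept at least `1` so that `x ^ (m - 1)` is monotone in the mean value estimate.
  set m : ℝ := max (-r) 1 with hm
  obtain ⟨C, hC0, hC⟩ := (hk (-m)).exists_nonneg
  rw [IsBigOWith, eventually_nhdsWithin_iff, Metric.eventually_nhds_iff] at hC
  obtain ⟨δ, hδ, hC⟩ := hC
  have hb : ∀ t, 0 < t → t < δ → ‖f t - E‖ ≤ C * t ^ m := by
    intro t ht htδ
    -- The mean value inequality is applied on `[ε, t]`, where `f` is differentiable, and then `ε →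
    -- 0`.
    have hlim : Tendsto (fun ε => ‖f t - f ε‖) (𝓝[>] 0) (𝓝 ‖f t - E‖) :=
      (tendsto_const_nhds.sub hE).norm
    refine le_of_tendsto hlim ?_
    filter_upwards [Ioo_mem_nhdsGT ht] with ε hε
    have := (convex_Icc ε t).norm_image_sub_le_of_norm_hasDerivWithin_le (f := f)
      (f' := fun x => k x / x) (C := C * t ^ (m - 1)) (x := ε) (y := t)
      (fun x hx => (hd x (hε.1.trans_le hx.1)).hasDerivWithinAt) ?_
      (left_mem_Icc.2 hε.2.le) (right_mem_Icc.2 hε.2.le)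
    · refine this.trans ?_
      rw [Real.norm_eq_abs, abs_of_pos (sub_pos.2 hε.2)]
      calc C * t ^ (m - 1) * (t - ε) ≤ C * t ^ (m - 1) * t := by
            have : 0 ≤ t ^ (m - 1) := by positivity
            have := hε.1
            gcongr
            linarith
        _ = C * t ^ m := by
            rw [mul_assoc, ← Real.rpow_add_one ht.ne', sub_add_cancel]
    · intro x hx
      have hx0 : 0 < x := hε.1.trans_le hx.1
      have h1 := hC (y := x) (by
        rw [Real.dist_eq, sub_zero, abs_of_pos hx0]
        exact hx.2.trans_lt htδ) hx0
      rw [norm_div, Complex.norm_real, Real.norm_of_nonneg hx0.le, div_le_iff₀ hx0]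
      refine h1.trans ?_
      rw [neg_neg, Real.norm_of_nonneg (by positivity), mul_assoc]
      gcongr
      calc x ^ m = x ^ (m - 1) * x := by rw [← Real.rpow_add_one hx0.ne', sub_add_cancel]
        _ ≤ t ^ (m - 1) * x := by
          gcongr
          · linarith [le_max_right (-r) 1]
          · exact hx.2
  refine IsBigO.of_bound C ?_
  filter_upwards [Ioo_mem_nhdsGT (lt_min hδ one_pos)] with t ht
  refine (hb t ht.1 (ht.2.trans_le (min_le_left _ _))).trans ?_
  rw [Real.norm_of_nonneg (by have := ht.1; positivity)]
  gcongr ?_ * ?_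
  exact Real.rpow_le_rpow_of_exponent_ge ht.1 (ht.2.le.trans (min_le_right _ _)) (le_max_left _ _)

/-- The regularized integral of `f` in terms of the logarithmic derivative. -/
theorem hasRegConst_of_hasDerivAt {f k : ℝ → ℂ} {E : ℂ}
    (hd : ∀ t, 0 < t → HasDerivAt f (k t / t) t) (hk : RapidDecay k)
    (hkc : ContinuousOn k (Ioi 0))
    (h0 : Tendsto f (𝓝[>] 0) (𝓝 E)) (h1 : Tendsto f atTop (𝓝 (-E))) :
    HasRegConst f E (-mellin (fun t => Real.log t • k t) 0) := by
  have hfc : ContinuousOn f (Ioi 0) := fun t ht => (hd t ht).continuousAt.continuousWithinAt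
  have hz := isBigO_zero_of_hasDerivAt hd hk.3 h0
  have hi : ∀ r : ℝ, (fun t => f t + E) =O[atTop] fun t => t ^ (-r) := by
    intro r
    -- The behaviour at `∞` is reduced to that at `0` by `t ↦ t⁻¹`, which changes the sign of the
    -- logarithmic derivative.
    have hd' : ∀ t, 0 < t → HasDerivAt (fun t => f t⁻¹) ((-k t⁻¹) / t) t := by
      intro t ht
      refine ((hd t⁻¹ (inv_pos.2 ht)).scomp t (hasDerivAt_inv ht.ne')).congr_deriv ?_
      have : (t : ℂ) ≠ 0 := by exact_mod_cast ht.ne'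
      rw [Complex.real_smul]
      push_cast
      field_simp
    have := isBigO_zero_of_hasDerivAt hd' (fun r => ((hk.comp_inv hkc).3 r).neg_left)
      (h1.comp tendsto_inv_nhdsGT_zero) (-r)
    refine (this.comp_tendsto tendsto_inv_atTop_nhdsGT_zero).congr' ?_ ?_
    · filter_upwards with t
      simp
    · filter_upwards [eventually_gt_atTop 0] with t ht
      simp [Real.inv_rpow ht.le, Real.rpow_neg ht.le]
  have hms : Measurable (signStep E) :=
    Measurable.ite measurableSet_Iic measurable_const measurable_const
  have hr : RapidDecay (fun t => f t - signStep E t) := by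
    refine ⟨?_, fun r => (hi r).congr' ?_ EventuallyEq.rfl,
      fun r => (hz r).congr' ?_ EventuallyEq.rfl⟩
    · refine (hfc.locallyIntegrableOn measurableSet_Ioi).sub ?_
      refine LocallyIntegrable.locallyIntegrableOn ?_ _
      refine (locallyIntegrable_const ‖E‖).mono hms.aestronglyMeasurable (ae_of_all _ fun t => ?_)
      unfold signStep
      split_ifs <;> simp
    · filter_upwards [eventually_gt_atTop 1] with t ht
      simp [signStep, not_le.2 ht]
    · filter_upwards [Ioo_mem_nhdsGT one_pos] with t ht
      simp [signStep, ht.2.le]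
  refine ⟨hr, ?_⟩
  have i1 := hr.integrableOn_div
  have i2 := hk.log_smul.integrableOn_div
  have i3 : IntegrableOn (fun t : ℝ => (f t - signStep E t) / t + Real.log t • k t / t) (Ioi 0) :=
    i1.add i2
  rw [← add_eq_zero_iff_eq_neg, mellin_zero_eq, mellin_zero_eq, ← integral_add i1 i2,
    ← Ioc_union_Ioi_eq_Ioi zero_le_one, setIntegral_union (Ioc_disjoint_Ioi le_rfl)
    measurableSet_Ioi (i3.mono_set Ioc_subset_Ioi_self)
    (i3.mono_set (Ioi_subset_Ioi zero_le_one))]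
  -- The integrand is the derivative of `(f ± E) log t` on either side of `1`. The boundary terms
  -- vanish at `1` because `log 1 = 0`, and at `0` and `∞` by rapid convergence, so both integrals
  -- are `0`.
  have hlog : ∀ t : ℝ, 0 < t → ∀ c : ℂ,
      HasDerivAt (fun t => (f t + c) * (Real.log t : ℂ))
        ((f t + c) / t + Real.log t • k t / t) t := by
    intro t ht c
    refine (((hd t ht).add_const c).mul
      ((Real.hasDerivAt_log ht.ne').ofReal_comp)).congr_deriv ?_
    rw [Complex.real_smul]
    push_cast
    ring
  have e2 : ∫ t in Ioi (1:ℝ), ((f t - signStep E t) / t + Real.log t • k t / t) = 0 := by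
    have e : ∀ t ∈ Ioi (1:ℝ), (f t - signStep E t) / t + Real.log t • k t / t =
        (f t + E) / t + Real.log t • k t / t := by
      intro t ht
      simp [signStep, not_le.2 (show (1:ℝ) < t from ht)]
    rw [setIntegral_congr_fun measurableSet_Ioi e]
    rw [integral_Ioi_of_hasDerivAt_of_tendsto' (m := 0) (f := fun t => (f t + E) * (Real.log t : ℂ))]
    · simp
    · intro t ht
      exact hlog t (one_pos.trans_le ht) E
    · exact (i3.mono_set (Ioi_subset_Ioi zero_le_one)).congr_fun e measurableSet_Ioi
    · have := (isBigO_rpow_top_log_smul (a := 2) (b := 1) (by norm_num) (hi 2)).trans_tendsto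
        (tendsto_rpow_neg_atTop one_pos)
      refine this.congr fun t => ?_
      rw [Complex.real_smul, mul_comm]
  have e1 : ∫ t in Ioc (0:ℝ) 1, ((f t - signStep E t) / t + Real.log t • k t / t) = 0 := by
    have e : ∀ t ∈ Ioc (0:ℝ) 1, (f t - signStep E t) / t + Real.log t • k t / t =
        (f t + -E) / t + Real.log t • k t / t := by
      intro t ht
      simp [signStep, ht.2, sub_eq_add_neg]
    rw [setIntegral_congr_fun measurableSet_Ioc e, ← intervalIntegral.integral_of_le zero_le_one]
    rw [intervalIntegral.integral_eq_sub_of_hasDerivAt_of_tendsto (fa := 0) (fb := 0)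
      (f := fun t => (f t + -E) * (Real.log t : ℂ)) one_pos]
    · simp
    · intro t ht
      exact hlog t ht.1 (-E)
    · rw [intervalIntegrable_iff_integrableOn_Ioc_of_le zero_le_one]
      exact (i3.mono_set Ioc_subset_Ioi_self).congr_fun e measurableSet_Ioc
    · have h := (isBigO_rpow_zero_log_smul (a := -2) (b := -1) (by norm_num) (hz (-2)))
      have h' : Tendsto (fun t : ℝ => t ^ (-(-1 : ℝ))) (𝓝[>] 0) (𝓝 0) := by
        simp only [neg_neg, Real.rpow_one]
        exact tendsto_nhdsWithin_of_tendsto_nhds tendsto_id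
      refine (h.trans_tendsto h').congr fun t => ?_
      rw [Complex.real_smul, mul_comm, sub_eq_add_neg]
    · have : ContinuousAt (fun t => (f t + -E) * (Real.log t : ℂ)) 1 :=
        (hlog 1 one_pos (-E)).continuousAt
      have h := this.tendsto.mono_left (nhdsWithin_le_nhds (s := Iio 1))
      simpa using h
  rw [e1, e2, add_zero]

/-! ### The error function and some integrals -/

theorem hasDerivAt_erf (x : ℝ) : HasDerivAt erf (2 / √Real.pi * Real.exp (-x ^ 2)) x := by
  have hc : Continuous fun r : ℝ => Real.exp (-r ^ 2) := by fun_prop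
  exact (intervalIntegral.integral_hasDerivAt_right (hc.intervalIntegrable _ _)
    hc.aestronglyMeasurable.stronglyMeasurableAtFilter hc.continuousAt).const_mul _

theorem continuous_erf : Continuous erf :=
  continuous_iff_continuousAt.2 fun x => (hasDerivAt_erf x).continuousAt

@[simp] theorem erf_zero : erf 0 = 0 := by simp [erf]

@[simp] theorem erf_neg (x : ℝ) : erf (-x) = -erf x := by
  have h := intervalIntegral.integral_comp_neg (a := 0) (b := x) fun r : ℝ => Real.exp (-r ^ 2)
  simp only [neg_sq, neg_zero] at h
  rw [erf, erf, h, intervalIntegral.integral_symm (-x) 0]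
  ring

theorem integrable_exp_neg_sq : Integrable fun r : ℝ => Real.exp (-r ^ 2) := by
  simpa using integrable_exp_neg_mul_sq one_pos

theorem integral_Ioi_exp_neg_sq : ∫ r in Ioi (0 : ℝ), Real.exp (-r ^ 2) = √Real.pi / 2 := by
  simpa using integral_gaussian_Ioi 1

theorem tendsto_erf_atTop : Tendsto erf atTop (𝓝 1) := by
  have h := (intervalIntegral_tendsto_integral_Ioi (f := fun r : ℝ => Real.exp (-r ^ 2)) 0
    integrable_exp_neg_sq.integrableOn tendsto_id).const_mul (2 / √Real.pi)
  have h0 : √Real.pi ≠ 0 := (Real.sqrt_pos.2 Real.pi_pos).ne'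
  rw [integral_Ioi_exp_neg_sq, show 2 / √Real.pi * (√Real.pi / 2) = 1 by field_simp] at h
  exact h

theorem tendsto_erf_atBot : Tendsto erf atBot (𝓝 (-1)) := by
  refine (tendsto_erf_atTop.comp tendsto_neg_atBot_atTop).neg.congr fun x => ?_
  simp

theorem integral_Ioi_shift_exp_neg_sq (x : ℝ) :
    ∫ r in Ioi (0 : ℝ), 2 / √Real.pi * Real.exp (-(r + x) ^ 2) = 1 - erf x := by
  rw [integral_Ioi_of_hasDerivAt_of_tendsto' (f := fun r => erf (r + x)) (m := 1)]
  · simp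
  · intro r _
    exact (hasDerivAt_erf (r + x)).comp_add_const r x
  · exact ((integrable_exp_neg_sq.comp_add_right x).const_mul _).integrableOn
  · exact tendsto_erf_atTop.comp (tendsto_atTop_add_const_right _ _ tendsto_id)

theorem erf_le_one (x : ℝ) : erf x ≤ 1 := by
  rw [← sub_nonneg, ← integral_Ioi_shift_exp_neg_sq]
  exact setIntegral_nonneg measurableSet_Ioi fun r _ => by positivity

theorem abs_erf_le_one (x : ℝ) : |erf x| ≤ 1 :=
  abs_le.2 ⟨by have := erf_le_one (-x); rw [erf_neg] at this; linarith, erf_le_one x⟩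

/-- For `r, x ≥ 0` one has `(r + x)² ≥ r² + x²`, and the remaining Gaussian integral has total mass
`1`. -/
theorem one_sub_erf_le {x : ℝ} (hx : 0 ≤ x) : 1 - erf x ≤ Real.exp (-x ^ 2) := by
  rw [← integral_Ioi_shift_exp_neg_sq]
  calc ∫ r in Ioi (0 : ℝ), 2 / √Real.pi * Real.exp (-(r + x) ^ 2)
      ≤ ∫ r in Ioi (0 : ℝ), 2 / √Real.pi * (Real.exp (-x ^ 2) * Real.exp (-r ^ 2)) := by
        refine setIntegral_mono_on
          ((integrable_exp_neg_sq.comp_add_right x).const_mul _).integrableOn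
          ((integrable_exp_neg_sq.const_mul _).const_mul _).integrableOn measurableSet_Ioi ?_
        intro r hr
        have hr' : 0 < r := hr
        rw [← Real.exp_add]
        gcongr
        nlinarith [mul_nonneg hr'.le hx]
    _ = Real.exp (-x ^ 2) := by
        rw [integral_const_mul, integral_const_mul, integral_Ioi_exp_neg_sq]
        have h0 : √Real.pi ≠ 0 := (Real.sqrt_pos.2 Real.pi_pos).ne'
        field_simp

/-- For `x` with the sign of `s`, the error function is close to `sgn(s)`. -/
theorem abs_erf_sub_sign_le {x s : ℝ} (h : 0 < s * x ∨ s = 0 ∧ x = 0) :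
    |erf x - Real.sign s| ≤ Real.exp (-x ^ 2) := by
  rcases h with h | ⟨rfl, rfl⟩
  · rcases pos_and_pos_or_neg_and_neg_of_mul_pos h with ⟨hs, hx⟩ | ⟨hs, hx⟩
    · rw [Real.sign_of_pos hs, abs_sub_comm, abs_of_nonneg (sub_nonneg.2 (erf_le_one x))]
      exact one_sub_erf_le hx.le
    · have := one_sub_erf_le (neg_pos.2 hx).le
      have h1 := erf_le_one (-x)
      rw [erf_neg] at this h1
      rw [Real.sign_of_neg hs, sub_neg_eq_add, abs_of_nonneg (by linarith)]
      simpa [neg_sq, add_comm] using this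
  · simp

theorem image_const_mul_exp {l : ℝ} (hl : 0 < l) :
    (fun y => l * Real.exp y) '' univ = Ioi 0 := by
  ext t
  constructor
  · rintro ⟨y, -, rfl⟩
    exact mul_pos hl (Real.exp_pos y)
  · intro ht
    have ht' : 0 < t := ht
    refine ⟨Real.log (t / l), mem_univ _, ?_⟩
    simp only
    rw [Real.exp_log (by positivity)]
    field_simp

/-- The substitution `t = l e^y` in an integral against `dt/t`. -/
theorem integral_div_eq_integral_exp {l : ℝ} (hl : 0 < l) (F : ℝ → ℂ) :
    ∫ t in Ioi (0 : ℝ), F t / (t : ℂ) = ∫ y : ℝ, F (l * Real.exp y) := by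
  rw [← image_const_mul_exp hl, integral_image_eq_integral_abs_deriv_smul MeasurableSet.univ
    (fun y _ => ((Real.hasDerivAt_exp y).const_mul l).hasDerivWithinAt)
    (fun x _ y _ h => Real.exp_injective (mul_left_cancel₀ hl.ne' h)), setIntegral_univ]
  congr 1
  ext y
  have : ((l * Real.exp y : ℝ) : ℂ) ≠ 0 := by exact_mod_cast (by positivity)
  rw [abs_of_pos (by positivity), Complex.real_smul, mul_div_cancel₀ _ this]

theorem integrableOn_div_iff_exp {l : ℝ} (hl : 0 < l) (F : ℝ → ℂ) :
    IntegrableOn (fun t => F t / (t : ℂ)) (Ioi 0) ↔ Integrable fun y => F (l * Real.exp y) := by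
  rw [← image_const_mul_exp hl, integrableOn_image_iff_integrableOn_abs_deriv_smul
    MeasurableSet.univ
    (fun y _ => ((Real.hasDerivAt_exp y).const_mul l).hasDerivWithinAt)
    (fun x _ y _ h => Real.exp_injective (mul_left_cancel₀ hl.ne' h)), integrableOn_univ]
  refine integrable_congr (ae_of_all _ fun y => ?_)
  have : ((l * Real.exp y : ℝ) : ℂ) ≠ 0 := by exact_mod_cast (by positivity)
  simp only
  rw [abs_of_pos (by positivity), Complex.real_smul, mul_div_cancel₀ _ this]

theorem integral_eq_zero_of_odd {f : ℝ → ℂ} (h : ∀ y, f (-y) = -f y) : ∫ y, f y = 0 := by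
  have h1 := integral_neg_eq_self f volume
  simp only [h, integral_neg] at h1
  exact self_eq_neg.1 h1.symm

theorem image_const_mul_sinh {m : ℝ} (hm : 0 < m) :
    (fun y => m * Real.sinh y) '' univ = univ := by
  rw [image_univ, range_eq_univ]
  intro x
  obtain ⟨y, hy⟩ := Real.sinh_surjective (x / m)
  exact ⟨y, by simp only [hy]; field_simp⟩

/-- The substitution `r = m sinh y` turns this into the Gaussian integral over `ℝ`. -/
theorem integral_cosh_mul_exp_neg_sinh_sq {m : ℝ} (hm : 0 < m) :
    Integrable (fun y => m * Real.cosh y * Real.exp (-(m * Real.sinh y) ^ 2)) ∧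
    ∫ y, m * Real.cosh y * Real.exp (-(m * Real.sinh y) ^ 2) = √Real.pi := by
  have hd : ∀ y ∈ (univ : Set ℝ), HasDerivWithinAt (fun y => m * Real.sinh y) (m * Real.cosh y)
      univ y := fun y _ => ((Real.hasDerivAt_sinh y).const_mul m).hasDerivWithinAt
  have hinj : InjOn (fun y => m * Real.sinh y) univ :=
    fun x _ y _ h => Real.sinh_injective (mul_left_cancel₀ hm.ne' h)
  have habs : ∀ y, |m * Real.cosh y| = m * Real.cosh y := fun y =>
    abs_of_pos (mul_pos hm (Real.cosh_pos y))
  constructor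
  · have := (integrableOn_image_iff_integrableOn_abs_deriv_smul MeasurableSet.univ hd hinj
      (fun r => Real.exp (-r ^ 2))).1 integrable_exp_neg_sq.integrableOn
    simpa only [integrableOn_univ, habs, smul_eq_mul] using this
  · have := integral_image_eq_integral_abs_deriv_smul MeasurableSet.univ hd hinj
      (fun r => Real.exp (-r ^ 2))
    rw [image_const_mul_sinh hm] at this
    simp only [setIntegral_univ, habs, smul_eq_mul] at this
    rw [← this]
    simpa using integral_gaussian 1

theorem integral_cosh_mul_exp_neg_cosh_sq {m : ℝ} (hm : 0 < m) :
    Integrable (fun y => Real.cosh y * Real.exp (-(m * Real.cosh y) ^ 2)) ∧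
    ∫ y, Real.cosh y * Real.exp (-(m * Real.cosh y) ^ 2) =
      √Real.pi * (Real.exp (-m ^ 2) / m) := by
  obtain ⟨h1, h2⟩ := integral_cosh_mul_exp_neg_sinh_sq hm
  have e : ∀ y, Real.cosh y * Real.exp (-(m * Real.cosh y) ^ 2) = (Real.exp (-m ^ 2) / m) *
      (m * Real.cosh y * Real.exp (-(m * Real.sinh y) ^ 2)) := by
    intro y
    have : Real.exp (-(m * Real.cosh y) ^ 2) =
        Real.exp (-m ^ 2) * Real.exp (-(m * Real.sinh y) ^ 2) := by
      rw [← Real.exp_add, mul_pow, mul_pow, Real.cosh_sq]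
      ring_nf
    rw [this]
    field_simp
  simp only [e]
  exact ⟨h1.const_mul _, by rw [integral_const_mul, h2]; ring⟩

theorem integral_Ioi_exp_neg_sq_div {m : ℝ} (hm : 0 < m) :
    IntegrableOn (fun k : ℝ => 2 * (Real.exp (-k ^ 2) / k)) (Ioi m) ∧
    ∫ k in Ioi m, 2 * (Real.exp (-k ^ 2) / k) = incompleteGamma 0 (m ^ 2) := by
  have him : (fun k : ℝ => k ^ 2) '' Ioi m = Ioi (m ^ 2) := by
    ext r
    constructor
    · rintro ⟨k, hk, rfl⟩
      exact pow_lt_pow_left₀ hk hm.le two_ne_zero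
    · intro hr
      have hr' : m ^ 2 < r := hr
      refine ⟨√r, ?_, Real.sq_sqrt (by nlinarith)⟩
      exact Real.lt_sqrt_of_sq_lt hr'
  have hd : ∀ k ∈ Ioi m, HasDerivWithinAt (fun k : ℝ => k ^ 2) (2 * k) (Ioi m) k := fun k _ => by
    simpa using (hasDerivAt_pow 2 k).hasDerivWithinAt
  have hinj : InjOn (fun k : ℝ => k ^ 2) (Ioi m) := fun x hx y hy h =>
    (pow_left_inj₀ (hm.trans hx).le (hm.trans hy).le two_ne_zero).1 h
  have e : ∀ k ∈ Ioi m, |2 * k| • ((k ^ 2) ^ ((0 : ℝ) - 1) * Real.exp (-k ^ 2)) =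
      2 * (Real.exp (-k ^ 2) / k) := by
    intro k hk
    have hk' : 0 < k := hm.trans hk
    rw [abs_of_pos (by positivity), zero_sub, Real.rpow_neg_one, smul_eq_mul]
    field_simp
  constructor
  · have hG : IntegrableOn (fun r : ℝ => r ^ ((0 : ℝ) - 1) * Real.exp (-r)) (Ioi (m ^ 2)) := by
      have h1 : IntegrableOn (fun r : ℝ => (m ^ 2)⁻¹ * Real.exp (-r)) (Ioi (m ^ 2)) :=
        (integrableOn_exp_neg_Ioi _).const_mul _
      refine Integrable.mono' h1 ?_ ?_
      · refine ContinuousOn.aestronglyMeasurable (fun r hr => ?_) measurableSet_Ioi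
        have hr' : m ^ 2 < r := hr
        have : r ≠ 0 := by nlinarith
        exact ((continuousAt_id.rpow_const (Or.inl this)).mul
          (Real.continuous_exp.comp continuous_neg).continuousAt).continuousWithinAt
      · refine (ae_restrict_mem measurableSet_Ioi).mono fun r hr => ?_
        have hr' : m ^ 2 < r := hr
        have h0 : 0 < m ^ 2 := by positivity
        have : 0 < r := h0.trans hr'
        rw [zero_sub, Real.rpow_neg_one, Real.norm_of_nonneg (by positivity)]
        gcongr
    rw [← him, integrableOn_image_iff_integrableOn_abs_deriv_smul measurableSet_Ioi hd hinj] at hG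
    exact hG.congr_fun e measurableSet_Ioi
  · rw [incompleteGamma, ← him, integral_image_eq_integral_abs_deriv_smul measurableSet_Ioi hd hinj]
    exact (setIntegral_congr_fun measurableSet_Ioi e).symm

/-- The complementary error function is itself an integral over the scale: `1 - erf(m cosh y)` is
the integral over `k > m` of the `k`-derivative of `erf(k cosh y)`. After exchanging the integrals,
the one over `y` is `2 e^{-k²}/k`, and `r = k²` gives `Γ(0, m²)`. -/
theorem integral_erfc_cosh {m : ℝ} (hm : 0 < m) :
    Integrable (fun y => 1 - erf (m * Real.cosh y)) ∧
    ∫ y, (1 - erf (m * Real.cosh y)) = incompleteGamma 0 (m ^ 2) := by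
  set f : ℝ → ℝ → ℝ := fun y k => 2 / √Real.pi * Real.cosh y * Real.exp (-(k * Real.cosh y) ^ 2)
    with hf
  have hin : ∀ y, ∫ k in Ioi m, f y k = 1 - erf (m * Real.cosh y) := by
    intro y
    rw [integral_Ioi_of_hasDerivAt_of_tendsto' (f := fun k => erf (k * Real.cosh y)) (m := 1)]
    · intro k _
      have := (hasDerivAt_erf (k * Real.cosh y)).comp k ((hasDerivAt_id k).mul_const (Real.cosh y))
      refine this.congr_deriv ?_
      simp only [hf]
      ring
    · refine Integrable.integrableOn ?_
      have := (integrable_exp_neg_mul_sq (b := Real.cosh y ^ 2)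
        (by have := Real.cosh_pos y; positivity)).const_mul (2 / √Real.pi * Real.cosh y)
      refine this.congr (ae_of_all _ fun k => ?_)
      simp only [hf]
      ring_nf
    · exact tendsto_erf_atTop.comp (tendsto_id.atTop_mul_const (Real.cosh_pos y))
  have hout : ∀ k ∈ Ioi m, Integrable (fun y => f y k) ∧
      ∫ y, f y k = 2 * (Real.exp (-k ^ 2) / k) := by
    intro k hk
    obtain ⟨h1, h2⟩ := integral_cosh_mul_exp_neg_cosh_sq (hm.trans hk)
    have h0 : √Real.pi ≠ 0 := (Real.sqrt_pos.2 Real.pi_pos).ne'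
    simp only [hf, mul_assoc]
    refine ⟨h1.const_mul _, ?_⟩
    rw [integral_const_mul, h2]
    field_simp
  have hnn : ∀ y k, 0 ≤ f y k := fun y k => by
    have := Real.cosh_pos y
    simp only [hf]
    positivity
  have hint : Integrable (Function.uncurry f) (volume.prod (volume.restrict (Ioi m))) := by
    rw [integrable_prod_iff']
    · constructor
      · exact (ae_restrict_mem measurableSet_Ioi).mono fun k hk => (hout k hk).1
      · refine (integral_Ioi_exp_neg_sq_div hm).1.congr ?_
        refine (ae_restrict_mem measurableSet_Ioi).mono fun k hk => ?_
        simp only [Function.uncurry, Real.norm_of_nonneg (hnn _ _), (hout k hk).2]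
    · refine Continuous.aestronglyMeasurable ?_
      simp only [hf, Function.uncurry_def]
      have := Real.continuous_cosh
      fun_prop
  constructor
  · refine hint.integral_prod_left.congr (ae_of_all _ fun y => ?_)
    simp only [Function.uncurry, hin]
  · rw [← (integral_Ioi_exp_neg_sq_div hm).2, ← setIntegral_congr_fun measurableSet_Ioi
      (fun k hk => (hout k hk).2), ← integral_integral_swap hint]
    simp only [hin]

theorem abs_le_cosh (y : ℝ) : |y| ≤ Real.cosh y := by
  rw [← Real.cosh_abs]
  exact (Real.self_le_sinh_iff.2 (abs_nonneg y)).trans (Real.sinh_lt_cosh _).le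

/-- Integration by parts: `y (1 - erf(m cosh y))` has derivative `1 - erf(m cosh y)` minus the
integrand, so both have the same integral. -/
theorem integral_mul_sinh_mul_exp_neg_cosh_sq {m : ℝ} (hm : 0 < m) :
    ∫ y, y * (2 / √Real.pi * (m * Real.sinh y) * Real.exp (-(m * Real.cosh y) ^ 2)) =
      incompleteGamma 0 (m ^ 2) := by
  set k : ℝ → ℝ := fun y =>
    y * (2 / √Real.pi * (m * Real.sinh y) * Real.exp (-(m * Real.cosh y) ^ 2)) with hk
  have hd : ∀ y, HasDerivAt (fun y => y * (1 - erf (m * Real.cosh y)))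
      (1 - erf (m * Real.cosh y) - k y) y := by
    intro y
    have h1 := (hasDerivAt_erf (m * Real.cosh y)).comp y ((Real.hasDerivAt_cosh y).const_mul m)
    refine ((hasDerivAt_id y).mul (h1.const_sub 1)).congr_deriv ?_
    simp only [hk, id, Function.comp]
    ring
  have hf : Integrable fun y => y * (1 - erf (m * Real.cosh y)) := by
    refine (integral_cosh_mul_exp_neg_cosh_sq hm).1.mono'
      (Continuous.aestronglyMeasurable ?_) (ae_of_all _ fun y => ?_)
    · have := Real.continuous_cosh
      have := continuous_erf
      fun_prop
    · rw [norm_mul, Real.norm_eq_abs, Real.norm_of_nonneg (sub_nonneg.2 (erf_le_one _))]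
      have := Real.cosh_pos y
      exact mul_le_mul (abs_le_cosh y) (one_sub_erf_le (by positivity))
        (sub_nonneg.2 (erf_le_one _)) this.le
  have hki : Integrable k := by
    have hm2 : 0 < m / 2 := by positivity
    refine ((integral_cosh_mul_exp_neg_cosh_sq hm2).1.const_mul
      (2 / √Real.pi * m * (4 / m ^ 2))).mono'
      (Continuous.aestronglyMeasurable ?_) (ae_of_all _ fun y => ?_)
    · have := Real.continuous_cosh
      have := Real.continuous_sinh
      simp only [hk]
      fun_prop
    · have hc := Real.one_le_cosh y
      have hs : |Real.sinh y| ≤ Real.cosh y := by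
        rw [← Real.cosh_abs, Real.abs_sinh]
        exact (Real.sinh_lt_cosh _).le
      have hpi : 0 < √Real.pi := Real.sqrt_pos.2 Real.pi_pos
      -- Three quarters of the exponent are more than enough to absorb one factor `cosh y`; a
      -- quarter of it, i.e. `m / 2` in place of `m`, still gives an integrable majorant.
      have hexp : Real.cosh y * Real.exp (-(m * Real.cosh y) ^ 2) ≤
          4 / m ^ 2 * Real.exp (-(m / 2 * Real.cosh y) ^ 2) := by
        have h1 : (m / 2 * Real.cosh y) ^ 2 ≤ Real.exp ((m / 2 * Real.cosh y) ^ 2) :=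
          (by linarith : (m / 2 * Real.cosh y) ^ 2 ≤ (m / 2 * Real.cosh y) ^ 2 + 1).trans
            (Real.add_one_le_exp _)
        have h2 : Real.cosh y ≤ 4 / m ^ 2 * Real.exp ((m / 2 * Real.cosh y) ^ 2) := by
          calc Real.cosh y ≤ Real.cosh y ^ 2 := by nlinarith
            _ = 4 / m ^ 2 * (m / 2 * Real.cosh y) ^ 2 := by field_simp; ring
            _ ≤ _ := by gcongr
        calc Real.cosh y * Real.exp (-(m * Real.cosh y) ^ 2)
            ≤ 4 / m ^ 2 * Real.exp ((m / 2 * Real.cosh y) ^ 2) *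
              Real.exp (-(m * Real.cosh y) ^ 2) := by gcongr
          _ ≤ 4 / m ^ 2 * Real.exp (-(m / 2 * Real.cosh y) ^ 2) := by
              rw [mul_assoc, ← Real.exp_add]
              gcongr
              nlinarith [sq_nonneg (m * Real.cosh y)]
      have e : ‖k y‖ = 2 / √Real.pi * m * (|y| * |Real.sinh y| *
          Real.exp (-(m * Real.cosh y) ^ 2)) := by
        simp only [hk, norm_mul, Real.norm_eq_abs, abs_of_pos hm, Real.abs_exp,
          abs_of_pos (show 0 < 2 / √Real.pi by positivity)]
        ring
      rw [e, mul_assoc (2 / √Real.pi * m)]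
      refine mul_le_mul_of_nonneg_left ?_ (by positivity)
      calc |y| * |Real.sinh y| * Real.exp (-(m * Real.cosh y) ^ 2)
          ≤ Real.cosh y * Real.cosh y * Real.exp (-(m * Real.cosh y) ^ 2) := by
            gcongr
            exact abs_le_cosh y
        _ = Real.cosh y * (Real.cosh y * Real.exp (-(m * Real.cosh y) ^ 2)) := by ring
        _ ≤ Real.cosh y * (4 / m ^ 2 * Real.exp (-(m / 2 * Real.cosh y) ^ 2)) := by gcongr
        _ = 4 / m ^ 2 * (Real.cosh y * Real.exp (-(m / 2 * Real.cosh y) ^ 2)) := by ring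
  have h0 := integral_eq_zero_of_hasDerivAt_of_integrable hd
    ((integral_erfc_cosh hm).1.sub hki) hf
  rw [integral_sub (integral_erfc_cosh hm).1 hki, (integral_erfc_cosh hm).2, sub_eq_zero] at h0
  exact h0.symm

/-! ### The real kernel functions -/

/-- The Gaussian `exp(-κ²(x²/t² + y²t²))`. -/
noncomputable def gaussTerm (κ x y t : ℝ) : ℝ :=
  Real.exp (-((κ * (x / t)) ^ 2 + (κ * (y * t)) ^ 2))

/-- The real factor of `φ`. -/
noncomputable def phiTerm (κ x y t : ℝ) : ℝ :=
  κ / √Real.pi * (x / t + y * t) * gaussTerm κ x y t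

/-- The real factor of the logarithmic derivative of `φ̃` in `t`. -/
noncomputable def psiTerm (κ x y t : ℝ) : ℝ :=
  2 * κ / √Real.pi * (y * t - x / t) * gaussTerm κ x y t

open Classical in
/-- The sign of a vector of non-negative norm, and `0` on vectors of negative norm. -/
noncomputable def signTerm (x y : ℝ) : ℝ := if x * y < 0 then 0 else Real.sign (x + y)

/-- The real factor of `φ̃`. -/
noncomputable def tildeTerm (κ x y t : ℝ) : ℝ :=
  Real.exp (2 * κ ^ 2 * (x * y)) * (erf (κ * (x / t + y * t)) - signTerm x y)

/-- The cross term in `(x/t + yt)²` is `2xy`, independent of `t`. -/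
theorem gaussTerm_eq_left {κ x y t : ℝ} (ht : 0 < t) : gaussTerm κ x y t =
    Real.exp (2 * κ ^ 2 * (x * y)) * Real.exp (-(κ * (x / t + y * t)) ^ 2) := by
  rw [gaussTerm, ← Real.exp_add]
  congr 1
  field_simp
  ring

theorem gaussTerm_le {κ x y t : ℝ} (ht : 0 < t) :
    gaussTerm κ x y t ≤ Real.exp (-(2 * κ ^ 2 * |x * y|)) := by
  rw [gaussTerm]
  gcongr
  have h : |x * y| = |x / t| * |y * t| := by
    rw [← abs_mul]; congr 1; field_simp
  rw [h, mul_pow, mul_pow, ← sq_abs (x / t), ← sq_abs (y * t)]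
  nlinarith [mul_nonneg (sq_nonneg κ) (sq_nonneg (|x / t| - |y * t|))]

/-- The sign is constant in `t` and disappears; the derivative of `erf` combines with the prefactor
`e^{2κ²xy}` into the full Gaussian. -/
theorem hasDerivAt_tildeTerm (κ x y : ℝ) {t : ℝ} (ht : 0 < t) :
    HasDerivAt (tildeTerm κ x y) (psiTerm κ x y t / t) t := by
  have h1 : HasDerivAt (fun t => κ * (x / t + y * t)) (κ * (-x / t ^ 2 + y)) t := by
    have := ((hasDerivAt_const t x).div (hasDerivAt_id t) ht.ne').add
      ((hasDerivAt_id t).const_mul y)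
    refine (this.const_mul κ).congr_deriv ?_
    simp
  have h2 := (((hasDerivAt_erf (κ * (x / t + y * t))).comp t h1).sub_const
    (signTerm x y)).const_mul (Real.exp (2 * κ ^ 2 * (x * y)))
  refine h2.congr_deriv ?_
  rw [psiTerm, gaussTerm_eq_left ht]
  field_simp
  ring

/-- When `xy ≥ 0`, the numbers `x + y` and `x/t + yt` have the same sign, so the error function is
compared with its own limit value. -/
theorem abs_tildeTerm_le_gaussTerm {κ x y t : ℝ} (hκ : 0 < κ) (ht : 0 < t) (h : 0 ≤ x * y) :
    |tildeTerm κ x y t| ≤ gaussTerm κ x y t := by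
  rw [tildeTerm, abs_mul, Real.abs_exp, gaussTerm_eq_left ht, signTerm, if_neg (not_lt.2 h)]
  gcongr
  apply abs_erf_sub_sign_le
  have hit : 0 < 1 / t := by positivity
  rcases lt_trichotomy (x + y) 0 with hs | hs | hs
  · left
    have hx : x ≤ 0 := by by_contra hx; push Not at hx; nlinarith [nonneg_of_mul_nonneg_right h hx]
    have hy : y ≤ 0 := by by_contra hy; push Not at hy; nlinarith [nonneg_of_mul_nonneg_left h hy]
    have : x / t + y * t < 0 := by
      rcases lt_or_eq_of_le hx with hx | hx
      · have : x / t < 0 := div_neg_of_neg_of_pos hx ht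
        nlinarith
      · subst hx
        simp only [zero_add] at hs
        simp only [zero_div, zero_add]
        nlinarith
    exact mul_pos_of_neg_of_neg hs (by nlinarith)
  · right
    refine ⟨hs, ?_⟩
    have hy : y = -x := by linarith
    subst hy
    have : x = 0 := by nlinarith
    simp [this]
  · left
    have hx : 0 ≤ x := by by_contra hx; push Not at hx; nlinarith
    have hy : 0 ≤ y := by by_contra hy; push Not at hy; nlinarith
    have : 0 < x / t + y * t := by
      rcases lt_or_eq_of_le hx with hx | hx
      · have : 0 < x / t := by positivity
        nlinarith
      · rw [← hx] at hs ⊢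
        simp only [zero_add] at hs
        simp only [zero_div, zero_add]
        positivity
    positivity

/-- Uniform in `t`, hence a majorant for dominated convergence at `0` and `∞`. For `xy < 0` there is
no decay in `t`, and the factor `e^{2κ²xy}` alone gives the bound. -/
theorem abs_tildeTerm_le {κ x y t : ℝ} (hκ : 0 < κ) (ht : 0 < t) :
    |tildeTerm κ x y t| ≤ Real.exp (-(2 * κ ^ 2 * |x * y|)) := by
  rcases le_or_gt 0 (x * y) with h | h
  · exact (abs_tildeTerm_le_gaussTerm hκ ht h).trans (gaussTerm_le ht)
  · rw [tildeTerm, abs_mul, Real.abs_exp, signTerm, if_pos h, sub_zero, abs_of_neg h]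
    calc Real.exp (2 * κ ^ 2 * (x * y)) * |erf (κ * (x / t + y * t))|
        ≤ Real.exp (2 * κ ^ 2 * (x * y)) * 1 := by
          gcongr
          exact abs_erf_le_one _
      _ = _ := by rw [mul_one]; congr 1; ring

theorem tendsto_const_div_nhdsGT_zero {x : ℝ} (hx : 0 < x) :
    Tendsto (fun t => x / t) (𝓝[>] 0) atTop := by
  simpa only [div_eq_mul_inv] using tendsto_inv_nhdsGT_zero.const_mul_atTop hx

theorem tendsto_tildeTerm_zero {κ x y : ℝ} (hκ : 0 < κ) (hx : x ≠ 0) :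
    Tendsto (tildeTerm κ x y) (𝓝[>] 0)
      (𝓝 (Real.exp (2 * κ ^ 2 * (x * y)) * (Real.sign x - signTerm x y))) := by
  refine (Tendsto.sub_const ?_ _).const_mul _
  have hy : Tendsto (fun t : ℝ => y * t) (𝓝[>] 0) (𝓝 0) := by
    have : Continuous fun t : ℝ => y * t := by fun_prop
    simpa using (this.tendsto 0).mono_left nhdsWithin_le_nhds
  rcases lt_or_gt_of_ne hx with hx | hx
  · rw [Real.sign_of_neg hx]
    refine tendsto_erf_atBot.comp (Tendsto.const_mul_atBot hκ (Tendsto.atBot_add ?_ hy))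
    have := (tendsto_const_div_nhdsGT_zero (neg_pos.2 hx))
    refine (tendsto_neg_atTop_atBot.comp this).congr fun t => ?_
    simp [neg_div]
  · rw [Real.sign_of_pos hx]
    exact tendsto_erf_atTop.comp (Tendsto.const_mul_atTop hκ
      ((tendsto_const_div_nhdsGT_zero hx).atTop_add hy))

theorem tildeTerm_swap (κ x y t : ℝ) : tildeTerm κ x y t = tildeTerm κ y x t⁻¹ := by
  simp only [tildeTerm, signTerm, mul_comm y x, add_comm y x, div_inv_eq_mul]
  rw [add_comm (y * t), ← div_eq_mul_inv]

theorem tendsto_tildeTerm_atTop {κ x y : ℝ} (hκ : 0 < κ) (hy : y ≠ 0) :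
    Tendsto (tildeTerm κ x y) atTop
      (𝓝 (Real.exp (2 * κ ^ 2 * (x * y)) * (Real.sign y - signTerm x y))) := by
  have h := (tendsto_tildeTerm_zero (y := x) hκ hy).comp tendsto_inv_atTop_nhdsGT_zero
  rw [mul_comm y x, show signTerm y x = signTerm x y by
    simp only [signTerm, mul_comm y x, add_comm y x]] at h
  exact h.congr fun t => (tildeTerm_swap κ x y t).symm

theorem continuousOn_gaussTerm (κ x y : ℝ) : ContinuousOn (gaussTerm κ x y) (Ioi 0) := by
  have h : ∀ t ∈ Ioi (0 : ℝ), t ≠ 0 := fun t ht => ne_of_gt ht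
  unfold gaussTerm
  fun_prop (disch := assumption)

theorem continuousOn_phiTerm (κ x y : ℝ) : ContinuousOn (phiTerm κ x y) (Ioi 0) := by
  have h : ∀ t ∈ Ioi (0 : ℝ), t ≠ 0 := fun t ht => ne_of_gt ht
  have := continuousOn_gaussTerm κ x y
  unfold phiTerm
  fun_prop (disch := assumption)

theorem continuousOn_psiTerm (κ x y : ℝ) : ContinuousOn (psiTerm κ x y) (Ioi 0) := by
  have h : ∀ t ∈ Ioi (0 : ℝ), t ≠ 0 := fun t ht => ne_of_gt ht
  have := continuousOn_gaussTerm κ x y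
  unfold psiTerm
  fun_prop (disch := assumption)

/-! ### Domination by a fixed rapidly decaying function -/

/-- A rapidly decaying function that is invariant under `t ↦ t⁻¹`. -/
noncomputable def decayBound (c t : ℝ) : ℝ := (t + t⁻¹) * Real.exp (-(c * (t ^ 2 + t⁻¹ ^ 2)))

theorem decayBound_inv (c t : ℝ) : decayBound c t⁻¹ = decayBound c t := by
  simp only [decayBound, inv_inv, add_comm]

theorem decayBound_nonneg (c : ℝ) {t : ℝ} (ht : 0 < t) : 0 ≤ decayBound c t := by
  unfold decayBound
  positivity

theorem decayBound_le {c t : ℝ} (hc : 0 < c) (ht : 1 ≤ t) :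
    decayBound c t ≤ 4 / c * Real.exp (-(c / 2) * t) := by
  have h0 : 0 < t := by linarith
  have h1 : t⁻¹ ≤ t := (inv_le_one_of_one_le₀ ht).trans ht
  have h2 : c / 2 * t ≤ Real.exp (c / 2 * t) :=
    (le_add_of_nonneg_right zero_le_one).trans (Real.add_one_le_exp _)
  have h3 : t + t⁻¹ ≤ 4 / c * Real.exp (c / 2 * t) := by
    calc t + t⁻¹ ≤ 2 * t := by linarith
      _ = 4 / c * (c / 2 * t) := by field_simp; ring
      _ ≤ _ := by gcongr
  calc decayBound c t ≤ 4 / c * Real.exp (c / 2 * t) * Real.exp (-(c * t)) := by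
        unfold decayBound
        gcongr
        nlinarith [sq_nonneg t⁻¹]
    _ = _ := by
        rw [mul_assoc, ← Real.exp_add]
        ring_nf

theorem decayBound_le_const {c t : ℝ} (hc : 0 < c) (ht : 0 < t) : decayBound c t ≤ 4 / c := by
  have key : ∀ t : ℝ, 1 ≤ t → decayBound c t ≤ 4 / c := fun t ht => by
    refine (decayBound_le hc ht).trans ?_
    have : Real.exp (-(c / 2) * t) ≤ 1 := Real.exp_le_one_iff.2 (by nlinarith)
    exact mul_le_of_le_one_right (by positivity) this
  rcases le_total 1 t with h | h
  · exact key t h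
  · rw [← decayBound_inv]
    exact key _ ((one_le_inv₀ ht).2 h)

theorem continuousOn_decayBound (c : ℝ) : ContinuousOn (decayBound c) (Ioi 0) := by
  have h : ∀ t ∈ Ioi (0 : ℝ), t ≠ 0 := fun t ht => ne_of_gt ht
  unfold decayBound
  fun_prop (disch := assumption)

theorem rapidDecay_decayBound {c : ℝ} (hc : 0 < c) :
    RapidDecay (fun t => (decayBound c t : ℂ)) := by
  have htop : ∀ r : ℝ, (fun t => (decayBound c t : ℂ)) =O[atTop] fun t => t ^ (-r) := by
    intro r
    refine IsBigO.trans ?_ (isLittleO_exp_neg_mul_rpow_atTop (half_pos hc) (-r)).isBigO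
    refine IsBigO.of_bound (4 / c) ?_
    filter_upwards [eventually_ge_atTop 1] with t ht
    rw [Complex.norm_real, Real.norm_of_nonneg (decayBound_nonneg c (by linarith)),
      Real.norm_of_nonneg (Real.exp_pos _).le]
    exact decayBound_le hc ht
  refine ⟨ContinuousOn.locallyIntegrableOn ?_ measurableSet_Ioi, htop, fun r => ?_⟩
  · exact Complex.continuous_ofReal.comp_continuousOn (continuousOn_decayBound c)
  · refine ((htop (-r)).comp_tendsto tendsto_inv_nhdsGT_zero).congr' ?_ ?_
    · filter_upwards with t
      simp [decayBound_inv]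
    · filter_upwards [self_mem_nhdsWithin] with t ht
      simp [Real.inv_rpow (le_of_lt ht), Real.rpow_neg (le_of_lt ht)]

/-- Sums of functions dominated by multiples of a fixed rapidly decaying function. -/
theorem RapidDecay.tsum {ι : Type*} [Countable ι] {p : ι → ℝ → ℂ} {α : ι → ℝ} {g : ℝ → ℝ} {G : ℝ}
    (hα : Summable α) (hα0 : ∀ i, 0 ≤ α i) (hg : RapidDecay (fun t => (g t : ℂ)))
    (hg0 : ∀ t, 0 < t → 0 ≤ g t) (hG : ∀ t, 0 < t → g t ≤ G)
    (hp : ∀ i, ContinuousOn (p i) (Ioi 0)) (hb : ∀ i t, 0 < t → ‖p i t‖ ≤ α i * g t) :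
    RapidDecay (fun t => ∑' i, p i t) ∧ ContinuousOn (fun t => ∑' i, p i t) (Ioi 0) ∧
    HasSum (fun i => mellin (p i) 0) (mellin (fun t => ∑' i, p i t) 0) ∧
    HasSum (fun i => mellin (fun t => Real.log t • p i t) 0)
      (mellin (fun t => Real.log t • ∑' i, p i t) 0) := by
  have hsum : ∀ t, 0 < t → Summable fun i => p i t := fun t ht =>
    Summable.of_norm_bounded (hα.mul_right (g t)) fun i => hb i t ht
  have hc : ContinuousOn (fun t => ∑' i, p i t) (Ioi 0) := by
    refine continuousOn_tsum hp (hα.mul_right G) fun i t ht => (hb i t ht).trans ?_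
    exact mul_le_mul_of_nonneg_left (hG t ht) (hα0 i)
  have hbt : ∀ t, 0 < t → ‖∑' i, p i t‖ ≤ (∑' i, α i) * ‖(g t : ℂ)‖ := by
    intro t ht
    rw [Complex.norm_real, Real.norm_of_nonneg (hg0 t ht), ← tsum_mul_right]
    exact tsum_of_norm_bounded (hα.mul_right (g t)).hasSum fun i => hb i t ht
  have hgi := hg.integrableOn_div
  have hgl := hg.log_smul.integrableOn_div
  refine ⟨⟨hc.locallyIntegrableOn measurableSet_Ioi, fun r => ?_, fun r => ?_⟩, hc, ?_, ?_⟩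
  · refine (IsBigO.of_bound (∑' i, α i) ?_).trans (hg.2 r)
    filter_upwards [eventually_gt_atTop 0] with t ht using hbt t ht
  · refine (IsBigO.of_bound (∑' i, α i) ?_).trans (hg.3 r)
    filter_upwards [self_mem_nhdsWithin] with t ht using hbt t ht
  · simp only [mellin_zero_eq, ← tsum_div_const]
    have hbd : ∀ i, ∀ t ∈ Ioi (0 : ℝ), ‖p i t / (t : ℂ)‖ ≤ α i * ‖(g t : ℂ) / t‖ := by
      intro i t ht
      rw [norm_div, norm_div, Complex.norm_real (g t), Real.norm_of_nonneg (hg0 t ht), ← mul_div_assoc]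
      gcongr
      exact hb i t ht
    have hi : ∀ i, IntegrableOn (fun t => p i t / (t : ℂ)) (Ioi 0) := fun i => by
      refine (hgi.norm.const_mul (α i)).mono' ?_ ((ae_restrict_mem measurableSet_Ioi).mono (hbd i))
      refine ContinuousOn.aestronglyMeasurable ?_ measurableSet_Ioi
      exact (hp i).div Complex.continuous_ofReal.continuousOn fun t ht =>
        Complex.ofReal_ne_zero.2 (ne_of_gt ht)
    refine hasSum_integral_of_summable_integral_norm hi ?_
    refine Summable.of_nonneg_of_le (fun i => by positivity) (fun i => ?_)
      (hα.mul_right (∫ t in Ioi (0 : ℝ), ‖(g t : ℂ) / t‖))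
    rw [← integral_const_mul]
    exact setIntegral_mono_on (hi i).norm (hgi.norm.const_mul _) measurableSet_Ioi (hbd i)
  · have e : ∀ t ∈ Ioi (0:ℝ), (Real.log t • ∑' i, p i t) / (t : ℂ) =
        ∑' i, Real.log t • p i t / (t : ℂ) := fun t ht => by
      rw [← (hsum t ht).tsum_const_smul, tsum_div_const]
    simp only [mellin_zero_eq]
    rw [setIntegral_congr_fun measurableSet_Ioi e]
    have hbd : ∀ i, ∀ t ∈ Ioi (0 : ℝ), ‖Real.log t • p i t / (t : ℂ)‖ ≤
        α i * ‖Real.log t • (g t : ℂ) / (t : ℂ)‖ := by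
      intro i t ht
      rw [norm_div, norm_div, norm_smul, norm_smul, Complex.norm_real (g t),
        Real.norm_of_nonneg (hg0 t ht), ← mul_div_assoc, mul_left_comm]
      gcongr
      exact hb i t ht
    have hi : ∀ i, IntegrableOn (fun t => Real.log t • p i t / (t : ℂ)) (Ioi 0) := fun i => by
      refine (hgl.norm.const_mul (α i)).mono' ?_ ((ae_restrict_mem measurableSet_Ioi).mono (hbd i))
      refine ContinuousOn.aestronglyMeasurable ?_ measurableSet_Ioi
      have hl : ContinuousOn (fun t => Real.log t • p i t) (Ioi 0) :=
        (Real.continuousOn_log.mono fun x hx => ne_of_gt hx).smul (hp i)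
      exact hl.div Complex.continuous_ofReal.continuousOn fun t ht =>
        Complex.ofReal_ne_zero.2 (ne_of_gt ht)
    refine hasSum_integral_of_summable_integral_norm hi ?_
    refine Summable.of_nonneg_of_le (fun i => by positivity) (fun i => ?_)
      (hα.mul_right (∫ t in Ioi (0 : ℝ), ‖Real.log t • (g t : ℂ) / (t : ℂ)‖))
    rw [← integral_const_mul]
    exact setIntegral_mono_on (hi i).norm (hgl.norm.const_mul _) measurableSet_Ioi (hbd i)

/-- Half of the exponent is estimated by `x²/t² + y²t² ≥ 2|xy|`, giving convergence over the
lattice. The other half is estimated with `|x|, |y| ≥ 1`, giving decay in `t` independent of the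
vector. -/
theorem gaussTerm_le_decay {κ x y t : ℝ} (ht : 0 < t) (hx : 1 ≤ |x|) (hy : 1 ≤ |y|) :
    gaussTerm κ x y t ≤
      Real.exp (-(κ ^ 2 * |x * y|)) * Real.exp (-(κ ^ 2 / 2 * (t ^ 2 + t⁻¹ ^ 2))) := by
  have hx2 : 1 ≤ x ^ 2 := by rw [← sq_abs]; nlinarith
  have hy2 : 1 ≤ y ^ 2 := by rw [← sq_abs]; nlinarith
  have h1 : t⁻¹ ^ 2 ≤ (x / t) ^ 2 := by
    rw [div_pow, inv_pow, div_eq_mul_inv]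
    exact le_mul_of_one_le_left (by positivity) hx2
  have h2 : t ^ 2 ≤ (y * t) ^ 2 := by
    rw [mul_pow]
    exact le_mul_of_one_le_left (by positivity) hy2
  have h : |x * y| = |x / t| * |y * t| := by
    rw [← abs_mul]; congr 1; field_simp
  have h3 : 2 * |x * y| ≤ (x / t) ^ 2 + (y * t) ^ 2 := by
    rw [h, ← sq_abs (x / t), ← sq_abs (y * t)]
    nlinarith [sq_nonneg (|x / t| - |y * t|)]
  rw [gaussTerm, ← Real.exp_add]
  gcongr
  rw [mul_pow, mul_pow]
  have hk := sq_nonneg κ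
  nlinarith [mul_le_mul_of_nonneg_left h1 hk, mul_le_mul_of_nonneg_left h2 hk,
    mul_le_mul_of_nonneg_left h3 hk]

theorem abs_mul_gaussTerm_le_decay {κ x y t s : ℝ} (ht : 0 < t) (hx : 1 ≤ |x|)
    (hy : 1 ≤ |y|) (hs : |s| = 1) :
    |(y * t + s * (x / t)) * gaussTerm κ x y t| ≤
      |x * y| * Real.exp (-(κ ^ 2 * |x * y|)) * decayBound (κ ^ 2 / 2) t := by
  have hg : 0 ≤ gaussTerm κ x y t := (Real.exp_pos _).le
  have h1 : |y * t + s * (x / t)| ≤ |x * y| * (t + t⁻¹) := by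
    refine (abs_add_le _ _).trans ?_
    rw [abs_mul, abs_mul s, hs, one_mul, abs_div, abs_of_pos ht, abs_mul, mul_add, div_eq_mul_inv]
    gcongr
    · exact le_mul_of_one_le_left (abs_nonneg y) hx
    · exact le_mul_of_one_le_right (abs_nonneg x) hy
  rw [abs_mul, abs_of_nonneg hg]
  calc |y * t + s * (x / t)| * gaussTerm κ x y t
      ≤ (|x * y| * (t + t⁻¹)) *
        (Real.exp (-(κ ^ 2 * |x * y|)) * Real.exp (-(κ ^ 2 / 2 * (t ^ 2 + t⁻¹ ^ 2)))) := by
        gcongr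
        exact gaussTerm_le_decay ht hx hy
    _ = _ := by rw [decayBound]; ring

theorem abs_phiTerm_le_decay {κ x y t : ℝ} (hκ : 0 < κ) (ht : 0 < t) (hx : 1 ≤ |x|)
    (hy : 1 ≤ |y|) : |phiTerm κ x y t| ≤
      2 * κ / √Real.pi * (|x * y| * Real.exp (-(κ ^ 2 * |x * y|))) * decayBound (κ ^ 2 / 2) t := by
  have h := abs_mul_gaussTerm_le_decay (κ := κ) ht hx hy (s := 1) (by simp)
  have e : phiTerm κ x y t =
      κ / √Real.pi * ((y * t + 1 * (x / t)) * gaussTerm κ x y t) := by rw [phiTerm]; ring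
  have hpi : 0 < √Real.pi := Real.sqrt_pos.2 Real.pi_pos
  rw [e, abs_mul, abs_of_pos (by positivity : 0 < κ / √Real.pi), mul_assoc (2 * κ / √Real.pi)]
  have hle : κ / √Real.pi ≤ 2 * κ / √Real.pi := by gcongr; linarith
  exact mul_le_mul hle h (abs_nonneg _) (by positivity)

theorem abs_psiTerm_le_decay {κ x y t : ℝ} (hκ : 0 < κ) (ht : 0 < t) (hx : 1 ≤ |x|)
    (hy : 1 ≤ |y|) : |psiTerm κ x y t| ≤
      2 * κ / √Real.pi * (|x * y| * Real.exp (-(κ ^ 2 * |x * y|))) * decayBound (κ ^ 2 / 2) t := by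
  have h := abs_mul_gaussTerm_le_decay (κ := κ) ht hx hy (s := -1) (by simp)
  have e : psiTerm κ x y t =
      2 * κ / √Real.pi * ((y * t + -1 * (x / t)) * gaussTerm κ x y t) := by rw [psiTerm]; ring
  have hpi : 0 < √Real.pi := Real.sqrt_pos.2 Real.pi_pos
  rw [e, abs_mul, abs_of_pos (by positivity : 0 < 2 * κ / √Real.pi), mul_assoc (2 * κ / √Real.pi)]
  gcongr

/-! ### Unfolded integrals -/

theorem RapidDecay.of_norm_le {p : ℝ → ℂ} {α : ℝ} {g : ℝ → ℝ} (hg : RapidDecay (fun t => (g t : ℂ)))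
    (hg0 : ∀ t, 0 < t → 0 ≤ g t) (hp : ContinuousOn p (Ioi 0))
    (hb : ∀ t, 0 < t → ‖p t‖ ≤ α * g t) : RapidDecay p := by
  refine ⟨hp.locallyIntegrableOn measurableSet_Ioi, fun r => ?_, fun r => ?_⟩
  · refine (IsBigO.of_bound α ?_).trans (hg.2 r)
    filter_upwards [eventually_gt_atTop 0] with t ht
    rw [Complex.norm_real, Real.norm_of_nonneg (hg0 t ht)]
    exact hb t ht
  · refine (IsBigO.of_bound α ?_).trans (hg.3 r)
    filter_upwards [self_mem_nhdsWithin] with t ht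
    rw [Complex.norm_real, Real.norm_of_nonneg (hg0 t ht)]
    exact hb t ht

theorem rapidDecay_phiTerm {κ x y : ℝ} (hκ : 0 < κ) (hx : 1 ≤ |x|) (hy : 1 ≤ |y|) :
    RapidDecay (fun t => (phiTerm κ x y t : ℂ)) :=
  (rapidDecay_decayBound (by positivity : 0 < κ ^ 2 / 2)).of_norm_le
    (fun _ ht => decayBound_nonneg _ ht)
    (Complex.continuous_ofReal.comp_continuousOn (continuousOn_phiTerm κ x y))
    fun _ ht => by
      rw [Complex.norm_real]
      exact abs_phiTerm_le_decay hκ ht hx hy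

theorem rapidDecay_psiTerm {κ x y : ℝ} (hκ : 0 < κ) (hx : 1 ≤ |x|) (hy : 1 ≤ |y|) :
    RapidDecay (fun t => (psiTerm κ x y t : ℂ)) :=
  (rapidDecay_decayBound (by positivity : 0 < κ ^ 2 / 2)).of_norm_le
    (fun _ ht => decayBound_nonneg _ ht)
    (Complex.continuous_ofReal.comp_continuousOn (continuousOn_psiTerm κ x y))
    fun _ ht => by
      rw [Complex.norm_real]
      exact abs_psiTerm_le_decay hκ ht hx hy

/-! ### Integrals for vectors in the open positive quadrant. -/

section Positive

variable {κ a b : ℝ}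

/-- Writing the coordinates as squares makes the substitution `t = (a/b) e^s` rational: then `x/t =
ab e^{-s}` and `yt = ab e^s`. -/
theorem gaussTerm_exp (ha : 0 < a) (hb : 0 < b) (s : ℝ) :
    gaussTerm κ (a ^ 2) (b ^ 2) (a / b * Real.exp s) =
      Real.exp (2 * (κ * a * b) ^ 2) * Real.exp (-(2 * κ * a * b * Real.cosh s) ^ 2) := by
  rw [gaussTerm, ← Real.exp_add, Real.cosh_eq, Real.exp_neg s]
  congr 1
  field_simp
  ring

theorem phiTerm_exp (ha : 0 < a) (hb : 0 < b) (s : ℝ) :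
    phiTerm κ (a ^ 2) (b ^ 2) (a / b * Real.exp s) = 1 / √Real.pi *
      Real.exp (-(2 * (κ * a * b) ^ 2)) * (2 * κ * a * b * Real.cosh s *
        Real.exp (-(2 * κ * a * b * Real.sinh s) ^ 2)) := by
  have h : Real.exp (2 * (κ * a * b) ^ 2) * Real.exp (-(2 * κ * a * b * Real.cosh s) ^ 2) =
      Real.exp (-(2 * (κ * a * b) ^ 2)) * Real.exp (-(2 * κ * a * b * Real.sinh s) ^ 2) := by
    rw [← Real.exp_add, ← Real.exp_add, mul_pow _ (Real.cosh s), Real.cosh_sq]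
    congr 1
    ring
  rw [phiTerm, gaussTerm_exp ha hb, h, Real.cosh_eq, Real.exp_neg s]
  field_simp
  ring

theorem psiTerm_exp (ha : 0 < a) (hb : 0 < b) (s : ℝ) :
    psiTerm κ (a ^ 2) (b ^ 2) (a / b * Real.exp s) = Real.exp (2 * (κ * a * b) ^ 2) *
      (2 / √Real.pi * (2 * κ * a * b * Real.sinh s) *
        Real.exp (-(2 * κ * a * b * Real.cosh s) ^ 2)) := by
  have h : b ^ 2 * (a / b * Real.exp s) - a ^ 2 / (a / b * Real.exp s) =
      2 * a * b * Real.sinh s := by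
    rw [Real.sinh_eq, Real.exp_neg s]
    field_simp
  rw [psiTerm, gaussTerm_exp ha hb, h]
  field_simp

theorem mellin_phiTerm_of_pos (hκ : 0 < κ) (ha : 0 < a) (hb : 0 < b) :
    mellin (fun t => (phiTerm κ (a ^ 2) (b ^ 2) t : ℂ)) 0 =
      (Real.exp (-(2 * (κ * a * b) ^ 2)) : ℝ) := by
  have h0 : √Real.pi ≠ 0 := (Real.sqrt_pos.2 Real.pi_pos).ne'
  rw [mellin_zero_eq, integral_div_eq_integral_exp (div_pos ha hb)]
  simp only [phiTerm_exp ha hb]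
  rw [integral_complex_ofReal, integral_const_mul,
    (integral_cosh_mul_exp_neg_sinh_sq (by positivity : 0 < 2 * κ * a * b)).2]
  congr 1
  field_simp

theorem mellin_psiTerm_of_pos (ha : 0 < a) (hb : 0 < b) :
    mellin (fun t => (psiTerm κ (a ^ 2) (b ^ 2) t : ℂ)) 0 = 0 := by
  rw [mellin_zero_eq, integral_div_eq_integral_exp (div_pos ha hb)]
  simp only [psiTerm_exp ha hb]
  apply integral_eq_zero_of_odd
  intro s
  rw [Real.cosh_neg, Real.sinh_neg]
  push_cast
  ring

/-- In the variable `s`, `log t = log(a/b) + s`. The kernel is even in `s`, so the summand `s`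
integrates to zero. -/
theorem mellin_log_phiTerm_of_pos (hκ : 0 < κ) (ha : 1 ≤ a) (hb : 1 ≤ b) :
    mellin (fun t => Real.log t • (phiTerm κ (a ^ 2) (b ^ 2) t : ℂ)) 0 =
      (Real.log (a / b) * Real.exp (-(2 * (κ * a * b) ^ 2)) : ℝ) := by
  have ha0 : 0 < a := by linarith
  have hb0 : 0 < b := by linarith
  have hr : RapidDecay (fun t => (phiTerm κ (a ^ 2) (b ^ 2) t : ℂ)) :=
    rapidDecay_phiTerm hκ (by rw [abs_of_nonneg (by positivity)]; nlinarith)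
      (by rw [abs_of_nonneg (by positivity)]; nlinarith)
  have i1 := (integrableOn_div_iff_exp (div_pos ha0 hb0) _).1 hr.log_smul.integrableOn_div
  have i2 := (integrableOn_div_iff_exp (div_pos ha0 hb0) _).1 hr.integrableOn_div
  have h2 := mellin_phiTerm_of_pos hκ ha0 hb0
  rw [mellin_zero_eq, integral_div_eq_integral_exp (div_pos ha0 hb0)] at h2 ⊢
  have h3 := integral_sub i1 (i2.const_mul (Real.log (a / b) : ℂ))
  rw [integral_const_mul, h2, integral_eq_zero_of_odd] at h3
  · rw [sub_eq_zero.1 h3.symm, Complex.ofReal_mul]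
  · intro s
    rw [phiTerm_exp ha0 hb0, phiTerm_exp ha0 hb0, Real.log_mul (by positivity) (by positivity),
      Real.log_mul (by positivity) (by positivity), Real.log_exp, Real.log_exp, Real.cosh_neg,
      Real.sinh_neg, mul_neg, neg_sq, Complex.real_smul, Complex.real_smul]
    push_cast
    ring

/-- Here the kernel is odd in `s`. The constant `log(a/b)` drops out and only `s sinh s · e^{-m²
cosh² s}` remains, which integrates to the incomplete Gamma function. -/
theorem mellin_log_psiTerm_of_pos (hκ : 0 < κ) (ha : 1 ≤ a) (hb : 1 ≤ b) :
    mellin (fun t => Real.log t • (psiTerm κ (a ^ 2) (b ^ 2) t : ℂ)) 0 =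
      (Real.exp (2 * (κ * a * b) ^ 2) * incompleteGamma 0 ((2 * κ * a * b) ^ 2) : ℝ) := by
  have ha0 : 0 < a := by linarith
  have hb0 : 0 < b := by linarith
  have hr : RapidDecay (fun t => (psiTerm κ (a ^ 2) (b ^ 2) t : ℂ)) :=
    rapidDecay_psiTerm hκ (by rw [abs_of_nonneg (by positivity)]; nlinarith)
      (by rw [abs_of_nonneg (by positivity)]; nlinarith)
  have i1 := (integrableOn_div_iff_exp (div_pos ha0 hb0) _).1 hr.log_smul.integrableOn_div
  have i2 := (integrableOn_div_iff_exp (div_pos ha0 hb0) _).1 hr.integrableOn_div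
  have h2 := mellin_psiTerm_of_pos (κ := κ) ha0 hb0
  rw [mellin_zero_eq, integral_div_eq_integral_exp (div_pos ha0 hb0)] at h2 ⊢
  have h3 := integral_sub i1 (i2.const_mul (Real.log (a / b) : ℂ))
  rw [integral_const_mul, h2, mul_zero, sub_zero] at h3
  rw [← h3, ← integral_mul_sinh_mul_exp_neg_cosh_sq (by positivity : 0 < 2 * κ * a * b),
    ← integral_const_mul, ← integral_complex_ofReal]
  congr 1
  ext s
  rw [psiTerm_exp ha0 hb0, Real.log_mul (by positivity) (by positivity), Real.log_exp,
    Complex.real_smul]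
  push_cast
  ring

end Positive

/-! ### Sign symmetries reducing all quadrants to the positive one. -/

theorem gaussTerm_neg_left (κ x y t : ℝ) : gaussTerm κ (-x) y t = gaussTerm κ x y t := by
  simp only [gaussTerm, neg_div, mul_neg, neg_sq]

theorem gaussTerm_neg_right (κ x y t : ℝ) : gaussTerm κ x (-y) t = gaussTerm κ x y t := by
  simp only [gaussTerm, neg_mul, mul_neg, neg_sq]

theorem phiTerm_neg_neg (κ x y t : ℝ) : phiTerm κ (-x) (-y) t = -phiTerm κ x y t := by
  rw [phiTerm, phiTerm, gaussTerm_neg_left, gaussTerm_neg_right]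
  ring

theorem psiTerm_neg_neg (κ x y t : ℝ) : psiTerm κ (-x) (-y) t = -psiTerm κ x y t := by
  rw [psiTerm, psiTerm, gaussTerm_neg_left, gaussTerm_neg_right]
  ring

theorem phiTerm_neg_left (κ x y t : ℝ) : phiTerm κ (-x) y t = 2⁻¹ * psiTerm κ x y t := by
  rw [phiTerm, psiTerm, gaussTerm_neg_left]
  ring

/-- Reflecting one coordinate exchanges the two kernels. This is why vectors of negative norm give
an elementary logarithm and those of positive norm an incomplete Gamma function. -/
theorem psiTerm_neg_left (κ x y t : ℝ) : psiTerm κ (-x) y t = 2 * phiTerm κ x y t := by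
  rw [phiTerm, psiTerm, gaussTerm_neg_left]
  ring

theorem mellin_neg (f : ℝ → ℂ) (s : ℂ) : mellin (fun t => -f t) s = -mellin f s := by
  simpa using mellin_const_smul f s (-1 : ℂ)

theorem mellin_const_mul (c : ℂ) (f : ℝ → ℂ) (s : ℂ) :
    mellin (fun t => c * f t) s = c * mellin f s := by
  simpa using mellin_const_smul f s c

open Classical in
theorem mellin_phiTerm {κ x y : ℝ} (hκ : 0 < κ) (hx : x ≠ 0) (hy : y ≠ 0) :
    mellin (fun t => (phiTerm κ x y t : ℂ)) 0 =
      ((if 0 < x * y then Real.sign x * Real.exp (-(2 * κ ^ 2 * (x * y))) else 0 : ℝ) : ℂ) := by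
  have key : ∀ y : ℝ, 0 < y → ∀ x : ℝ, x ≠ 0 → mellin (fun t => (phiTerm κ x y t : ℂ)) 0 =
      ((if 0 < x * y then Real.sign x * Real.exp (-(2 * κ ^ 2 * (x * y))) else 0 : ℝ) : ℂ) := by
    intro y hy x hx
    obtain ⟨b, hb, rfl⟩ : ∃ b : ℝ, 0 < b ∧ y = b ^ 2 :=
      ⟨√y, Real.sqrt_pos.2 hy, (Real.sq_sqrt hy.le).symm⟩
    rcases lt_or_gt_of_ne hx with hx | hx
    · obtain ⟨a, ha, hxa⟩ : ∃ a : ℝ, 0 < a ∧ -x = a ^ 2 :=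
        ⟨√(-x), Real.sqrt_pos.2 (by linarith), (Real.sq_sqrt (by linarith)).symm⟩
      obtain rfl : x = -a ^ 2 := by linarith
      rw [if_neg (by nlinarith)]
      simp only [phiTerm_neg_left, Complex.ofReal_mul]
      rw [mellin_const_mul, mellin_psiTerm_of_pos ha hb]
      simp
    · obtain ⟨a, ha, rfl⟩ : ∃ a : ℝ, 0 < a ∧ x = a ^ 2 :=
        ⟨√x, Real.sqrt_pos.2 hx, (Real.sq_sqrt hx.le).symm⟩
      rw [if_pos (by positivity), mellin_phiTerm_of_pos hκ ha hb, Real.sign_of_pos hx]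
      congr 1
      ring_nf
  rcases lt_or_gt_of_ne hy with hy | hy
  · have h := key (-y) (by linarith) (-x) (by simpa using hx)
    simp only [phiTerm_neg_neg, Complex.ofReal_neg] at h
    rw [mellin_neg, neg_eq_iff_eq_neg] at h
    rw [h, neg_mul_neg, ← Complex.ofReal_neg, Real.sign_neg]
    split_ifs <;> simp
  · exact key y hy x hx

open Classical in
/-- The regularized integral attached to a vector of non-zero norm. -/
noncomputable def logCoeff (κ x y : ℝ) : ℝ :=
  if 0 < x * y then
    -(Real.sign x * (Real.exp (2 * κ ^ 2 * (x * y)) * incompleteGamma 0 (4 * κ ^ 2 * (x * y))))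
  else Real.sign x * Real.log |x / y| * Real.exp (2 * κ ^ 2 * (x * y))

/-- The symmetry `X ↦ -X` reduces to `y > 0`. For `x > 0` the odd kernel gives the Gamma term; for
`x < 0` the reflected, even kernel gives the logarithm, with `log|x/y| = 2 log(a/b)`. -/
theorem mellin_log_psiTerm {κ x y : ℝ} (hκ : 0 < κ) (hx : 1 ≤ |x|) (hy : 1 ≤ |y|) :
    mellin (fun t => Real.log t • (psiTerm κ x y t : ℂ)) 0 = (-logCoeff κ x y : ℝ) := by
  have key : ∀ y : ℝ, 0 < y → 1 ≤ |y| → ∀ x : ℝ, 1 ≤ |x| →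
      mellin (fun t => Real.log t • (psiTerm κ x y t : ℂ)) 0 = (-logCoeff κ x y : ℝ) := by
    intro y hy hy1 x hx
    rw [abs_of_pos hy] at hy1
    obtain ⟨b, hb, rfl⟩ : ∃ b : ℝ, 1 ≤ b ∧ y = b ^ 2 :=
      ⟨√y, Real.one_le_sqrt.2 hy1, (Real.sq_sqrt hy.le).symm⟩
    have hb0 : 0 < b := by linarith
    rcases le_abs.1 hx with hx | hx
    · obtain ⟨a, ha, rfl⟩ : ∃ a : ℝ, 1 ≤ a ∧ x = a ^ 2 :=
        ⟨√x, Real.one_le_sqrt.2 hx, (Real.sq_sqrt (by linarith)).symm⟩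
      have ha0 : 0 < a := by linarith
      rw [logCoeff, if_pos (by positivity), mellin_log_psiTerm_of_pos hκ ha hb,
        Real.sign_of_pos (by linarith)]
      congr 1
      ring_nf
    · obtain ⟨a, ha, hxa⟩ : ∃ a : ℝ, 1 ≤ a ∧ -x = a ^ 2 :=
        ⟨√(-x), Real.one_le_sqrt.2 hx, (Real.sq_sqrt (by linarith)).symm⟩
      have ha0 : 0 < a := by linarith
      obtain rfl : x = -a ^ 2 := by linarith
      rw [logCoeff, if_neg (by have : 0 < a ^ 2 * b ^ 2 := by positivity
                               linarith)]
      have hlog : Real.log |-a ^ 2 / b ^ 2| = 2 * Real.log (a / b) := by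
        rw [neg_div, abs_neg, ← div_pow, abs_of_pos (by positivity), Real.log_pow]
        norm_num
      have e : ∀ t, Real.log t • (psiTerm κ (-a ^ 2) (b ^ 2) t : ℂ) =
          (2 : ℂ) * (Real.log t • (phiTerm κ (a ^ 2) (b ^ 2) t : ℂ)) := by
        intro t
        rw [psiTerm_neg_left, Complex.real_smul, Complex.real_smul]
        push_cast
        ring
      simp only [e]
      rw [mellin_const_mul, mellin_log_phiTerm_of_pos hκ ha hb, hlog,
        Real.sign_of_neg (by linarith)]
      push_cast
      ring_nf
  rcases le_or_gt y 0 with h | h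
  · have hy' : -y ≠ 0 := by rintro hy0; rw [neg_eq_zero.1 hy0] at hy; norm_num at hy
    have h := key (-y) (lt_of_le_of_ne (by linarith) hy'.symm) (by rwa [abs_neg]) (-x)
      (by rwa [abs_neg])
    simp only [psiTerm_neg_neg, Complex.ofReal_neg, smul_neg] at h
    rw [mellin_neg, neg_inj] at h
    rw [h, logCoeff, logCoeff, neg_mul_neg, neg_div_neg_eq, Real.sign_neg]
    congr 1
    split_ifs <;> ring
  · exact key y h hy x hx

/-! ### Sums over lattice vectors of non-zero norm -/

theorem summable_pow_mul_exp_neg_abs (k : ℕ) {c : ℝ} (hc : 0 < c) :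
    Summable fun n : ℤ => |(n : ℝ)| ^ k * Real.exp (-(c * |(n : ℝ)|)) := by
  have h := Real.summable_pow_mul_exp_neg_nat_mul k hc
  refine Summable.of_nat_of_neg ?_ ?_
  · simpa using h
  · simpa using h

/-- The form is indefinite, but for non-zero integers `2|xy| ≥ |x| + |y|`, so the series is
dominated by a product of two one-dimensional ones. -/
theorem summable_norm_mul_exp_neg {c : ℝ} (hc : 0 < c) :
    Summable fun X : {X : ℤ × ℤ // X.1 ≠ 0 ∧ X.2 ≠ 0} =>
      |(X.1.1 : ℝ) * X.1.2| * Real.exp (-(c * |(X.1.1 : ℝ) * X.1.2|)) := by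
  have h := summable_pow_mul_exp_neg_abs 1 (half_pos hc)
  have h2 := (h.mul_of_nonneg h (fun n => by positivity) (fun n => by positivity)).comp_injective
    (Subtype.val_injective (p := fun X : ℤ × ℤ => X.1 ≠ 0 ∧ X.2 ≠ 0))
  refine Summable.of_nonneg_of_le (fun X => by positivity) (fun X => ?_) h2
  obtain ⟨⟨x, y⟩, hx, hy⟩ := X
  have hx1 : 1 ≤ |(x : ℝ)| := by exact_mod_cast Int.one_le_abs hx
  have hy1 : 1 ≤ |(y : ℝ)| := by exact_mod_cast Int.one_le_abs hy
  simp only [Function.comp, pow_one]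
  rw [abs_mul, mul_mul_mul_comm, ← Real.exp_add]
  gcongr
  nlinarith [mul_nonneg (sub_nonneg.2 hx1) (sub_nonneg.2 hy1)]

section Nondegenerate

variable {κ : ℝ} {S : Set (ℤ × ℤ)} {w : S → ℂ}

theorem summable_norm_mul_exp_neg_subtype (hS : ∀ X ∈ S, X.1 ≠ 0 ∧ X.2 ≠ 0) {c : ℝ} (hc : 0 < c) :
    Summable fun X : S =>
      |(X.1.1 : ℝ) * X.1.2| * Real.exp (-(c * |(X.1.1 : ℝ) * X.1.2|)) :=
  (summable_norm_mul_exp_neg hc).comp_injective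
    (i := fun X : S => (⟨X.1, hS X.1 X.2⟩ : {X : ℤ × ℤ // X.1 ≠ 0 ∧ X.2 ≠ 0}))
    fun X Y h => Subtype.ext (by simpa using h)

theorem one_le_abs_of_mem (hS : ∀ X ∈ S, X.1 ≠ 0 ∧ X.2 ≠ 0) (X : S) :
    1 ≤ |(X.1.1 : ℝ)| ∧ 1 ≤ |(X.1.2 : ℝ)| :=
  ⟨by exact_mod_cast Int.one_le_abs (hS X.1 X.2).1, by exact_mod_cast Int.one_le_abs (hS X.1 X.2).2⟩

theorem one_le_abs_mul_of_mem (hS : ∀ X ∈ S, X.1 ≠ 0 ∧ X.2 ≠ 0) (X : S) :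
    1 ≤ |(X.1.1 : ℝ) * X.1.2| := by
  obtain ⟨h1, h2⟩ := one_le_abs_of_mem hS X
  rw [abs_mul]
  nlinarith

theorem summable_exp_neg_subtype (hS : ∀ X ∈ S, X.1 ≠ 0 ∧ X.2 ≠ 0) {c : ℝ} (hc : 0 < c) :
    Summable fun X : S => Real.exp (-(c * |(X.1.1 : ℝ) * X.1.2|)) := by
  refine Summable.of_nonneg_of_le (fun X => (Real.exp_pos _).le) (fun X => ?_)
    (summable_norm_mul_exp_neg_subtype hS hc)
  exact le_mul_of_one_le_left (Real.exp_pos _).le (one_le_abs_mul_of_mem hS X)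

theorem norm_mul_le_of_norm_le_one {z : ℂ} {r b : ℝ} (hz : ‖z‖ ≤ 1) (hr : |r| ≤ b) :
    ‖z * (r : ℂ)‖ ≤ b := by
  rw [norm_mul, Complex.norm_real, Real.norm_eq_abs]
  exact (mul_le_of_le_one_left (abs_nonneg r) hz).trans hr

theorem rapidDecay_tsum_phiTerm (hκ : 0 < κ) (hS : ∀ X ∈ S, X.1 ≠ 0 ∧ X.2 ≠ 0)
    (hw : ∀ X, ‖w X‖ ≤ 1) :
    RapidDecay (fun t => ∑' X : S, w X * (phiTerm κ X.1.1 X.1.2 t : ℂ)) ∧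
    HasSum (fun X : S => w X * mellin (fun t => (phiTerm κ X.1.1 X.1.2 t : ℂ)) 0)
      (mellin (fun t => ∑' X : S, w X * (phiTerm κ X.1.1 X.1.2 t : ℂ)) 0) := by
  have h := RapidDecay.tsum (p := fun (X : S) t => w X * (phiTerm κ X.1.1 X.1.2 t : ℂ))
    ((summable_norm_mul_exp_neg_subtype hS (by positivity : 0 < κ ^ 2)).mul_left
      (2 * κ / √Real.pi)) (fun X => by positivity)
    (rapidDecay_decayBound (by positivity : 0 < κ ^ 2 / 2))
    (fun _ ht => decayBound_nonneg _ ht)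
    (fun _ ht => decayBound_le_const (by positivity : 0 < κ ^ 2 / 2) ht)
    (fun X => continuousOn_const.mul
      (Complex.continuous_ofReal.comp_continuousOn (continuousOn_phiTerm κ _ _)))
    (fun X t ht => norm_mul_le_of_norm_le_one (hw X) (abs_phiTerm_le_decay hκ ht
      (one_le_abs_of_mem hS X).1 (one_le_abs_of_mem hS X).2))
  refine ⟨h.1, ?_⟩
  simpa only [mellin_const_mul] using h.2.2.1

/-- Domination by a fixed rapidly decaying function permits termwise integration against `log t
dt/t`. -/
theorem rapidDecay_tsum_psiTerm (hκ : 0 < κ) (hS : ∀ X ∈ S, X.1 ≠ 0 ∧ X.2 ≠ 0)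
    (hw : ∀ X, ‖w X‖ ≤ 1) :
    RapidDecay (fun t => ∑' X : S, w X * (psiTerm κ X.1.1 X.1.2 t : ℂ)) ∧
    ContinuousOn (fun t => ∑' X : S, w X * (psiTerm κ X.1.1 X.1.2 t : ℂ)) (Ioi 0) ∧
    HasSum (fun X : S => w X * (logCoeff κ X.1.1 X.1.2 : ℂ))
      (-mellin (fun t => Real.log t • ∑' X : S, w X * (psiTerm κ X.1.1 X.1.2 t : ℂ)) 0) := by
  have h := RapidDecay.tsum (p := fun (X : S) t => w X * (psiTerm κ X.1.1 X.1.2 t : ℂ))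
    ((summable_norm_mul_exp_neg_subtype hS (by positivity : 0 < κ ^ 2)).mul_left
      (2 * κ / √Real.pi)) (fun X => by positivity)
    (rapidDecay_decayBound (by positivity : 0 < κ ^ 2 / 2))
    (fun _ ht => decayBound_nonneg _ ht)
    (fun _ ht => decayBound_le_const (by positivity : 0 < κ ^ 2 / 2) ht)
    (fun X => continuousOn_const.mul
      (Complex.continuous_ofReal.comp_continuousOn (continuousOn_psiTerm κ _ _)))
    (fun X t ht => norm_mul_le_of_norm_le_one (hw X) (abs_psiTerm_le_decay hκ ht
      (one_le_abs_of_mem hS X).1 (one_le_abs_of_mem hS X).2))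
  refine ⟨h.1, h.2.1, ?_⟩
  have e : ∀ X : S, mellin (fun t => Real.log t • (w X * (psiTerm κ X.1.1 X.1.2 t : ℂ))) 0 =
      -(w X * (logCoeff κ X.1.1 X.1.2 : ℂ)) := by
    intro X
    simp only [← mul_smul_comm]
    rw [mellin_const_mul, mellin_log_psiTerm hκ (one_le_abs_of_mem hS X).1
      (one_le_abs_of_mem hS X).2]
    push_cast
    ring
  have h3 := h.2.2.2
  simp only [e] at h3
  simpa only [neg_neg] using h3.neg

/-- The limit at `t → 0` of the real factor of `φ̃`. -/
noncomputable def tildeLimit (κ x y : ℝ) : ℝ :=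
  Real.exp (2 * κ ^ 2 * (x * y)) * (Real.sign x - signTerm x y)

/-- For `xy > 0` the boundary values at `0` and `∞` both vanish; for `xy < 0` the coordinates have
opposite signs and the subtracted sign is `0`. Each vector off the axes thus has opposite boundary
values without any correction. -/
theorem neg_tildeLimit {κ x y : ℝ} (hx : x ≠ 0) (hy : y ≠ 0) :
    -tildeLimit κ x y = Real.exp (2 * κ ^ 2 * (x * y)) * (Real.sign y - signTerm x y) := by
  rw [tildeLimit, signTerm]
  rcases lt_or_gt_of_ne hx with hx | hx <;> rcases lt_or_gt_of_ne hy with hy | hy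
  · rw [if_neg (by nlinarith), Real.sign_of_neg hx, Real.sign_of_neg hy,
      Real.sign_of_neg (by linarith)]
    ring
  · rw [if_pos (by nlinarith), Real.sign_of_neg hx, Real.sign_of_pos hy]
    ring
  · rw [if_pos (by nlinarith), Real.sign_of_pos hx, Real.sign_of_neg hy]
    ring
  · rw [if_neg (by nlinarith), Real.sign_of_pos hx, Real.sign_of_pos hy,
      Real.sign_of_pos (by linarith)]
    ring

theorem hasRegConst_tsum_tildeTerm (hκ : 0 < κ) (hS : ∀ X ∈ S, X.1 ≠ 0 ∧ X.2 ≠ 0)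
    (hw : ∀ X, ‖w X‖ ≤ 1) :
    HasRegConst (fun t => ∑' X : S, w X * (tildeTerm κ X.1.1 X.1.2 t : ℂ))
      (∑' X : S, w X * (tildeLimit κ X.1.1 X.1.2 : ℂ))
      (-mellin (fun t => Real.log t • ∑' X : S, w X * (psiTerm κ X.1.1 X.1.2 t : ℂ)) 0) := by
  obtain ⟨hr, hc, -⟩ := rapidDecay_tsum_psiTerm hκ hS hw
  have hsum := summable_exp_neg_subtype hS (by positivity : 0 < 2 * κ ^ 2)
  have hκ2 : 0 < κ ^ 2 / 2 := by positivity
  refine hasRegConst_of_hasDerivAt (fun t ht => ?_) hr hc ?_ ?_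
  · rw [← tsum_div_const]
    -- On `(t/2, ∞)` the factor `1/s` is at most `2/t`, and `decayBound` is at most `4 / (κ²/2)`
    -- everywhere.
    set C : ℝ := (2 / t) * (4 / (κ ^ 2 / 2)) with hC
    refine hasDerivAt_tsum_of_isPreconnected (y₀ := t) (t := Ioi (t / 2))
      (g := fun (X : S) (s : ℝ) => w X * (tildeTerm κ X.1.1 X.1.2 s : ℂ))
      (g' := fun (X : S) (s : ℝ) => w X * (psiTerm κ X.1.1 X.1.2 s : ℂ) / (s : ℂ))
      (u := fun X : S => 2 * κ / √Real.pi * (|(X.1.1 : ℝ) * X.1.2| *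
        Real.exp (-(κ ^ 2 * |(X.1.1 : ℝ) * X.1.2|))) * C)
      (((summable_norm_mul_exp_neg_subtype hS (by positivity : 0 < κ ^ 2)).mul_left _).mul_right _)
      isOpen_Ioi isPreconnected_Ioi
      (fun X s hs => ?_) (fun X s hs => ?_) (mem_Ioi.2 (half_lt_self ht)) ?_
      (mem_Ioi.2 (half_lt_self ht))
    · have hs0 : 0 < s := (half_pos ht).trans hs
      have := ((hasDerivAt_tildeTerm κ X.1.1 X.1.2 hs0).ofReal_comp).const_mul (w X)
      refine this.congr_deriv ?_
      push_cast
      ring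
    · have hs' : t / 2 < s := hs
      have hs0 : 0 < s := (half_pos ht).trans hs'
      rw [norm_div, Complex.norm_real, Real.norm_of_nonneg hs0.le, div_eq_mul_inv]
      have h1 := norm_mul_le_of_norm_le_one (hw X) (abs_psiTerm_le_decay hκ hs0
        (one_le_abs_of_mem hS X).1 (one_le_abs_of_mem hS X).2)
      have h2 : s⁻¹ ≤ 2 / t := by
        rw [inv_le_comm₀ hs0 (by positivity), inv_div]
        exact hs'.le
      calc _ ≤ 2 * κ / √Real.pi * (|(X.1.1 : ℝ) * X.1.2| *
            Real.exp (-(κ ^ 2 * |(X.1.1 : ℝ) * X.1.2|))) * decayBound (κ ^ 2 / 2) s * (2 / t) := by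
            gcongr
            exact (norm_nonneg _).trans h1
        _ ≤ 2 * κ / √Real.pi * (|(X.1.1 : ℝ) * X.1.2| *
            Real.exp (-(κ ^ 2 * |(X.1.1 : ℝ) * X.1.2|))) * (4 / (κ ^ 2 / 2)) * (2 / t) := by
            gcongr
            exact decayBound_le_const hκ2 hs0
        _ = _ := by rw [hC]; ring
    · exact Summable.of_norm_bounded hsum fun X =>
        norm_mul_le_of_norm_le_one (hw X) (abs_tildeTerm_le hκ ht)
  · refine tendsto_tsum_of_dominated_convergence hsum (fun X => ?_) ?_
    · exact ((Complex.continuous_ofReal.tendsto _).comp (tendsto_tildeTerm_zero hκ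
        (by exact_mod_cast (hS X.1 X.2).1))).const_mul _
    · filter_upwards [self_mem_nhdsWithin] with t ht X
      exact norm_mul_le_of_norm_le_one (hw X) (abs_tildeTerm_le hκ ht)
  · rw [← tsum_neg]
    refine tendsto_tsum_of_dominated_convergence hsum (fun X => ?_) ?_
    · have hx : (X.1.1 : ℝ) ≠ 0 := by exact_mod_cast (hS X.1 X.2).1
      have hy : (X.1.2 : ℝ) ≠ 0 := by exact_mod_cast (hS X.1 X.2).2
      rw [← mul_neg, ← Complex.ofReal_neg, neg_tildeLimit hx hy]
      exact ((Complex.continuous_ofReal.tendsto _).comp (tendsto_tildeTerm_atTop hκ hy)).const_mul _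
    · filter_upwards [eventually_gt_atTop 0] with t ht X
      exact norm_mul_le_of_norm_le_one (hw X) (abs_tildeTerm_le hκ ht)

end Nondegenerate

/-! ### The kernels in terms of the real kernel functions -/

/-- `√(πv/N)`. -/
noncomputable def kappa (N : ℕ) (τ : ℂ) : ℝ := √(Real.pi * τ.im / N)

/-- The phase `e(x₁x₂u/N)`, where `u = Re τ`. -/
noncomputable def phase (N : ℕ) (τ : ℂ) (X : ℤ × ℤ) : ℂ :=
  expTwoPiI ((X.1 * X.2 / N * τ.re : ℝ) : ℂ)

theorem norm_expTwoPiI (z : ℂ) : ‖expTwoPiI z‖ = Real.exp (-(2 * Real.pi * z.im)) := by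
  rw [expTwoPiI, Complex.norm_exp]
  congr 1
  simp [mul_assoc]

theorem expTwoPiI_add (z w : ℂ) : expTwoPiI (z + w) = expTwoPiI z * expTwoPiI w := by
  rw [expTwoPiI, expTwoPiI, expTwoPiI, ← Complex.exp_add, mul_add]

theorem expTwoPiI_mul_I (r : ℝ) :
    expTwoPiI (r * Complex.I) = (Real.exp (-(2 * Real.pi * r)) : ℝ) := by
  rw [expTwoPiI, Complex.ofReal_exp]
  congr 1
  push_cast
  linear_combination (2 * Real.pi * r : ℂ) * Complex.I_mul_I

theorem norm_phase (N : ℕ) (τ : ℂ) (X : ℤ × ℤ) : ‖phase N τ X‖ = 1 := by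
  rw [phase, norm_expTwoPiI, Complex.ofReal_im]
  simp

section Kernel

variable {N : ℕ} [NeZero N] {τ : ℂ}

theorem natCast_pos_real : (0 : ℝ) < N := by exact_mod_cast Nat.pos_of_ne_zero (NeZero.ne N)

theorem kappa_pos (hτ : 0 < τ.im) : 0 < kappa N τ := by
  have := natCast_pos_real (N := N)
  exact Real.sqrt_pos.2 (by positivity)

theorem kappa_sq (hτ : 0 < τ.im) : kappa N τ ^ 2 = Real.pi * τ.im / N := by
  have := natCast_pos_real (N := N)
  exact Real.sq_sqrt (by positivity)

theorem expTwoPiI_mul_tau (hτ : 0 < τ.im) (X : ℤ × ℤ) (c : ℝ) :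
    expTwoPiI ((c * (X.1 * X.2 / N) : ℝ) * τ) = expTwoPiI ((c * (X.1 * X.2 / N) * τ.re : ℝ) : ℂ) *
      (Real.exp (-(c * (2 * kappa N τ ^ 2 * (X.1 * X.2)))) : ℝ) := by
  have e : ((c * (X.1 * X.2 / N) : ℝ) : ℂ) * τ = ((c * (X.1 * X.2 / N) * τ.re : ℝ) : ℂ) +
      ((c * (X.1 * X.2 / N) * τ.im : ℝ) : ℂ) * Complex.I := by
    conv_lhs => rw [← Complex.re_add_im τ]
    push_cast
    ring
  rw [e, expTwoPiI_add, expTwoPiI_mul_I, kappa_sq hτ]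
  congr 3
  ring

theorem iota_eq {t : ℝ} (ht : 0 < t) (X : ℤ × ℤ) : iota N t (toRealVec X) =
    ((X.1 / t + X.2 * t) / √(2 * N), (X.2 * t - X.1 / t) / √(2 * N)) := by
  have hN := natCast_pos_real (N := N)
  have h2 : √(N / 2 : ℝ) = N / √(2 * N) := by
    rw [eq_div_iff (by positivity), ← Real.sqrt_mul (by positivity),
      show (N / 2 * (2 * N) : ℝ) = N ^ 2 by ring, Real.sqrt_sq hN.le]
  simp only [iota, bilin, vecW, vecZ, toRealVec, h2]
  have h3 : √(2 * N : ℝ) ≠ 0 := (Real.sqrt_pos.2 (by positivity)).ne'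
  ext <;> field_simp
  ring

theorem phi_iota (hτ : 0 < τ.im) {t : ℝ} (ht : 0 < t) (X : ℤ × ℤ) :
    phi τ (iota N t (toRealVec X)) = phase N τ X * (phiTerm (kappa N τ) X.1 X.2 t : ℂ) := by
  have hN := natCast_pos_real (N := N)
  have hN2 : (0 : ℝ) < 2 * N := by positivity
  have hsq : √(2 * N : ℝ) ^ 2 = 2 * N := Real.sq_sqrt hN2.le
  rw [iota_eq ht, phi]
  set a : ℝ := (X.1 / t + X.2 * t) / √(2 * N) with ha
  set b : ℝ := (X.2 * t - X.1 / t) / √(2 * N) with hb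
  have h1 : (a : ℂ) ^ 2 / 2 * τ - (b : ℂ) ^ 2 / 2 * (starRingEnd ℂ) τ =
      ((X.1 * X.2 / N * τ.re : ℝ) : ℂ) + (((a ^ 2 + b ^ 2) / 2 * τ.im : ℝ) : ℂ) * Complex.I := by
    have hab : (a ^ 2 - b ^ 2) / 2 = X.1 * X.2 / N := by
      rw [ha, hb, div_pow, div_pow, hsq]
      field_simp
      ring
    have hconj : (starRingEnd ℂ) τ = τ.re - τ.im * Complex.I := by apply Complex.ext <;> simp
    have hτe := (Complex.re_add_im τ).symm
    rw [← hab, hconj]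
    push_cast
    linear_combination (a : ℂ) ^ 2 / 2 * hτe
  rw [h1, expTwoPiI_add, expTwoPiI_mul_I, phase]
  have h2 : √(2 * τ.im) * a * Real.exp (-(2 * Real.pi * ((a ^ 2 + b ^ 2) / 2 * τ.im))) =
      phiTerm (kappa N τ) X.1 X.2 t := by
    rw [phiTerm, gaussTerm, mul_pow, mul_pow, kappa_sq hτ]
    have e1 : √(2 * τ.im) * a = kappa N τ / √Real.pi * (X.1 / t + X.2 * t) := by
      rw [ha, kappa, Real.sqrt_div (by positivity), Real.sqrt_mul Real.pi_pos.le,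
        Real.sqrt_mul (by positivity), Real.sqrt_mul (by positivity)]
      have := Real.sqrt_pos.2 Real.pi_pos
      have := Real.sqrt_pos.2 hN
      field_simp
    rw [e1]
    congr 2
    rw [ha, hb, div_pow, div_pow, hsq]
    field_simp
    ring
  rw [← h2]
  push_cast
  ring

/-- The condition `y² > x²` in the kernel says `Q(X) < 0`. There the two signs cancel; on the
remaining vectors the sign of the first coordinate of `ι_t(X)` equals that of `x₁ + x₂` for every `t
> 0`. -/
theorem phiTilde_iota (hτ : 0 < τ.im) {t : ℝ} (ht : 0 < t) (X : ℤ × ℤ) :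
    phiTilde τ (iota N t (toRealVec X)) =
      (starRingEnd ℂ) (phase N τ X) * (tildeTerm (kappa N τ) X.1 X.2 t : ℂ) := by
  have hN := natCast_pos_real (N := N)
  have hN2 : (0 : ℝ) < 2 * N := by positivity
  have hs0 := Real.sqrt_pos.2 hN2
  have hsq : √(2 * N : ℝ) ^ 2 = 2 * N := Real.sq_sqrt hN2.le
  rw [iota_eq ht, phiTilde, phiPlus, phiStar]
  set a : ℝ := (X.1 / t + X.2 * t) / √(2 * N) with ha
  set b : ℝ := (X.2 * t - X.1 / t) / √(2 * N) with hb
  have hab : (b ^ 2 - a ^ 2) / 2 = -1 * (X.1 * X.2 / N) := by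
    rw [ha, hb, div_pow, div_pow, hsq]
    field_simp
    ring
  have h1 : ((b : ℂ) ^ 2 - (a : ℂ) ^ 2) / 2 * τ = ((-1 * (X.1 * X.2 / N) : ℝ) : ℂ) * τ := by
    rw [← hab]
    push_cast
    ring
  have hphase : (starRingEnd ℂ) (phase N τ X) =
      expTwoPiI ((-1 * (X.1 * X.2 / N) * τ.re : ℝ) : ℂ) := by
    rw [phase, expTwoPiI, expTwoPiI, ← Complex.exp_conj]
    congr 1
    simp only [map_mul, Complex.conj_ofReal, Complex.conj_I, map_ofNat]
    push_cast
    ring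
  have harg : √(2 * Real.pi * τ.im) * a = kappa N τ * (X.1 / t + X.2 * t) := by
    rw [ha, kappa, Real.sqrt_div (by positivity), mul_assoc 2, Real.sqrt_mul (by positivity) (_ * _),
      Real.sqrt_mul (by positivity) (N : ℝ)]
    have := Real.sqrt_pos.2 hN
    field_simp
  have hsign : (Real.sign a * (if a ^ 2 < b ^ 2 then 1 else 0) - Real.sign a : ℝ) =
      -signTerm X.1 X.2 := by
    have hiff : a ^ 2 < b ^ 2 ↔ (X.1 : ℝ) * X.2 < 0 := by
      have e : (X.1 : ℝ) * X.2 = -(N * ((b ^ 2 - a ^ 2) / 2)) := by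
        rw [hab]
        field_simp
      rw [e]
      constructor <;> intro h <;> nlinarith
    rw [signTerm]
    by_cases h : (X.1 : ℝ) * X.2 < 0
    · rw [if_pos (hiff.2 h), if_pos h]
      ring
    · rw [if_neg (fun h' => h (hiff.1 h')), if_neg h, mul_zero, zero_sub, neg_inj]
      push Not at h
      rcases lt_trichotomy ((X.1 : ℝ) + X.2) 0 with hs | hs | hs
      · have hx : (X.1 : ℝ) ≤ 0 := by by_contra hx; push Not at hx; nlinarith
        have hy : (X.2 : ℝ) ≤ 0 := by by_contra hy; push Not at hy; nlinarith
        have : (X.1 : ℝ) / t + X.2 * t < 0 := by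
          rcases lt_or_eq_of_le hx with hx | hx
          · have := div_neg_of_neg_of_pos hx ht
            nlinarith
          · rw [hx] at hs ⊢
            simp only [zero_add, zero_div] at hs ⊢
            nlinarith
        rw [Real.sign_of_neg hs, Real.sign_of_neg (div_neg_of_neg_of_pos this hs0)]
      · have hy : (X.2 : ℝ) = -X.1 := by linarith
        rw [hy] at h
        have hx : (X.1 : ℝ) = 0 := by nlinarith
        rw [ha, hy, hx]
        simp
      · have hx : 0 ≤ (X.1 : ℝ) := by by_contra hx; push Not at hx; nlinarith
        have hy : 0 ≤ (X.2 : ℝ) := by by_contra hy; push Not at hy; nlinarith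
        have : 0 < (X.1 : ℝ) / t + X.2 * t := by
          rcases lt_or_eq_of_le hx with hx | hx
          · have : 0 < (X.1 : ℝ) / t := by positivity
            nlinarith
          · rw [← hx] at hs ⊢
            simp only [zero_add, zero_div] at hs ⊢
            positivity
        rw [Real.sign_of_pos hs, Real.sign_of_pos (div_pos this hs0)]
  have hexp := expTwoPiI_mul_tau (N := N) hτ X (-1)
  simp only
  rw [h1, hexp, hphase, harg, tildeTerm, neg_eq_iff_eq_neg.1 hsign.symm]
  split_ifs <;> push_cast <;> ring_nf

end Kernel

/-! ### The odd Hurwitz zeta function at `s = 0` -/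

/-- The terms of a series for the odd Hurwitz zeta function converging near `s = 0`. -/
noncomputable def oddZetaTerm (a : ℝ) (n : ℕ) (s : ℂ) : ℂ :=
  ((n + a : ℝ) : ℂ) ^ (-s) - ((n + 1 - a : ℝ) : ℂ) ^ (-s) -
    s * (1 - 2 * a) * ((n + 1 : ℝ) : ℂ) ^ (-s - 1)

/-- The subtracted term is the first-order part of the difference of powers. Two mean value
estimates on `[n, n+1]`, for `x^{-s}` corrected by a linear function and for `x^{-s-1}`, leave an
error `O(n^{-3/2})` in the half-plane `Re s > -1/2`. -/
theorem norm_oddZetaTerm_le {a : ℝ} (ha : a ∈ Ioo (0 : ℝ) 1) {n : ℕ} (hn : n ≠ 0) {s : ℂ}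
    (hs : -(1 / 2) < s.re) :
    ‖oddZetaTerm a n s‖ ≤ ‖s‖ * (‖s‖ + 1) * (n : ℝ) ^ (-(3 / 2) : ℝ) := by
  have hn0 : (1 : ℝ) ≤ n := by exact_mod_cast Nat.one_le_iff_ne_zero.2 hn
  have hpos : ∀ x ∈ Icc (n : ℝ) (n + 1), 0 < x := fun x hx => by linarith [hx.1]
  have hpow : ∀ c : ℂ, ∀ x ∈ Icc (n : ℝ) (n + 1),
      HasDerivAt (fun x : ℝ => (x : ℂ) ^ c) (c * (x : ℂ) ^ (c - 1)) x := fun c x hx =>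
    ((Complex.hasStrictDerivAt_cpow_const (Complex.ofReal_mem_slitPlane.2
      (hpos x hx))).hasDerivAt).comp_ofReal
  have hle : ∀ x ∈ Icc (n : ℝ) (n + 1),
      ‖(x : ℂ) ^ (-s - 1) - ((n + 1 : ℝ) : ℂ) ^ (-s - 1)‖ ≤
        (‖s‖ + 1) * (n : ℝ) ^ (-(3 / 2) : ℝ) := by
    intro x hx
    have h := (convex_Icc (n : ℝ) (n + 1)).norm_image_sub_le_of_norm_hasDerivWithin_le
      (f := fun x : ℝ => (x : ℂ) ^ (-s - 1)) (C := (‖s‖ + 1) * (n : ℝ) ^ (-(3 / 2) : ℝ))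
      (fun y hy => (hpow (-s - 1) y hy).hasDerivWithinAt) (fun y hy => ?_)
      (right_mem_Icc.2 (by linarith)) hx
    · refine h.trans (mul_le_of_le_one_right (by positivity) ?_)
      rw [Real.norm_eq_abs, abs_le]
      constructor <;> linarith [hx.1, hx.2]
    · rw [norm_mul, Complex.norm_cpow_eq_rpow_re_of_pos (hpos y hy)]
      have h1 : ‖-s - 1‖ ≤ ‖s‖ + 1 := by
        refine (norm_sub_le _ _).trans ?_
        simp
      have h2 : y ^ (-s - 1 - 1).re ≤ (n : ℝ) ^ (-(3 / 2) : ℝ) := by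
        have hre : (-s - 1 - 1).re ≤ -(3 / 2) := by simp; linarith
        calc y ^ (-s - 1 - 1).re ≤ y ^ (-(3 / 2) : ℝ) :=
              Real.rpow_le_rpow_of_exponent_le (hn0.trans hy.1) hre
          _ ≤ _ := Real.rpow_le_rpow_of_nonpos (by linarith) hy.1 (by norm_num)
      exact mul_le_mul h1 h2 (Real.rpow_nonneg (hpos y hy).le _) (by positivity)
  have h := (convex_Icc (n : ℝ) (n + 1)).norm_image_sub_le_of_norm_hasDerivWithin_le
    (f := fun x : ℝ => (x : ℂ) ^ (-s) + s * ((n + 1 : ℝ) : ℂ) ^ (-s - 1) * (x : ℂ))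
    (f' := fun x => -s * (x : ℂ) ^ (-s - 1) + s * ((n + 1 : ℝ) : ℂ) ^ (-s - 1))
    (C := ‖s‖ * ((‖s‖ + 1) * (n : ℝ) ^ (-(3 / 2) : ℝ)))
    (x := n + 1 - a) (y := n + a)
    (fun y hy => (((hpow (-s) y hy).add
      ((Complex.ofRealCLM.hasDerivAt (x := y)).const_mul _)).congr_deriv
        (by simp)).hasDerivWithinAt) (fun y hy => ?_)
    ⟨by linarith [ha.2], by linarith [ha.1]⟩ ⟨by linarith [ha.1], by linarith [ha.2]⟩
  · have e : oddZetaTerm a n s =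
        (((n + a : ℝ) : ℂ) ^ (-s) + s * ((n + 1 : ℝ) : ℂ) ^ (-s - 1) * ((n + a : ℝ) : ℂ)) -
        (((n + 1 - a : ℝ) : ℂ) ^ (-s) + s * ((n + 1 : ℝ) : ℂ) ^ (-s - 1) *
          ((n + 1 - a : ℝ) : ℂ)) := by
      rw [oddZetaTerm]
      push_cast
      ring
    rw [e, mul_assoc ‖s‖]
    refine h.trans (mul_le_of_le_one_right (by positivity) ?_)
    rw [Real.norm_eq_abs, abs_le]
    constructor <;> linarith [ha.1, ha.2]
  · have e : -s * (y : ℂ) ^ (-s - 1) + s * ((n + 1 : ℝ) : ℂ) ^ (-s - 1) =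
        -s * ((y : ℂ) ^ (-s - 1) - ((n + 1 : ℝ) : ℂ) ^ (-s - 1)) := by ring
    rw [e, norm_mul, norm_neg]
    gcongr
    exact hle y hy

theorem hasDerivAt_const_cpow_neg {x : ℝ} (hx : 0 < x) (s : ℂ) :
    HasDerivAt (fun s : ℂ => (x : ℂ) ^ (-s)) (-((x : ℂ) ^ (-s) * Real.log x)) s := by
  have hx0 : (x : ℂ) ≠ 0 := by exact_mod_cast hx.ne'
  have := (hasDerivAt_neg s).const_cpow (c := (x : ℂ)) (Or.inl hx0)
  refine this.congr_deriv ?_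
  rw [Complex.ofReal_log hx.le]
  ring

theorem differentiable_oddZetaTerm {a : ℝ} (ha : a ∈ Ioo (0 : ℝ) 1) (n : ℕ) :
    Differentiable ℂ (oddZetaTerm a n) := by
  have h0 : (0 : ℝ) ≤ n := Nat.cast_nonneg n
  have h1 : ((n + a : ℝ) : ℂ) ≠ 0 := Complex.ofReal_ne_zero.2 (by linarith [ha.1])
  have h2 : ((n + 1 - a : ℝ) : ℂ) ≠ 0 := Complex.ofReal_ne_zero.2 (by linarith [ha.2])
  have h3 : ((n + 1 : ℝ) : ℂ) ≠ 0 := Complex.ofReal_ne_zero.2 (by linarith)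
  unfold oddZetaTerm
  exact ((differentiable_neg.const_cpow (Or.inl h1)).sub
    (differentiable_neg.const_cpow (Or.inl h2))).sub
    ((differentiable_id.mul_const _).mul ((differentiable_neg.sub_const 1).const_cpow (Or.inl h3)))

theorem deriv_oddZetaTerm_zero {a : ℝ} (ha : a ∈ Ioo (0 : ℝ) 1) (n : ℕ) :
    deriv (oddZetaTerm a n) 0 =
      (Real.log (n + 1 - a) - Real.log (n + a) - (1 - 2 * a) / (n + 1) : ℝ) := by
  have h0 : (0 : ℝ) ≤ n := Nat.cast_nonneg n
  have h1 : (0 : ℝ) < n + a := by linarith [ha.1]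
  have h2 : (0 : ℝ) < n + 1 - a := by linarith [ha.2]
  have h3 : (0 : ℝ) < n + 1 := by linarith
  have h3' : ((n + 1 : ℝ) : ℂ) ≠ 0 := by exact_mod_cast h3.ne'
  have hd := ((hasDerivAt_const_cpow_neg h1 0).sub (hasDerivAt_const_cpow_neg h2 0)).sub
    (((hasDerivAt_id (0 : ℂ)).mul_const (1 - 2 * a : ℂ)).mul
      (((hasDerivAt_neg (0 : ℂ)).sub_const 1).const_cpow (c := ((n + 1 : ℝ) : ℂ)) (Or.inl h3')))
  have : HasDerivAt (oddZetaTerm a n) _ 0 := hd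
  rw [this.deriv]
  simp only [neg_zero, Complex.cpow_zero, id, zero_sub, Complex.cpow_neg_one, zero_mul]
  push_cast
  ring

open Classical in
/-- The entire function `s ζ(s + 1)`. -/
noncomputable def mulZeta (s : ℂ) : ℂ := if s = 0 then 1 else s * riemannZeta (s + 1)

/-- The difference quotient is `ζ(s+1) - 1/s`, whose limit is Euler's constant. -/
theorem hasDerivAt_mulZeta_zero : HasDerivAt mulZeta Real.eulerMascheroniConstant 0 := by
  rw [hasDerivAt_iff_tendsto_slope]
  have h : Tendsto (fun s : ℂ => s + 1) (𝓝[≠] 0) (𝓝[≠] 1) := by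
    refine tendsto_nhdsWithin_of_tendsto_nhds_of_eventually_within _ ?_ ?_
    · have : Continuous fun s : ℂ => s + 1 := by fun_prop
      simpa using (this.tendsto 0).mono_left nhdsWithin_le_nhds
    · filter_upwards [self_mem_nhdsWithin] with s hs
      simpa using hs
  refine (tendsto_riemannZeta_sub_one_div.comp h).congr' ?_
  filter_upwards [self_mem_nhdsWithin] with s hs
  have hs0 : s ≠ 0 := hs
  rw [slope_def_field, mulZeta, mulZeta, if_neg hs0, if_pos rfl]
  simp only [Function.comp, add_sub_cancel_right, sub_zero]
  field_simp

theorem differentiable_mulZeta : Differentiable ℂ mulZeta := by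
  intro s
  by_cases hs : s = 0
  · subst hs
    exact hasDerivAt_mulZeta_zero.differentiableAt
  · have h : DifferentiableAt ℂ (fun s => s * riemannZeta (s + 1)) s :=
      differentiableAt_id.mul ((differentiableAt_riemannZeta (by simpa using hs)).comp s
        (differentiableAt_id.add_const 1))
    refine h.congr_of_eventuallyEq ?_
    filter_upwards [isOpen_ne.mem_nhds hs] with z hz
    rw [mulZeta, if_neg hz]

theorem hurwitzZetaOdd_eq_of_one_lt_re {a : ℝ} (ha : a ∈ Ioo (0 : ℝ) 1) {s : ℂ} (hs : 1 < s.re) :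
    HasSum (fun n => oddZetaTerm a n s)
      (2 * HurwitzZeta.hurwitzZetaOdd (a : UnitAddCircle) s - (1 - 2 * a) * mulZeta s) := by
  have h1 := (HurwitzZeta.hasSum_nat_hurwitzZetaOdd_of_mem_Icc (Ioo_subset_Icc_self ha) hs).mul_left 2
  have hs1 : 1 < (s + 1).re := by simp; linarith
  have hs0 : s ≠ 0 := by rintro rfl; simp at hs; linarith
  have hsum : Summable fun n : ℕ => 1 / (n + 1 : ℂ) ^ (s + 1) := by
    have := (summable_nat_add_iff 1).2 (Complex.summable_one_div_nat_cpow.2 hs1)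
    simpa using this
  have h2 := hsum.hasSum
  rw [← zeta_eq_tsum_one_div_nat_add_one_cpow hs1] at h2
  have h3 := h1.sub (h2.mul_left (s * (1 - 2 * a)))
  rw [mulZeta, if_neg hs0]
  convert! h3 using 1
  · ext n
    rw [oddZetaTerm, show -s - 1 = -(s + 1) by ring, Complex.cpow_neg, Complex.cpow_neg,
      Complex.cpow_neg]
    push_cast
    ring
  · ring

/-- The accelerated series converges normally near `0`, so the identity known for `Re s > 1` extends
there. The term `n = 0` stands apart because the uniform bound needs `n ≥ 1`. -/
theorem hurwitzZetaOdd_eq {a : ℝ} (ha : a ∈ Ioo (0 : ℝ) 1) :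
    ∃ G : ℂ → ℂ, HasSum (fun n => deriv (oddZetaTerm a (n + 1)) 0) (deriv G 0) ∧ G 0 = 0 ∧
      DifferentiableAt ℂ G 0 ∧
      ∀ᶠ s in 𝓝 (0 : ℂ), 2 * HurwitzZeta.hurwitzZetaOdd (a : UnitAddCircle) s =
        oddZetaTerm a 0 s + G s + (1 - 2 * a) * mulZeta s := by
  -- A connected neighbourhood of `0` that contains `2`, where the Dirichlet series converges. On
  -- the ball of radius `3` one has `‖s‖(‖s‖ + 1) ≤ 12`.
  set U : Set ℂ := {s : ℂ | -(1 / 2) < s.re} ∩ Metric.ball 0 3 with hU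
  have hUo : IsOpen U := (isOpen_lt continuous_const Complex.continuous_re).inter Metric.isOpen_ball
  have hUc : IsPreconnected U :=
    ((convex_halfSpace_re_gt _).inter (convex_ball _ _)).isPreconnected
  have hu : Summable fun n : ℕ => 12 * ((n + 1 : ℕ) : ℝ) ^ (-(3 / 2) : ℝ) :=
    ((summable_nat_add_iff 1).2 (Real.summable_nat_rpow.2 (by norm_num))).mul_left 12
  have hb : ∀ (n : ℕ) (s : ℂ), s ∈ U →
      ‖oddZetaTerm a (n + 1) s‖ ≤ 12 * ((n + 1 : ℕ) : ℝ) ^ (-(3 / 2) : ℝ) := by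
    intro n s hs
    refine (norm_oddZetaTerm_le ha n.succ_ne_zero hs.1).trans ?_
    have h3 : ‖s‖ ≤ 3 := (mem_ball_zero_iff.1 hs.2).le
    gcongr
    nlinarith [norm_nonneg s]
  have h0U : (0 : ℂ) ∈ U := ⟨by simp, by simp⟩
  have hdiff : ∀ n : ℕ, DifferentiableOn ℂ (oddZetaTerm a (n + 1)) U :=
    fun n => (differentiable_oddZetaTerm ha _).differentiableOn
  have hG := Complex.differentiableOn_tsum_of_summable_norm hu hdiff hUo hb
  refine ⟨fun s => ∑' n, oddZetaTerm a (n + 1) s,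
    Complex.hasSum_deriv_of_summable_norm hu hdiff hUo hb h0U, ?_,
    hG.differentiableAt (hUo.mem_nhds h0U), ?_⟩
  · simp [oddZetaTerm]
  · have hL : AnalyticOnNhd ℂ
        (fun s => 2 * HurwitzZeta.hurwitzZetaOdd (a : UnitAddCircle) s) U :=
      ((HurwitzZeta.differentiable_hurwitzZetaOdd _).const_mul 2).differentiableOn.analyticOnNhd hUo
    have hR : AnalyticOnNhd ℂ (fun s => oddZetaTerm a 0 s + ∑' n, oddZetaTerm a (n + 1) s +
        (1 - 2 * a) * mulZeta s) U :=
      (((differentiable_oddZetaTerm ha 0).differentiableOn.add hG).add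
        (differentiable_mulZeta.const_mul _).differentiableOn).analyticOnNhd hUo
    have h2U : (2 : ℂ) ∈ U := ⟨by norm_num, by simp; norm_num⟩
    have heq := hL.eqOn_of_preconnected_of_eventuallyEq hR hUc h2U (by
      have ho : IsOpen {s : ℂ | 1 < s.re} := isOpen_lt continuous_const Complex.continuous_re
      filter_upwards [ho.mem_nhds (by simp : (2 : ℂ) ∈ {s : ℂ | 1 < s.re})] with s hs
      have h := hurwitzZetaOdd_eq_of_one_lt_re ha hs
      have h' := h.summable.tsum_eq_zero_add
      rw [h.tsum_eq] at h'
      rw [← h']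
      ring)
    filter_upwards [hUo.mem_nhds h0U] with s hs using heq hs

theorem hurwitzZetaOdd_zero {a : ℝ} (ha : a ∈ Ioo (0 : ℝ) 1) :
    HurwitzZeta.hurwitzZetaOdd (a : UnitAddCircle) 0 = 1 / 2 - a := by
  obtain ⟨G, -, hG0, -, hG⟩ := hurwitzZetaOdd_eq ha
  have h := hG.self_of_nhds
  rw [hG0] at h
  simp [oddZetaTerm, mulZeta] at h
  linear_combination h / 2

/-- Differentiating the accelerated series gives sums of `log(n+1-a) - log(n+a) - (1-2a)/(n+1)` plus
`(1-2a)γ`. By Euler's limit formula for `log Γ` at `a` and `1 - a`, the harmonic sums cancel Euler's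
constant. -/
theorem deriv_hurwitzZetaOdd_zero {a : ℝ} (ha : a ∈ Ioo (0 : ℝ) 1) :
    2 * deriv (HurwitzZeta.hurwitzZetaOdd (a : UnitAddCircle)) 0 =
      (Real.log (Real.Gamma a) - Real.log (Real.Gamma (1 - a)) : ℝ) := by
  obtain ⟨G, hsum, hG0, hGd, hG⟩ := hurwitzZetaOdd_eq ha
  have hd : 2 * deriv (HurwitzZeta.hurwitzZetaOdd (a : UnitAddCircle)) 0 =
      deriv (oddZetaTerm a 0) 0 + deriv G 0 +
        (1 - 2 * a) * (Real.eulerMascheroniConstant : ℂ) := by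
    have h1 := (((differentiable_oddZetaTerm ha 0).differentiableAt (x := 0)).hasDerivAt.add
      hGd.hasDerivAt).add (hasDerivAt_mulZeta_zero.const_mul (1 - 2 * a : ℂ))
    have h2 := ((HurwitzZeta.differentiable_hurwitzZetaOdd
      (a : UnitAddCircle)).differentiableAt (x := 0)).hasDerivAt.const_mul (2 : ℂ)
    exact h2.unique (h1.congr_of_eventuallyEq hG)
  have hsum' : HasSum (fun n => deriv (oddZetaTerm a n) 0)
      (deriv (oddZetaTerm a 0) 0 + deriv G 0) := by
    rw [add_comm]
    refine (hasSum_nat_add_iff' 1).1 ?_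
    simpa using hsum
  rw [hd]
  generalize deriv (oddZetaTerm a 0) 0 + deriv G 0 = D at hsum' ⊢
  simp only [deriv_oddZetaTerm_zero ha] at hsum'
  have hlim := (hsum'.tendsto_sum_nat).comp (tendsto_add_atTop_nat 1)
  -- The index `n + 1` matches the `n + 1` summands in `logGammaSeq x n`; the additional `1/(n+1)`
  -- tends to `0`.
  have hH : Tendsto (fun n : ℕ => (harmonic (n + 1) : ℝ) - Real.log n) atTop
      (𝓝 Real.eulerMascheroniConstant) := by
    have h1 := Real.tendsto_harmonic_sub_log.add tendsto_one_div_add_atTop_nhds_zero_nat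
    rw [add_zero] at h1
    refine h1.congr fun n => ?_
    rw [harmonic_succ]
    push_cast
    ring
  have ha1 : 0 < 1 - a := by linarith [ha.2]
  have hreal := (((Real.BohrMollerup.tendsto_log_gamma ha.1).sub
    (Real.BohrMollerup.tendsto_log_gamma ha1)).sub (hH.const_mul (1 - 2 * a)))
  have hcomplex := (Complex.continuous_ofReal.tendsto _).comp hreal
  have key := tendsto_nhds_unique hlim (hcomplex.congr fun n => ?_)
  · rw [key]
    push_cast
    ring
  · simp only [Function.comp, Real.BohrMollerup.logGammaSeq]
    rw [← Complex.ofReal_sum]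
    congr 1
    simp only [harmonic_eq_sum_Icc, Finset.sum_sub_distrib]
    have e1 : ∑ x ∈ Finset.range (n + 1), Real.log (x + 1 - a) =
        ∑ x ∈ Finset.range (n + 1), Real.log (1 - a + x) :=
      Finset.sum_congr rfl fun x _ => by ring_nf
    have e2 : ∑ x ∈ Finset.range (n + 1), Real.log (x + a) =
        ∑ x ∈ Finset.range (n + 1), Real.log (a + x) :=
      Finset.sum_congr rfl fun x _ => by ring_nf
    have e3 : ∑ x ∈ Finset.range (n + 1), (1 - 2 * a) / ((x : ℝ) + 1) =
        (1 - 2 * a) * ((harmonic (n + 1) : ℚ) : ℝ) := by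
      rw [harmonic, Rat.cast_sum, Finset.mul_sum]
      refine Finset.sum_congr rfl fun x _ => ?_
      push_cast
      rw [div_eq_mul_inv]
    rw [e1, e2, e3, ← harmonic_eq_sum_Icc]
    ring

/-! ### Sums over the isotropic axes -/

/-- `∑_n (n + α) y exp(-π(n + α)²y²)`. -/
noncomputable def oddTheta (α : ℝ) (y : ℝ) : ℂ :=
  (y : ℂ) * (HurwitzZeta.oddKernel (α : UnitAddCircle) (y ^ 2) : ℂ)

theorem continuousOn_oddTheta (α : ℝ) : ContinuousOn (oddTheta α) (Ioi 0) := by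
  refine Complex.continuous_ofReal.continuousOn.mul (Complex.continuous_ofReal.comp_continuousOn
    ((HurwitzZeta.continuousOn_oddKernel _).comp (continuous_pow 2).continuousOn fun y hy => ?_))
  exact pow_pos (mem_Ioi.1 hy) 2

/-- Decay at `∞` is visible, decay at `0` comes from the functional equation. The odd kernel has no
constant term at either end. -/
theorem rapidDecay_oddTheta (α : ℝ) : RapidDecay (oddTheta α) := by
  have hP := HurwitzZeta.isStrong_hurwitzOddFEPair (α : UnitAddCircle)
  have htop : ∀ r : ℝ, (Complex.ofReal ∘ HurwitzZeta.oddKernel (α : UnitAddCircle)) =O[atTop]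
      (· ^ r) := fun r => hP.hf_top r
  have hzero : ∀ r : ℝ, (Complex.ofReal ∘ HurwitzZeta.oddKernel (α : UnitAddCircle)) =O[𝓝[>] 0]
      (· ^ r) := fun r => hP.hf_zero r
  refine ⟨(continuousOn_oddTheta α).locallyIntegrableOn measurableSet_Ioi, fun r => ?_,
    fun r => ?_⟩
  · have h1 := ((htop (-(r + 1) / 2)).comp_tendsto (tendsto_pow_atTop (α := ℝ) two_ne_zero))
    have h2 := ((isBigO_refl (fun y : ℝ => (y : ℂ)) atTop).norm_right.mul h1)
    refine h2.congr' ?_ ?_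
    · exact Eventually.of_forall fun y => by simp [oddTheta]
    · filter_upwards [eventually_gt_atTop 0] with y hy
      rw [Complex.norm_real, Real.norm_of_nonneg hy.le]
      simp only [Function.comp]
      rw [← Real.rpow_natCast, ← Real.rpow_mul hy.le]
      nth_rewrite 1 [← Real.rpow_one y]
      rw [← Real.rpow_add hy]
      congr 1
      push_cast
      ring
  · have ht : Tendsto (fun y : ℝ => y ^ 2) (𝓝[>] 0) (𝓝[>] 0) := by
      refine tendsto_nhdsWithin_of_tendsto_nhds_of_eventually_within _ ?_ ?_
      · simpa using ((continuous_pow (M := ℝ) 2).tendsto 0).mono_left nhdsWithin_le_nhds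
      · filter_upwards [self_mem_nhdsWithin] with y hy
        exact pow_pos (mem_Ioi.1 hy) 2
    have h1 := (hzero (-(r + 1) / 2)).comp_tendsto ht
    have h2 := ((isBigO_refl (fun y : ℝ => (y : ℂ)) (𝓝[>] 0)).norm_right.mul h1)
    refine h2.congr' ?_ ?_
    · exact Eventually.of_forall fun y => by simp [oddTheta]
    · filter_upwards [self_mem_nhdsWithin] with y hy
      have hy : 0 < y := hy
      rw [Complex.norm_real, Real.norm_of_nonneg hy.le]
      simp only [Function.comp]
      rw [← Real.rpow_natCast, ← Real.rpow_mul hy.le]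
      nth_rewrite 1 [← Real.rpow_one y]
      rw [← Real.rpow_add hy]
      congr 1
      push_cast
      ring

theorem mellin_oddTheta (α : ℝ) (s : ℂ) :
    mellin (oddTheta α) s = HurwitzZeta.completedHurwitzZetaOdd (α : UnitAddCircle) s := by
  have hP := HurwitzZeta.isStrong_hurwitzOddFEPair (α : UnitAddCircle)
  have e : oddTheta α = fun y : ℝ => (y : ℂ) ^ (1 : ℂ) •
      (Complex.ofReal ∘ HurwitzZeta.oddKernel (α : UnitAddCircle)) (y ^ (2 : ℝ)) := by
    ext y
    simp [oddTheta]
  rw [e, mellin_cpow_smul, mellin_comp_rpow, HurwitzZeta.completedHurwitzZetaOdd, hP.Λ_eq,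
    Complex.real_smul, abs_two]
  change _ = mellin (Complex.ofReal ∘ HurwitzZeta.oddKernel (α : UnitAddCircle)) _ / 2
  push_cast
  ring

/-- `∑_n (erf(√π (n + α) y) - sgn(n + α))`. -/
noncomputable def erfSum (α : ℝ) (y : ℝ) : ℂ :=
  ∑' n : ℤ, ((erf (√Real.pi * ((n + α) * y)) - Real.sign (n + α) : ℝ) : ℂ)

theorem abs_erfSum_term_le (α : ℝ) {y : ℝ} (hy : 0 < y) (n : ℤ) :
    |erf (√Real.pi * ((n + α) * y)) - Real.sign (n + α)| ≤
      Real.exp (-Real.pi * (n + α) ^ 2 * y ^ 2) := by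
  have hpi : 0 < √Real.pi := Real.sqrt_pos.2 Real.pi_pos
  have hsq : √Real.pi ^ 2 = Real.pi := Real.sq_sqrt Real.pi_pos.le
  refine (abs_erf_sub_sign_le ?_).trans_eq ?_
  · rcases eq_or_ne ((n : ℝ) + α) 0 with h | h
    · right
      simp [h]
    · left
      have : 0 < ((n : ℝ) + α) ^ 2 := by positivity
      have e : ((n : ℝ) + α) * (√Real.pi * ((n + α) * y)) = √Real.pi * ((n + α) ^ 2 * y) := by ring
      rw [e]
      positivity
  · rw [mul_pow, hsq]
    ring_nf

theorem summable_erfSum (α : ℝ) {y : ℝ} (hy : 0 < y) : Summable fun n : ℤ =>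
    ((erf (√Real.pi * ((n + α) * y)) - Real.sign (n + α) : ℝ) : ℂ) := by
  refine Summable.of_norm_bounded
    (HurwitzZeta.hasSum_int_evenKernel α (by positivity : 0 < y ^ 2)).summable fun n => ?_
  rw [Complex.norm_real]
  exact abs_erfSum_term_le α hy n

/-- Up to the factor `2`, the logarithmic derivative of the axis sum is the odd theta function. -/
theorem hasDerivAt_erfSum (α : ℝ) {y : ℝ} (hy : 0 < y) :
    HasDerivAt (erfSum α) (2 * oddTheta α y / y) y := by
  have hpi : 0 < √Real.pi := Real.sqrt_pos.2 Real.pi_pos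
  have hsq : √Real.pi ^ 2 = Real.pi := Real.sq_sqrt Real.pi_pos.le
  have hsum : ∑' n : ℤ, ((2 * ((n + α) * Real.exp (-Real.pi * (n + α) ^ 2 * y ^ 2)) : ℝ) : ℂ) =
      2 * oddTheta α y / y := by
    have hy0 : (y : ℂ) ≠ 0 := by exact_mod_cast hy.ne'
    rw [← Complex.ofReal_tsum, tsum_mul_left,
      (HurwitzZeta.hasSum_int_oddKernel α (by positivity : 0 < y ^ 2)).tsum_eq, oddTheta]
    push_cast
    field_simp
  rw [← hsum]
  have hy2 : 0 < (y / 2) ^ 2 := by positivity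
  refine hasDerivAt_tsum_of_isPreconnected (y₀ := y) (t := Ioi (y / 2))
    (g := fun (n : ℤ) (y : ℝ) =>
      ((erf (√Real.pi * ((n + α) * y)) - Real.sign (n + α) : ℝ) : ℂ))
    (g' := fun (n : ℤ) (y : ℝ) =>
      ((2 * ((n + α) * Real.exp (-Real.pi * (n + α) ^ 2 * y ^ 2)) : ℝ) : ℂ))
    (u := fun n : ℤ => 2 * ‖(n + α) * Real.exp (-Real.pi * (n + α) ^ 2 * (y / 2) ^ 2)‖)
    ((HurwitzZeta.hasSum_int_oddKernel α hy2).summable.norm.mul_left 2)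
    isOpen_Ioi isPreconnected_Ioi (fun n z hz => ?_) (fun n z hz => ?_)
    (mem_Ioi.2 (half_lt_self hy)) (summable_erfSum α hy) (mem_Ioi.2 (half_lt_self hy))
  · refine HasDerivAt.ofReal_comp ?_
    have h1 : HasDerivAt (fun z : ℝ => √Real.pi * ((n + α) * z)) (√Real.pi * (n + α)) z := by
      simpa using ((hasDerivAt_id z).const_mul ((n : ℝ) + α)).const_mul √Real.pi
    refine (((hasDerivAt_erf _).comp z h1).sub_const _).congr_deriv ?_
    rw [mul_pow, hsq]
    field_simp
  · have hz' : y / 2 < z := hz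
    rw [Complex.norm_real, norm_mul, Real.norm_of_nonneg zero_le_two, norm_mul, norm_mul,
      Real.norm_of_nonneg (Real.exp_pos _).le, Real.norm_of_nonneg (Real.exp_pos _).le]
    have h2 : Real.pi * (n + α) ^ 2 * (y / 2) ^ 2 ≤ Real.pi * (n + α) ^ 2 * z ^ 2 := by
      have := Real.pi_pos
      gcongr
    refine mul_le_mul_of_nonneg_left (mul_le_mul_of_nonneg_left (Real.exp_le_exp.2 ?_)
      (norm_nonneg _)) zero_le_two
    simp only [neg_mul]
    linarith

theorem tendsto_erfSum_atTop (α : ℝ) : Tendsto (erfSum α) atTop (𝓝 0) := by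
  have hs := (HurwitzZeta.hasSum_int_evenKernel α one_pos).summable
  have hpi : 0 < √Real.pi := Real.sqrt_pos.2 Real.pi_pos
  have h := tendsto_tsum_of_dominated_convergence (𝓕 := atTop)
    (f := fun (y : ℝ) (n : ℤ) =>
      ((erf (√Real.pi * ((n + α) * y)) - Real.sign (n + α) : ℝ) : ℂ))
    (g := fun _ => 0) hs (fun n => ?_) ?_
  · simp only [tsum_zero] at h
    exact h
  · rw [← Complex.ofReal_zero]
    refine (Complex.continuous_ofReal.tendsto 0).comp ?_
    rw [← sub_self (Real.sign (n + α))]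
    refine Tendsto.sub_const ?_ _
    rcases lt_trichotomy ((n : ℝ) + α) 0 with hn | hn | hn
    · rw [Real.sign_of_neg hn]
      exact tendsto_erf_atBot.comp ((tendsto_id.const_mul_atTop_of_neg hn).const_mul_atBot hpi)
    · simp [hn]
    · rw [Real.sign_of_pos hn]
      exact tendsto_erf_atTop.comp ((tendsto_id.const_mul_atTop hn).const_mul_atTop hpi)
  · filter_upwards [eventually_ge_atTop 1] with y hy n
    have hy0 : 0 < y := by linarith
    rw [Complex.norm_real]
    refine (abs_erfSum_term_le α hy0 n).trans ?_
    have h2 : Real.pi * (n + α) ^ 2 * 1 ≤ Real.pi * (n + α) ^ 2 * y ^ 2 := by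
      have := Real.pi_pos
      gcongr
      nlinarith
    refine Real.exp_le_exp.2 ?_
    simp only [neg_mul]
    linarith

theorem tendsto_nhdsGT_zero_of_hasDerivAt {f k : ℝ → ℂ}
    (hd : ∀ t, 0 < t → HasDerivAt f (k t / t) t)
    (hk : IntegrableOn (fun t => k t / (t : ℂ)) (Ioi 0)) (hf : Tendsto f atTop (𝓝 0)) :
    Tendsto f (𝓝[>] 0) (𝓝 (-mellin k 0)) := by
  rw [mellin_zero_eq]
  have hcov : AECover (volume.restrict (Ioi (0 : ℝ))) (𝓝[>] (0 : ℝ)) fun ε => Ioi ε :=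
    aecover_Ioi_of_Ioi (tendsto_nhdsWithin_of_tendsto_nhds tendsto_id)
  refine (hcov.integral_tendsto_of_countably_generated hk).neg.congr' ?_
  filter_upwards [self_mem_nhdsWithin] with ε hε
  have hε' : (0 : ℝ) < ε := hε
  rw [Measure.restrict_restrict_of_subset (Ioi_subset_Ioi hε'.le),
    integral_Ioi_of_hasDerivAt_of_tendsto' (fun t ht => hd t (hε'.trans_le ht))
      (hk.mono_set (Ioi_subset_Ioi hε'.le)) hf]
  simp

/-- Since the sum vanishes at `∞`, its limit at `0` is minus the integral of its derivative, a
Mellin value of the odd theta function. -/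
theorem tendsto_erfSum_zero (α : ℝ) : Tendsto (erfSum α) (𝓝[>] 0)
    (𝓝 (-(2 * HurwitzZeta.completedHurwitzZetaOdd (α : UnitAddCircle) 0))) := by
  have h := tendsto_nhdsGT_zero_of_hasDerivAt (fun t ht => hasDerivAt_erfSum α ht)
    ((rapidDecay_oddTheta α).const_mul 2).integrableOn_div (tendsto_erfSum_atTop α)
  rwa [mellin_const_mul, mellin_oddTheta] at h

section Scaling

variable {α β : ℝ}

theorem tendsto_mul_nhdsGT_zero (hβ : 0 < β) : Tendsto (fun t => β * t) (𝓝[>] 0) (𝓝[>] 0) := by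
  refine tendsto_nhdsWithin_of_tendsto_nhds_of_eventually_within _ ?_ ?_
  · have : Continuous fun t : ℝ => β * t := by fun_prop
    simpa using (this.tendsto 0).mono_left nhdsWithin_le_nhds
  · filter_upwards [self_mem_nhdsWithin] with t ht
    exact mul_pos hβ (mem_Ioi.1 ht)

theorem continuousOn_oddTheta_scale (hβ : 0 < β) :
    ContinuousOn (fun t => oddTheta α (β * t)) (Ioi 0) :=
  (continuousOn_oddTheta α).comp (by fun_prop) fun t ht => mul_pos hβ (mem_Ioi.1 ht)

theorem rapidDecay_oddTheta_scale (hβ : 0 < β) : RapidDecay (fun t => oddTheta α (β * t)) := by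
  refine ⟨(continuousOn_oddTheta_scale hβ).locallyIntegrableOn measurableSet_Ioi, fun r => ?_,
    fun r => ?_⟩
  · refine (((rapidDecay_oddTheta α).2 r).comp_tendsto
      (tendsto_id.const_mul_atTop hβ)).trans (IsBigO.of_bound (β ^ (-r)) ?_)
    filter_upwards [eventually_gt_atTop 0] with t ht
    simp only [Function.comp, id]
    rw [Real.mul_rpow hβ.le ht.le, norm_mul, Real.norm_of_nonneg (by positivity)]
  · refine (((rapidDecay_oddTheta α).3 r).comp_tendsto
      (tendsto_mul_nhdsGT_zero hβ)).trans (IsBigO.of_bound (β ^ (-r)) ?_)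
    filter_upwards [self_mem_nhdsWithin] with t ht
    simp only [Function.comp]
    rw [Real.mul_rpow hβ.le (le_of_lt ht), norm_mul, Real.norm_of_nonneg (by positivity)]

/-- The regularized integral attached to an axis. -/
noncomputable def axisConst (α β : ℝ) : ℂ :=
  2 * (Real.log β * HurwitzZeta.completedHurwitzZetaOdd (α : UnitAddCircle) 0 -
    deriv (HurwitzZeta.completedHurwitzZetaOdd (α : UnitAddCircle)) 0)

theorem mellin_oddTheta_scale (hβ : 0 < β) (s : ℂ) : mellin (fun t => oddTheta α (β * t)) s =
    (β : ℂ) ^ (-s) * HurwitzZeta.completedHurwitzZetaOdd (α : UnitAddCircle) s := by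
  rw [mellin_comp_mul_left _ _ hβ, mellin_oddTheta, smul_eq_mul]

/-- Rescaling multiplies the Mellin transform by `β^{-s}`, which is the origin of the `log β` term.
The logarithmic moment at `0` is the derivative of this product. -/
theorem deriv_mellin_oddTheta_scale (hβ : 0 < β) :
    HasDerivAt (mellin fun t => oddTheta α (β * t)) (-(axisConst α β / 2)) 0 := by
  have e : (mellin fun t => oddTheta α (β * t)) = fun s => (β : ℂ) ^ (-s) *
      HurwitzZeta.completedHurwitzZetaOdd (α : UnitAddCircle) s :=
    funext fun s => mellin_oddTheta_scale hβ s
  rw [e]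
  have h := (hasDerivAt_const_cpow_neg hβ 0).mul
    (HurwitzZeta.differentiable_completedHurwitzZetaOdd (α : UnitAddCircle) 0).hasDerivAt
  refine h.congr_deriv ?_
  simp only [neg_zero, Complex.cpow_zero, axisConst]
  ring

theorem mellin_log_oddTheta_scale (hβ : 0 < β) :
    mellin (fun t => Real.log t • oddTheta α (β * t)) 0 = -(axisConst α β / 2) :=
  ((rapidDecay_oddTheta_scale hβ).hasDerivAt_mellin 0).unique (deriv_mellin_oddTheta_scale hβ)

theorem rapidDecay_oddTheta_inv (hβ : 0 < β) : RapidDecay (fun t => oddTheta α (β * t⁻¹)) :=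
  (rapidDecay_oddTheta_scale hβ).comp_inv (continuousOn_oddTheta_scale hβ)

theorem mellin_oddTheta_inv (hβ : 0 < β) : mellin (fun t => oddTheta α (β * t⁻¹)) 0 =
    HurwitzZeta.completedHurwitzZetaOdd (α : UnitAddCircle) 0 := by
  have := mellin_comp_inv (fun t => oddTheta α (β * t)) 0
  rw [this, mellin_oddTheta_scale hβ]
  simp

theorem mellin_log_oddTheta_inv (hβ : 0 < β) :
    mellin (fun t => Real.log t • oddTheta α (β * t⁻¹)) 0 = axisConst α β / 2 := by
  have e : (mellin fun t => oddTheta α (β * t⁻¹)) =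
      fun s => mellin (fun t => oddTheta α (β * t)) (-s) :=
    funext fun s => mellin_comp_inv (fun t => oddTheta α (β * t)) s
  have h1 := (rapidDecay_oddTheta_inv (α := α) hβ).hasDerivAt_mellin 0
  rw [e] at h1
  have h0 := deriv_mellin_oddTheta_scale (α := α) hβ
  rw [← neg_zero] at h0
  have h2 := h0.scomp (0 : ℂ) (hasDerivAt_neg (0 : ℂ))
  have := h1.unique h2
  rw [this]
  simp

/-- The limits of the sum are `-2c` at `0` and `0` at `∞`, with `c` the completed zeta value at `0`.
Adding `c` makes them `∓c`, opposite as required. -/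
theorem hasRegConst_erfSum_scale (hβ : 0 < β) :
    HasRegConst (fun t => erfSum α (β * t) +
        HurwitzZeta.completedHurwitzZetaOdd (α : UnitAddCircle) 0)
      (-HurwitzZeta.completedHurwitzZetaOdd (α : UnitAddCircle) 0)
      (-mellin (fun t => Real.log t • (2 * oddTheta α (β * t))) 0) := by
  refine hasRegConst_of_hasDerivAt (fun t ht => ?_)
    ((rapidDecay_oddTheta_scale hβ).const_mul 2)
    (continuousOn_const.mul (continuousOn_oddTheta_scale hβ)) ?_ ?_
  · have h := (hasDerivAt_erfSum α (mul_pos hβ ht)).scomp t ((hasDerivAt_id t).const_mul β)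
    refine (h.add_const _).congr_deriv ?_
    have h1 : (t : ℂ) ≠ 0 := by exact_mod_cast ht.ne'
    have h2 : (β : ℂ) ≠ 0 := by exact_mod_cast hβ.ne'
    rw [Complex.real_smul]
    push_cast
    field_simp
  · have := ((tendsto_erfSum_zero α).comp (tendsto_mul_nhdsGT_zero hβ)).add_const
      (HurwitzZeta.completedHurwitzZetaOdd (α : UnitAddCircle) 0)
    convert! this using 2
    ring
  · have := ((tendsto_erfSum_atTop α).comp (tendsto_id.const_mul_atTop hβ)).add_const
      (HurwitzZeta.completedHurwitzZetaOdd (α : UnitAddCircle) 0)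
    simpa using this

theorem hasRegConst_erfSum_inv (hβ : 0 < β) :
    HasRegConst (fun t => erfSum α (β * t⁻¹) +
        HurwitzZeta.completedHurwitzZetaOdd (α : UnitAddCircle) 0)
      (HurwitzZeta.completedHurwitzZetaOdd (α : UnitAddCircle) 0)
      (-mellin (fun t => Real.log t • (-2 * oddTheta α (β * t⁻¹))) 0) := by
  have hc : ContinuousOn (fun t : ℝ => oddTheta α (β * t⁻¹)) (Ioi 0) :=
    (continuousOn_oddTheta_scale hβ).comp
      (continuousOn_inv₀.mono fun x hx => ne_of_gt hx) fun t ht => inv_pos.2 (mem_Ioi.1 ht)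
  refine hasRegConst_of_hasDerivAt (fun t ht => ?_)
    ((rapidDecay_oddTheta_inv hβ).const_mul (-2)) (continuousOn_const.mul hc) ?_ ?_
  · have h := (hasDerivAt_erfSum α (mul_pos hβ (inv_pos.2 ht))).scomp t
      ((hasDerivAt_inv ht.ne').const_mul β)
    refine (h.add_const _).congr_deriv ?_
    have h1 : (t : ℂ) ≠ 0 := by exact_mod_cast ht.ne'
    have h2 : (β : ℂ) ≠ 0 := by exact_mod_cast hβ.ne'
    rw [Complex.real_smul]
    push_cast
    field_simp
  · have := ((tendsto_erfSum_atTop α).comp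
      (tendsto_inv_nhdsGT_zero.const_mul_atTop hβ)).add_const
      (HurwitzZeta.completedHurwitzZetaOdd (α : UnitAddCircle) 0)
    simpa using this
  · have := ((tendsto_erfSum_zero α).comp ((tendsto_mul_nhdsGT_zero hβ).comp
      tendsto_inv_atTop_nhdsGT_zero)).add_const
      (HurwitzZeta.completedHurwitzZetaOdd (α : UnitAddCircle) 0)
    convert! this using 2
    ring

end Scaling

theorem completedHurwitzZetaOdd_zero_right {α : ℝ} (hα : α ∈ Ioo (0 : ℝ) 1) :
    HurwitzZeta.completedHurwitzZetaOdd (α : UnitAddCircle) 0 = 1 / 2 - α := by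
  rw [← hurwitzZetaOdd_zero hα, HurwitzZeta.hurwitzZetaOdd, zero_add, Complex.Gammaℝ_one, div_one]

/-- The completed function is `Γ_ℝ(s+1)` times the odd Hurwitz zeta function. Its derivative at `0`
therefore combines `Γ_ℝ'(1) = -(γ + log 4π)/2` with the logarithms of Gamma values; `Γ'/Γ(1/2) = -γ
- 2 log 2` rewrites the constants. -/
theorem axisConst_eq {α β : ℝ} (hα : α ∈ Ioo (0 : ℝ) 1) : axisConst α β =
    ((1 / 2 - α) * (2 * Real.log β + Real.log Real.pi -
      deriv Real.Gamma (1 / 2) / Real.Gamma (1 / 2)) -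
      Real.log (Real.Gamma α) + Real.log (Real.Gamma (1 - α)) : ℝ) := by
  have e : ∀ᶠ s in 𝓝 (0 : ℂ), HurwitzZeta.completedHurwitzZetaOdd (α : UnitAddCircle) s =
      HurwitzZeta.hurwitzZetaOdd (α : UnitAddCircle) s * Complex.Gammaℝ (s + 1) := by
    have ho : IsOpen {s : ℂ | -1 < s.re} := isOpen_lt continuous_const Complex.continuous_re
    filter_upwards [ho.mem_nhds (by simp : (0 : ℂ) ∈ {s : ℂ | -1 < s.re})] with s hs
    have hs' : -1 < s.re := hs
    rw [HurwitzZeta.hurwitzZetaOdd, div_mul_cancel₀]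
    exact Complex.Gammaℝ_ne_zero_of_re_pos (by simp; linarith)
  have hG : HasDerivAt (fun s : ℂ => Complex.Gammaℝ (s + 1))
      (-(Real.eulerMascheroniConstant + Complex.log (4 * Real.pi)) / 2) 0 := by
    have h := Complex.hasDerivAt_Gammaℝ_one
    rw [← zero_add (1 : ℂ)] at h
    exact h.comp_add_const 0 1
  have hd : deriv (HurwitzZeta.completedHurwitzZetaOdd (α : UnitAddCircle)) 0 =
      deriv (HurwitzZeta.hurwitzZetaOdd (α : UnitAddCircle)) 0 + (1 / 2 - α) *
      (-(Real.eulerMascheroniConstant + Complex.log (4 * Real.pi)) / 2) := by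
    have h := (((HurwitzZeta.differentiable_hurwitzZetaOdd (α : UnitAddCircle) 0).hasDerivAt.mul
      hG).congr_of_eventuallyEq e).deriv
    rw [h, zero_add, Complex.Gammaℝ_one, hurwitzZetaOdd_zero hα, mul_one]
  have hψ : deriv Real.Gamma (1 / 2) / Real.Gamma (1 / 2) =
      -(Real.eulerMascheroniConstant + 2 * Real.log 2) := by
    have hpi : √Real.pi ≠ 0 := (Real.sqrt_pos.2 Real.pi_pos).ne'
    rw [Real.hasDerivAt_Gamma_one_half.deriv, Real.Gamma_one_half_eq]
    field_simp
  have hlog : Complex.log (4 * Real.pi) = ((2 * Real.log 2 + Real.log Real.pi : ℝ) : ℂ) := by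
    have : (4 * Real.pi : ℂ) = ((2 ^ 2 * Real.pi : ℝ) : ℂ) := by push_cast; ring
    rw [this, ← Complex.ofReal_log (by positivity), Real.log_mul (by norm_num) Real.pi_pos.ne',
      Real.log_pow]
    push_cast
    ring
  have hz := deriv_hurwitzZetaOdd_zero hα
  rw [axisConst, completedHurwitzZetaOdd_zero_right hα, hd, hψ, hlog]
  push_cast at hz ⊢
  linear_combination -hz

/-- Oddness in the parameter. The zero class thus contributes nothing to the axis terms, where the
formula `1/2 - α` would give `1/2`. -/
theorem completedHurwitzZetaOdd_zero_left (s : ℂ) :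
    HurwitzZeta.completedHurwitzZetaOdd ((0 : ℝ) : UnitAddCircle) s = 0 := by
  have h := HurwitzZeta.completedHurwitzZetaOdd_neg ((0 : ℝ) : UnitAddCircle) s
  rw [← AddCircle.coe_neg, neg_zero] at h
  exact self_eq_neg.1 h

theorem axisConst_zero (β : ℝ) : axisConst 0 β = 0 := by
  have : HurwitzZeta.completedHurwitzZetaOdd ((0 : ℝ) : UnitAddCircle) = fun _ => 0 :=
    funext completedHurwitzZetaOdd_zero_left
  simp only [axisConst, this, deriv_const]
  simp

/-! ### Splitting a sum over a coset into non-isotropic vectors and the two axes -/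

section Splitting

variable {N : ℕ}

/-- The vectors of non-zero norm in a coset. -/
def anisoCoset (h : DiscGroup N) : Set (ℤ × ℤ) :=
  {X | X ∈ latticeCoset h ∧ X.1 ≠ 0 ∧ X.2 ≠ 0}

theorem ne_zero_of_mem_anisoCoset (h : DiscGroup N) : ∀ X ∈ anisoCoset h, X.1 ≠ 0 ∧ X.2 ≠ 0 :=
  fun _ hX => hX.2

variable [NeZero N]

theorem intCast_eq_iff_exists (x : ℤ) (r : ZMod N) :
    (x : ZMod N) = r ↔ ∃ n : ℤ, (r.val : ℤ) + N * n = x := by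
  have h1 : (x : ZMod N) = r ↔ (x : ZMod N) = ((r.val : ℤ) : ZMod N) := by simp
  rw [h1, eq_comm, ZMod.intCast_eq_intCast_iff_dvd_sub]
  exact ⟨fun ⟨n, hn⟩ => ⟨n, by linarith⟩, fun ⟨n, hn⟩ => ⟨n, by linarith⟩⟩

theorem injective_val_add_mul (r : ZMod N) :
    Function.Injective fun n : ℤ => (r.val : ℤ) + N * n := by
  intro m n h
  have hN : (N : ℤ) ≠ 0 := by exact_mod_cast NeZero.ne N
  have h' : (r.val : ℤ) + N * m = r.val + N * n := h
  exact mul_left_cancel₀ hN (by linarith)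

/-- The axes meet the coset only when a component of `h` vanishes. The origin lies on both axes, and
`f0` makes its double count harmless. -/
theorem hasSum_latticeCoset {h : DiscGroup N} {f : ℤ × ℤ → ℂ} {a b c : ℂ} (f0 : f (0, 0) = 0)
    (ha : HasSum (fun X : anisoCoset h => f X) a)
    (hb : h.2 = 0 → HasSum (fun n : ℤ => f ((h.1.val : ℤ) + N * n, 0)) b)
    (hc : h.1 = 0 → HasSum (fun n : ℤ => f (0, (h.2.val : ℤ) + N * n)) c) :
    HasSum (fun X : latticeCoset h => f X)
      (a + (if h.2 = 0 then b else 0) + (if h.1 = 0 then c else 0)) := by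
  have hb' : HasSum ({X : ℤ × ℤ | X ∈ latticeCoset h ∧ X.2 = 0}.indicator f)
      (if h.2 = 0 then b else 0) := by
    split_ifs with h2
    · have hr : {X : ℤ × ℤ | X ∈ latticeCoset h ∧ X.2 = 0} =
          Set.range fun n : ℤ => (((h.1.val : ℤ) + N * n, 0) : ℤ × ℤ) := by
        ext ⟨x, y⟩
        simp only [latticeCoset, mem_ofPred_eq, mem_range, Prod.mk.injEq, exists_and_right,
          intCast_eq_iff_exists x h.1]
        constructor
        · rintro ⟨⟨h1, -⟩, rfl⟩
          exact ⟨h1, rfl⟩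
        · rintro ⟨h1, rfl⟩
          exact ⟨⟨h1, by simp [h2]⟩, rfl⟩
      rw [← hasSum_subtype_iff_indicator, hr]
      refine (Function.Injective.hasSum_range_iff fun m n e => ?_).2 (hb h2)
      exact injective_val_add_mul h.1 (congrArg Prod.fst e)
    · have he : {X : ℤ × ℤ | X ∈ latticeCoset h ∧ X.2 = 0} = ∅ := by
        refine eq_empty_of_forall_notMem ?_
        rintro ⟨x, y⟩ ⟨⟨-, hy⟩, rfl⟩
        exact h2 (by simpa using hy.symm)
      rw [he, indicator_empty]
      exact hasSum_zero
  have hc' : HasSum ({X : ℤ × ℤ | X ∈ latticeCoset h ∧ X.1 = 0}.indicator f)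
      (if h.1 = 0 then c else 0) := by
    split_ifs with h1
    · have hr : {X : ℤ × ℤ | X ∈ latticeCoset h ∧ X.1 = 0} =
          Set.range fun n : ℤ => ((0, (h.2.val : ℤ) + N * n) : ℤ × ℤ) := by
        ext ⟨x, y⟩
        simp only [latticeCoset, mem_ofPred_eq, mem_range, Prod.mk.injEq, exists_and_left,
          intCast_eq_iff_exists y h.2]
        constructor
        · rintro ⟨⟨-, h2⟩, rfl⟩
          exact ⟨rfl, h2⟩
        · rintro ⟨rfl, h2⟩
          exact ⟨⟨by simp [h1], h2⟩, rfl⟩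
      rw [← hasSum_subtype_iff_indicator, hr]
      refine (Function.Injective.hasSum_range_iff fun m n e => ?_).2 (hc h1)
      exact injective_val_add_mul h.2 (congrArg Prod.snd e)
    · have he : {X : ℤ × ℤ | X ∈ latticeCoset h ∧ X.1 = 0} = ∅ := by
        refine eq_empty_of_forall_notMem ?_
        rintro ⟨x, y⟩ ⟨⟨hx, -⟩, rfl⟩
        exact h1 (by simpa using hx.symm)
      rw [he, indicator_empty]
      exact hasSum_zero
  have hs := ((hasSum_subtype_iff_indicator.1 ha).add hb').add hc'
  refine hasSum_subtype_iff_indicator.2 (hs.congr_fun ?_)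
  rintro ⟨x, y⟩
  by_cases hm : (x, y) ∈ latticeCoset h
  · by_cases hx : x = 0
    · by_cases hy : y = 0
      · subst hx hy
        have e : ∀ s : Set (ℤ × ℤ), s.indicator f (0, 0) = 0 :=
          fun s => indicator_apply_eq_zero.2 fun _ => f0
        simp only [e, add_zero]
      · subst hx
        simp [anisoCoset, hm, hy]
    · by_cases hy : y = 0
      · subst hy
        simp [anisoCoset, hm, hx]
      · simp [anisoCoset, hm, hx, hy]
  · simp [anisoCoset, hm]

end Splitting

/-! ### The theta kernels -/

section ThetaKernels

variable {N : ℕ} {τ : ℂ}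

theorem phase_of_mul_eq_zero {X : ℤ × ℤ} (h : X.1 = 0 ∨ X.2 = 0) : phase N τ X = 1 := by
  have : ((X.1 : ℝ) * X.2) = 0 := by rcases h with h | h <;> simp [h]
  simp [phase, this, expTwoPiI]

theorem norm_conj_phase_le (X : ℤ × ℤ) : ‖(starRingEnd ℂ) (phase N τ X)‖ ≤ 1 := by
  rw [RCLike.norm_conj, norm_phase]

/-- The scaling parameter `√(Nv)` of the sums over the axes. -/
noncomputable def axisScale (N : ℕ) (τ : ℂ) : ℝ := √(N * τ.im)

variable [NeZero N]

theorem axisScale_pos (hτ : 0 < τ.im) : 0 < axisScale N τ :=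
  Real.sqrt_pos.2 (mul_pos natCast_pos_real hτ)

/-- On an axis the coordinates are `N(n + α)`, so the Gaussian in `κN(n + α)` is the standard theta
series at scale `√(Nv)`. -/
theorem kappa_mul (hτ : 0 < τ.im) : kappa N τ * N = √Real.pi * axisScale N τ := by
  have hN := natCast_pos_real (N := N)
  have hpi := Real.pi_pos
  rw [kappa, axisScale, ← Real.sqrt_mul hpi.le]
  nth_rewrite 2 [← Real.sqrt_sq hN.le]
  rw [← Real.sqrt_mul (by positivity)]
  congr 1
  field_simp

/-- The representative of `x / N` in `[0, 1)`. -/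
noncomputable def valDiv (x : ZMod N) : ℝ := x.val / N

@[simp] theorem valDiv_zero {N : ℕ} : valDiv (0 : ZMod N) = 0 := by simp [valDiv]

theorem valDiv_mem_Ioo {x : ZMod N} (hx : x ≠ 0) : valDiv x ∈ Ioo (0 : ℝ) 1 := by
  have hN := natCast_pos_real (N := N)
  have h1 : 0 < x.val := Nat.pos_of_ne_zero fun h => hx ((ZMod.val_eq_zero x).1 h)
  refine ⟨by rw [valDiv]; positivity, ?_⟩
  rw [valDiv, div_lt_one hN]
  exact_mod_cast ZMod.val_lt x

theorem kappa_mul_val_add (hτ : 0 < τ.im) (x : ZMod N) (n : ℤ) :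
    kappa N τ * ((((x.val : ℤ) + N * n : ℤ)) : ℝ) =
      √Real.pi * ((n + valDiv x) * axisScale N τ) := by
  have hN := natCast_pos_real (N := N)
  have h := kappa_mul (N := N) hτ
  have e : (((x.val : ℤ) + N * n : ℤ) : ℝ) = N * (n + valDiv x) := by
    rw [valDiv]
    push_cast
    field_simp
    ring
  rw [e, ← mul_assoc, h]
  ring

theorem sign_val_add (x : ZMod N) (n : ℤ) :
    Real.sign (((x.val : ℤ) + N * n : ℤ) : ℝ) = Real.sign (n + valDiv x) := by
  have hN := natCast_pos_real (N := N)
  have e : (((x.val : ℤ) + N * n : ℤ) : ℝ) = N * (n + valDiv x) := by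
    rw [valDiv]
    push_cast
    field_simp
    ring
  rw [e]
  rcases lt_trichotomy ((n : ℝ) + valDiv x) 0 with h | h | h
  · rw [Real.sign_of_neg h, Real.sign_of_neg (mul_neg_of_pos_of_neg hN h)]
  · rw [h, mul_zero]
  · rw [Real.sign_of_pos h, Real.sign_of_pos (mul_pos hN h)]

theorem phiTerm_zero_right (κ x t : ℝ) : phiTerm κ x 0 t = phiTerm κ 0 x t⁻¹ := by
  simp only [phiTerm, gaussTerm, div_eq_mul_inv]
  ring_nf

theorem psiTerm_zero_left (κ x t : ℝ) : psiTerm κ 0 x t = 2 * phiTerm κ 0 x t := by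
  simp only [phiTerm, psiTerm]
  ring

theorem psiTerm_zero_right (κ x t : ℝ) : psiTerm κ x 0 t = -2 * phiTerm κ 0 x t⁻¹ := by
  simp only [phiTerm, psiTerm, gaussTerm, div_eq_mul_inv]
  ring_nf

theorem hasSum_phiTerm_axis (hτ : 0 < τ.im) (x : ZMod N) {t : ℝ} (ht : 0 < t) :
    HasSum (fun n : ℤ => (phiTerm (kappa N τ) 0 (((x.val : ℤ) + N * n : ℤ) : ℝ) t : ℂ))
      (oddTheta (valDiv x) (axisScale N τ * t)) := by
  have hb := axisScale_pos (N := N) hτ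
  have hsq : √Real.pi ^ 2 = Real.pi := Real.sq_sqrt Real.pi_pos.le
  have hpi : √Real.pi ≠ 0 := (Real.sqrt_pos.2 Real.pi_pos).ne'
  have h := (HurwitzZeta.hasSum_int_oddKernel (valDiv x)
    (by positivity : 0 < (axisScale N τ * t) ^ 2)).mul_left (axisScale N τ * t)
  rw [oddTheta, ← Complex.ofReal_mul]
  refine (Complex.hasSum_ofReal.2 h).congr_fun fun n => ?_
  congr 1
  have e := kappa_mul_val_add hτ x n
  have e1 : kappa N τ * ((((x.val : ℤ) + N * n : ℤ) : ℝ) * t) =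
      √Real.pi * ((n + valDiv x) * axisScale N τ) * t := by rw [← mul_assoc, e]
  simp only [phiTerm, gaussTerm, e1]
  rw [zero_div, zero_add, mul_zero, zero_pow two_ne_zero, zero_add, div_mul_eq_mul_div, e1,
    mul_assoc √Real.pi, mul_div_cancel_left₀ _ hpi, mul_pow √Real.pi, hsq]
  ring_nf

theorem hasSum_tildeTerm_axis (hτ : 0 < τ.im) (x : ZMod N) {t : ℝ} (ht : 0 < t) :
    HasSum (fun n : ℤ => (tildeTerm (kappa N τ) 0 (((x.val : ℤ) + N * n : ℤ) : ℝ) t : ℂ))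
      (erfSum (valDiv x) (axisScale N τ * t)) := by
  have hb := axisScale_pos (N := N) hτ
  refine (summable_erfSum (valDiv x) (mul_pos hb ht)).hasSum.congr_fun fun n => ?_
  congr 1
  have e := kappa_mul_val_add hτ x n
  rw [tildeTerm, signTerm, zero_mul, if_neg (lt_irrefl _), zero_add, sign_val_add, mul_zero,
    Real.exp_zero, one_mul, zero_div, zero_add, ← mul_assoc, e]
  ring_nf

theorem phiTerm_zero_zero (κ t : ℝ) : phiTerm κ 0 0 t = 0 := by simp [phiTerm]

theorem tildeTerm_zero_zero (κ t : ℝ) : tildeTerm κ 0 0 t = 0 := by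
  simp [tildeTerm, signTerm, erf_zero]

theorem summable_mul_phiTerm {κ : ℝ} (hκ : 0 < κ) {S : Set (ℤ × ℤ)}
    (hS : ∀ X ∈ S, X.1 ≠ 0 ∧ X.2 ≠ 0) {w : S → ℂ} (hw : ∀ X, ‖w X‖ ≤ 1) {t : ℝ} (ht : 0 < t) :
    Summable fun X : S => w X * (phiTerm κ X.1.1 X.1.2 t : ℂ) :=
  Summable.of_norm_bounded
    (((summable_norm_mul_exp_neg_subtype hS (by positivity : 0 < κ ^ 2)).mul_left
      (2 * κ / √Real.pi)).mul_right _)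
    fun X => norm_mul_le_of_norm_le_one (hw X) (abs_phiTerm_le_decay hκ ht
      (one_le_abs_of_mem hS X).1 (one_le_abs_of_mem hS X).2)

theorem summable_mul_psiTerm {κ : ℝ} (hκ : 0 < κ) {S : Set (ℤ × ℤ)}
    (hS : ∀ X ∈ S, X.1 ≠ 0 ∧ X.2 ≠ 0) {w : S → ℂ} (hw : ∀ X, ‖w X‖ ≤ 1) {t : ℝ} (ht : 0 < t) :
    Summable fun X : S => w X * (psiTerm κ X.1.1 X.1.2 t : ℂ) :=
  Summable.of_norm_bounded
    (((summable_norm_mul_exp_neg_subtype hS (by positivity : 0 < κ ^ 2)).mul_left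
      (2 * κ / √Real.pi)).mul_right _)
    fun X => norm_mul_le_of_norm_le_one (hw X) (abs_psiTerm_le_decay hκ ht
      (one_le_abs_of_mem hS X).1 (one_le_abs_of_mem hS X).2)

theorem summable_mul_tildeTerm {κ : ℝ} (hκ : 0 < κ) {S : Set (ℤ × ℤ)}
    (hS : ∀ X ∈ S, X.1 ≠ 0 ∧ X.2 ≠ 0) {w : S → ℂ} (hw : ∀ X, ‖w X‖ ≤ 1) {t : ℝ} (ht : 0 < t) :
    Summable fun X : S => w X * (tildeTerm κ X.1.1 X.1.2 t : ℂ) :=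
  Summable.of_norm_bounded (summable_exp_neg_subtype hS (by positivity : 0 < 2 * κ ^ 2))
    fun X => norm_mul_le_of_norm_le_one (hw X) (abs_tildeTerm_le hκ ht)

theorem hasSum_phi (hτ : 0 < τ.im) (h : DiscGroup N) {t : ℝ} (ht : 0 < t) :
    HasSum (fun X : latticeCoset h => phi τ (iota N t (toRealVec X)))
      ((∑' X : anisoCoset h, phase N τ X * (phiTerm (kappa N τ) X.1.1 X.1.2 t : ℂ)) +
        (if h.2 = 0 then oddTheta (valDiv h.1) (axisScale N τ * t⁻¹) else 0) +
        (if h.1 = 0 then oddTheta (valDiv h.2) (axisScale N τ * t) else 0)) := by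
  simp only [phi_iota hτ ht]
  refine hasSum_latticeCoset
    (f := fun X => phase N τ X * (phiTerm (kappa N τ) X.1 X.2 t : ℂ)) ?_ ?_ (fun _ => ?_)
    (fun _ => ?_)
  · simp [phiTerm_zero_zero]
  · exact (summable_mul_phiTerm (kappa_pos hτ) (ne_zero_of_mem_anisoCoset h)
      (w := fun X => phase N τ X) (fun X => (norm_phase N τ X).le) ht).hasSum
  · refine (hasSum_phiTerm_axis hτ h.1 (inv_pos.2 ht)).congr_fun fun n => ?_
    rw [phase_of_mul_eq_zero (Or.inr rfl), one_mul]
    simp only [Int.cast_zero, phiTerm_zero_right]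
  · refine (hasSum_phiTerm_axis hτ h.2 ht).congr_fun fun n => ?_
    rw [phase_of_mul_eq_zero (Or.inl rfl), one_mul]
    simp only [Int.cast_zero]

theorem hasSum_phiTilde (hτ : 0 < τ.im) (h : DiscGroup N) {t : ℝ} (ht : 0 < t) :
    HasSum (fun X : latticeCoset h => phiTilde τ (iota N t (toRealVec X)))
      ((∑' X : anisoCoset h, (starRingEnd ℂ) (phase N τ X) *
          (tildeTerm (kappa N τ) X.1.1 X.1.2 t : ℂ)) +
        (if h.2 = 0 then erfSum (valDiv h.1) (axisScale N τ * t⁻¹) else 0) +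
        (if h.1 = 0 then erfSum (valDiv h.2) (axisScale N τ * t) else 0)) := by
  simp only [phiTilde_iota hτ ht]
  refine hasSum_latticeCoset
    (f := fun X => (starRingEnd ℂ) (phase N τ X) * (tildeTerm (kappa N τ) X.1 X.2 t : ℂ)) ?_ ?_
    (fun _ => ?_) (fun _ => ?_)
  · simp [tildeTerm_zero_zero]
  · exact (summable_mul_tildeTerm (kappa_pos hτ) (ne_zero_of_mem_anisoCoset h)
      (w := fun X => (starRingEnd ℂ) (phase N τ X)) (fun X => norm_conj_phase_le X.1) ht).hasSum
  · refine (hasSum_tildeTerm_axis hτ h.1 (inv_pos.2 ht)).congr_fun fun n => ?_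
    rw [phase_of_mul_eq_zero (Or.inr rfl), map_one, one_mul, tildeTerm_swap]
    simp only [Int.cast_zero]
  · refine (hasSum_tildeTerm_axis hτ h.2 ht).congr_fun fun n => ?_
    rw [phase_of_mul_eq_zero (Or.inl rfl), map_one, one_mul]
    simp only [Int.cast_zero]

/-- The logarithmic derivative of the theta kernel `Θ̃_h` in `t`. -/
noncomputable def psiKernel (N : ℕ) (τ : ℂ) (t : ℝ) (h : DiscGroup N) : ℂ :=
  ∑' X : latticeCoset h, (starRingEnd ℂ) (phase N τ X) *
    (psiTerm (kappa N τ) X.1.1 X.1.2 t : ℂ)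

theorem hasSum_psiKernel (hτ : 0 < τ.im) (h : DiscGroup N) {t : ℝ} (ht : 0 < t) :
    HasSum (fun X : latticeCoset h => (starRingEnd ℂ) (phase N τ X) *
        (psiTerm (kappa N τ) X.1.1 X.1.2 t : ℂ))
      ((∑' X : anisoCoset h, (starRingEnd ℂ) (phase N τ X) *
          (psiTerm (kappa N τ) X.1.1 X.1.2 t : ℂ)) +
        (if h.2 = 0 then -2 * oddTheta (valDiv h.1) (axisScale N τ * t⁻¹) else 0) +
        (if h.1 = 0 then 2 * oddTheta (valDiv h.2) (axisScale N τ * t) else 0)) := by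
  refine hasSum_latticeCoset
    (f := fun X => (starRingEnd ℂ) (phase N τ X) * (psiTerm (kappa N τ) X.1 X.2 t : ℂ)) ?_ ?_
    (fun _ => ?_) (fun _ => ?_)
  · simp [psiTerm_zero_left, phiTerm_zero_zero]
  · exact (summable_mul_psiTerm (kappa_pos hτ) (ne_zero_of_mem_anisoCoset h)
      (w := fun X => (starRingEnd ℂ) (phase N τ X)) (fun X => norm_conj_phase_le X.1) ht).hasSum
  · refine ((hasSum_phiTerm_axis hτ h.1 (inv_pos.2 ht)).mul_left (-2)).congr_fun fun n => ?_
    rw [phase_of_mul_eq_zero (Or.inr rfl), map_one, one_mul]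
    simp only [Int.cast_zero, psiTerm_zero_right]
    push_cast
    ring
  · refine ((hasSum_phiTerm_axis hτ h.2 ht).mul_left 2).congr_fun fun n => ?_
    rw [phase_of_mul_eq_zero (Or.inl rfl), map_one, one_mul]
    simp only [Int.cast_zero, psiTerm_zero_left]
    push_cast
    ring

end ThetaKernels

/-! ### The regularized theta integrals as lattice sums -/

section ThetaIntegrals

variable {N : ℕ} [NeZero N] {τ : ℂ}

/-- The hypothesis matters: at the zero class the two normalizations give `1` and `0`. -/
theorem fracDiv_of_ne_zero {x : ZMod N} (hx : x ≠ 0) : (fracDiv x : ℝ) = valDiv x := by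
  have h := valDiv_mem_Ioo hx
  have h0 : fracDiv x = (x.val : ℚ) / N := by
    rw [fracDiv, fracPart, toIocMod_eq_self]
    have e : (((x.val : ℚ) / N : ℚ) : ℝ) = valDiv x := by
      rw [valDiv]
      push_cast
      rfl
    rw [← e] at h
    exact ⟨by exact_mod_cast h.1, by rw [zero_add]; exact_mod_cast h.2.le⟩
  rw [h0, valDiv]
  push_cast
  rfl

theorem valDiv_neg {x : ZMod N} (hx : x ≠ 0) : valDiv (-x) = 1 - valDiv x := by
  have hN := (natCast_pos_real (N := N)).ne'
  have : NeZero x := ⟨hx⟩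
  rw [valDiv, valDiv, ZMod.val_neg_of_ne_zero, Nat.cast_sub (ZMod.val_le x)]
  field_simp

theorem fracDiv_neg_of_ne_zero {x : ZMod N} (hx : x ≠ 0) :
    (fracDiv (-x) : ℝ) = 1 - valDiv x := by
  rw [fracDiv_of_ne_zero (neg_ne_zero.2 hx), valDiv_neg hx]

/-- This identifies `c_h(0)` with the sum of the corrections needed on the two axes. For `h = 0`
both sides vanish, by oddness of the zeta function. -/
theorem coeffC_zero_eq (h : DiscGroup N) : (coeffC h 0 : ℂ) =
    (if h.2 = 0 then HurwitzZeta.completedHurwitzZetaOdd (valDiv h.1 : UnitAddCircle) 0 else 0) +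
    (if h.1 = 0 then HurwitzZeta.completedHurwitzZetaOdd (valDiv h.2 : UnitAddCircle) 0 else 0) := by
  have hc : ∀ x : ZMod N, x ≠ 0 → (((1 / 2 - fracDiv x : ℚ)) : ℂ) =
      HurwitzZeta.completedHurwitzZetaOdd (valDiv x : UnitAddCircle) 0 := by
    intro x hx
    rw [completedHurwitzZetaOdd_zero_right (valDiv_mem_Ioo hx), ← fracDiv_of_ne_zero hx]
    push_cast
    ring
  rw [coeffC, if_pos rfl]
  by_cases h1 : h.1 = 0 <;> by_cases h2 : h.2 = 0
  · simp only [h1, h2, if_true, valDiv_zero, completedHurwitzZetaOdd_zero_left]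
    simp
  · rw [if_neg (by tauto), if_pos ⟨h1, h2⟩, if_neg h2, if_pos h1, zero_add, hc _ h2]
  · rw [if_pos ⟨h1, h2⟩, if_pos h2, if_neg h1, add_zero, hc _ h1]
  · rw [if_neg (by tauto), if_neg (by tauto), if_neg h2, if_neg h1]
    simp

/-- The scale is `√(Nv)`, so `2 log β = log N + log v`; the only dependence on `τ` is the term in
`log v`. -/
theorem axisConst_valDiv (hτ : 0 < τ.im) {x : ZMod N} (hx : x ≠ 0) :
    axisConst (valDiv x) (axisScale N τ) =
      ((((1 / 2 - fracDiv x : ℚ) : ℝ) *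
        (Real.log (Real.pi * N) - deriv Real.Gamma (1 / 2) / Real.Gamma (1 / 2)) -
        Real.log (Real.Gamma (fracDiv x)) + Real.log (Real.Gamma (fracDiv (-x)))) +
        ((1 / 2 - fracDiv x : ℚ) : ℝ) * Real.log τ.im : ℝ) := by
  have hN := natCast_pos_real (N := N)
  rw [axisConst_eq (valDiv_mem_Ioo hx), fracDiv_neg_of_ne_zero hx, Rat.cast_sub,
    fracDiv_of_ne_zero hx]
  congr 1
  have h1 : 2 * Real.log (axisScale N τ) = Real.log N + Real.log τ.im := by
    rw [axisScale, Real.log_sqrt (by positivity), Real.log_mul hN.ne' hτ.ne']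
    ring
  rw [h1, Real.log_mul Real.pi_pos.ne' hN.ne']
  push_cast
  ring

theorem sum_axisConst (hτ : 0 < τ.im) (h : DiscGroup N) :
    (if h.2 = 0 then axisConst (valDiv h.1) (axisScale N τ) else 0) +
      (if h.1 = 0 then axisConst (valDiv h.2) (axisScale N τ) else 0) =
    (coeffCTilde h 0 : ℂ) + (coeffC h 0 : ℂ) * (Real.log τ.im : ℂ) := by
  rw [coeffCTilde, if_pos rfl, coeffC, if_pos rfl]
  by_cases h1 : h.1 = 0 <;> by_cases h2 : h.2 = 0
  · simp [h1, h2, valDiv_zero, axisConst_zero]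
  · rw [if_neg h2, if_pos h1, if_neg h2, if_pos h1, if_neg (by tauto), if_pos ⟨h1, h2⟩,
      axisConst_valDiv hτ h2]
    push_cast
    ring
  · rw [if_pos h2, if_neg h1, if_pos h2, if_pos ⟨h1, h2⟩, axisConst_valDiv hτ h1]
    push_cast
    ring
  · rw [if_neg h2, if_neg h1, if_neg h2, if_neg h1, if_neg (by tauto), if_neg (by tauto)]
    simp

theorem rapidDecay_zero : RapidDecay (fun _ => 0) := by
  simpa using (rapidDecay_oddTheta 0).const_mul 0

theorem rapidDecay_ite {p : Prop} [Decidable p] {f : ℝ → ℂ} (hf : RapidDecay f) :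
    RapidDecay (fun t => if p then f t else 0) := by
  split_ifs
  · exact hf
  · exact rapidDecay_zero

theorem hasRegConst_ite {p : Prop} [Decidable p] {f : ℝ → ℂ} {E a : ℂ} (hf : HasRegConst f E a) :
    HasRegConst (fun t => if p then f t else 0) (if p then E else 0) (if p then a else 0) := by
  split_ifs
  · exact hf
  · have := rapidDecay_zero.hasRegConst
    simpa [mellin_zero_eq] using this

theorem mellin_ite {p : Prop} [Decidable p] {f : ℝ → ℂ} :
    mellin (fun t => if p then f t else 0) 0 = if p then mellin f 0 else 0 := by
  split_ifs
  · rfl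
  · simp [mellin_zero_eq]

/-- The theta kernel has no boundary values, and its regularized integral is a lattice sum. -/
theorem hasRegConst_thetaKernel (hτ : 0 < τ.im) (h : DiscGroup N) :
    ∃ a : ℂ, HasRegConst (fun t => thetaKernel N τ t h) 0 a ∧
      HasSum (fun X : anisoCoset h => phase N τ X *
        mellin (fun t => (phiTerm (kappa N τ) X.1.1 X.1.2 t : ℂ)) 0) (a - (coeffC h 0 : ℂ)) := by
  have hb := axisScale_pos (N := N) hτ
  obtain ⟨r, hs⟩ := rapidDecay_tsum_phiTerm (kappa_pos (N := N) hτ) (ne_zero_of_mem_anisoCoset h)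
    (w := fun X => phase N τ X) (fun X => (norm_phase N τ X).le)
  have r1 := rapidDecay_ite (p := h.2 = 0) (rapidDecay_oddTheta_inv (α := valDiv h.1) hb)
  have r2 := rapidDecay_ite (p := h.1 = 0) (rapidDecay_oddTheta_scale (α := valDiv h.2) hb)
  have R := ((r.hasRegConst.add r1.hasRegConst).add r2.hasRegConst).congr
    fun t ht => ((hasSum_phi hτ h ht).tsum_eq).symm
  rw [add_zero, add_zero] at R
  refine ⟨_, R, ?_⟩
  -- The value at `0` does not depend on the scale, nor on the inversion of `t`, so the axes
  -- contribute exactly `c_h(0)`.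
  rw [mellin_ite, mellin_ite, mellin_oddTheta_inv hb, mellin_oddTheta_scale hb, coeffC_zero_eq,
    neg_zero, Complex.cpow_zero, one_mul, add_assoc, add_sub_cancel_right]
  exact hs

theorem rapidDecay_psiKernel (hτ : 0 < τ.im) (h : DiscGroup N) :
    RapidDecay (fun t => psiKernel N τ t h) := by
  have hb := axisScale_pos (N := N) hτ
  obtain ⟨r, -⟩ := rapidDecay_tsum_psiTerm (kappa_pos (N := N) hτ) (ne_zero_of_mem_anisoCoset h)
    (w := fun X => (starRingEnd ℂ) (phase N τ X)) (fun X => norm_conj_phase_le X.1)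
  exact ((r.add (rapidDecay_ite ((rapidDecay_oddTheta_inv (α := valDiv h.1) hb).const_mul _))).add
    (rapidDecay_ite ((rapidDecay_oddTheta_scale (α := valDiv h.2) hb).const_mul _))).congr
    fun t ht => ((hasSum_psiKernel hτ h ht).tsum_eq).symm

/-- The pieces off the axes and on the two axes each have opposite boundary values, `c_h(0)`
supplying the axis corrections. Expressing the value through the undivided kernel `psiKernel` lets
the transformation law act on it. -/
theorem hasRegConst_thetaKernelTilde (hτ : 0 < τ.im) (h : DiscGroup N) :
    ∃ E : ℂ, HasRegConst (fun t => thetaKernelTilde N τ t h) E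
      (-mellin (fun t => Real.log t • psiKernel N τ t h) 0) := by
  have hb := axisScale_pos (N := N) hτ
  obtain ⟨r, -⟩ := rapidDecay_tsum_psiTerm (kappa_pos (N := N) hτ) (ne_zero_of_mem_anisoCoset h)
    (w := fun X => (starRingEnd ℂ) (phase N τ X)) (fun X => norm_conj_phase_le X.1)
  have r1 := rapidDecay_ite (p := h.2 = 0)
    ((rapidDecay_oddTheta_inv (α := valDiv h.1) hb).const_mul (-2))
  have r2 := rapidDecay_ite (p := h.1 = 0)
    ((rapidDecay_oddTheta_scale (α := valDiv h.2) hb).const_mul 2)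
  have R := ((hasRegConst_tsum_tildeTerm (kappa_pos (N := N) hτ) (ne_zero_of_mem_anisoCoset h)
    (w := fun X => (starRingEnd ℂ) (phase N τ X)) (fun X => norm_conj_phase_le X.1)).add
    (hasRegConst_ite (p := h.2 = 0) (hasRegConst_erfSum_inv (α := valDiv h.1) hb))).add
    (hasRegConst_ite (p := h.1 = 0) (hasRegConst_erfSum_scale (α := valDiv h.2) hb))
  have R' := R.congr (g := fun t => thetaKernelTilde N τ t h) fun t ht => by
    rw [thetaKernelTilde, (hasSum_phiTilde hτ h ht).tsum_eq, coeffC_zero_eq]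
    split_ifs <;> ring
  refine ⟨_, R'.1, R'.2.trans ?_⟩
  have m := r.log_smul.mellinConvergent 0
  have m1 := r1.log_smul.mellinConvergent 0
  have m2 := r2.log_smul.mellinConvergent 0
  have e : mellin (fun t => Real.log t • psiKernel N τ t h) 0 = mellin (fun t =>
      (Real.log t • (∑' X : anisoCoset h, (starRingEnd ℂ) (phase N τ X) *
          (psiTerm (kappa N τ) X.1.1 X.1.2 t : ℂ)) +
        Real.log t • (if h.2 = 0 then -2 * oddTheta (valDiv h.1) (axisScale N τ * t⁻¹) else 0)) +
        Real.log t • (if h.1 = 0 then 2 * oddTheta (valDiv h.2) (axisScale N τ * t) else 0)) 0 := by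
    rw [mellin, mellin]
    refine setIntegral_congr_fun measurableSet_Ioi fun t ht => ?_
    simp only [psiKernel]
    rw [(hasSum_psiKernel hτ h ht).tsum_eq]
    simp only [smul_add]
  rw [e, (hasMellin_add (hasMellin_add m m1).1 m2).2, (hasMellin_add m m1).2]
  simp only [smul_ite, smul_zero, mellin_ite, neg_add_rev]
  split_ifs <;> ring

theorem varthetaTilde_eq (hτ : 0 < τ.im) (h : DiscGroup N) :
    varthetaTilde N τ h = -mellin (fun t => Real.log t • psiKernel N τ t h) 0 :=
  (hasRegConst_thetaKernelTilde hτ h).choose_spec.constTermAtZero_eq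

theorem mellin_log_mul {f : ℝ → ℂ} (c : ℂ) : mellin (fun t => Real.log t • (c * f t)) 0 =
    c * mellin (fun t => Real.log t • f t) 0 := by
  simp only [← mul_smul_comm]
  exact mellin_const_mul _ _ _

/-- The same integral as in `varthetaTilde_eq`, now evaluated piece by piece. The two axes enter
with kernels of opposite sign in the variables `t` and `t⁻¹`, so both give `+axisConst`. -/
theorem hasSum_varthetaTilde (hτ : 0 < τ.im) (h : DiscGroup N) :
    HasSum (fun X : anisoCoset h => (starRingEnd ℂ) (phase N τ X) *
        (logCoeff (kappa N τ) X.1.1 X.1.2 : ℂ))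
      (varthetaTilde N τ h - ((coeffCTilde h 0 : ℂ) + (coeffC h 0 : ℂ) * (Real.log τ.im : ℂ))) := by
  have hb := axisScale_pos (N := N) hτ
  obtain ⟨r, -, hs⟩ := rapidDecay_tsum_psiTerm (kappa_pos (N := N) hτ) (ne_zero_of_mem_anisoCoset h)
    (w := fun X => (starRingEnd ℂ) (phase N τ X)) (fun X => norm_conj_phase_le X.1)
  convert hs using 1
  have R := ((hasRegConst_tsum_tildeTerm (kappa_pos (N := N) hτ) (ne_zero_of_mem_anisoCoset h)
    (w := fun X => (starRingEnd ℂ) (phase N τ X)) (fun X => norm_conj_phase_le X.1)).add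
    (hasRegConst_ite (p := h.2 = 0) (hasRegConst_erfSum_inv (α := valDiv h.1) hb))).add
    (hasRegConst_ite (p := h.1 = 0) (hasRegConst_erfSum_scale (α := valDiv h.2) hb))
  have R' := R.congr (g := fun t => thetaKernelTilde N τ t h) fun t ht => by
    rw [thetaKernelTilde, (hasSum_phiTilde hτ h ht).tsum_eq, coeffC_zero_eq]
    split_ifs <;> ring
  rw [varthetaTilde, R'.constTermAtZero_eq, ← sum_axisConst hτ h, mellin_log_mul, mellin_log_mul,
    mellin_log_oddTheta_inv hb, mellin_log_oddTheta_scale hb]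
  split_ifs <;> ring

theorem hasSum_vartheta (hτ : 0 < τ.im) (h : DiscGroup N) :
    HasSum (fun X : anisoCoset h => phase N τ X *
        mellin (fun t => (phiTerm (kappa N τ) X.1.1 X.1.2 t : ℂ)) 0)
      (vartheta N τ h - (coeffC h 0 : ℂ)) := by
  obtain ⟨a, ha, hs⟩ := hasRegConst_thetaKernel hτ h
  rwa [vartheta, ha.constTermAtZero_eq]

end ThetaIntegrals

/-! ### Partial Poisson summation -/

/-- Poisson summation for a Gaussian times a linear polynomial. -/
theorem tsum_linear_mul_gaussian {y : ℝ} (hy : 0 < y) (a w : ℝ) (A B : ℂ) :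
    ∑' k : ℤ, (A * (k + a) + B) * Complex.exp (-(2 * Real.pi * Complex.I * ((k + a) * w)) -
        Real.pi * y * (k + a) ^ 2) =
      (1 / √y : ℝ) * ∑' n : ℤ, (B - Complex.I * A / y * (n + w)) *
        Complex.exp (2 * Real.pi * Complex.I * (n * a) - Real.pi / y * (n + w) ^ 2) := by
  have hy0 : (y : ℂ) ≠ 0 := by exact_mod_cast hy.ne'
  have hpi : (Real.pi : ℂ) ≠ 0 := by exact_mod_cast Real.pi_ne_zero
  have hI : Complex.I ≠ 0 := Complex.I_ne_zero
  have hI2 := Complex.I_sq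
  -- With `T = iy` and `z = -w + iya`, the summands are the terms of the Jacobi theta function and
  -- of its `z`-derivative, up to the factor `E`. The claim is then the pair of functional equations
  -- under `T ↦ -1/T`.
  set T : ℂ := Complex.I * y with hT
  set z : ℂ := -w + Complex.I * (y * a) with hz
  have hT0 : T ≠ 0 := mul_ne_zero hI hy0
  have hTim : 0 < T.im := by simpa [hT] using hy
  have hT' : -1 / T = Complex.I / y := by
    rw [hT, div_eq_div_iff (mul_ne_zero hI hy0) hy0]
    linear_combination (-(y : ℂ)) * hI2
  have hTim' : 0 < (-1 / T).im := by
    rw [hT', Complex.div_ofReal_im, Complex.I_im]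
    positivity
  have hzT : z / T = a + Complex.I * w / y := by
    rw [hT, hz]
    field_simp
    linear_combination (-(w : ℂ)) * hI2
  have hsq : (-Complex.I * T) ^ (1 / 2 : ℂ) = (√y : ℝ) := by
    have : -Complex.I * T = (y : ℂ) := by
      rw [hT]
      linear_combination (-(y : ℂ)) * hI2
    rw [this, Real.sqrt_eq_rpow, Complex.ofReal_cpow hy.le]
    norm_num
  set E : ℂ := Complex.exp (-(2 * Real.pi * Complex.I * (a * w)) - Real.pi * y * a ^ 2) with hE
  set E' : ℂ := Complex.exp (-(Real.pi / y * w ^ 2)) with hE'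
  have hEE : E * Complex.exp (-Real.pi * Complex.I * z ^ 2 / T) = E' := by
    rw [hE, hE', ← Complex.exp_add]
    congr 1
    rw [hT, hz]
    field_simp
    linear_combination (-(y ^ 2 * a ^ 2 : ℂ)) * hI2
  have hl : ∀ k : ℤ, (A * (k + a) + B) *
      Complex.exp (-(2 * Real.pi * Complex.I * ((k + a) * w)) - Real.pi * y * (k + a) ^ 2) =
      E * (A / (2 * Real.pi * Complex.I) * jacobiTheta₂'_term k z T +
        (A * a + B) * jacobiTheta₂_term k z T) := by
    intro k
    have h1 : Complex.exp (-(2 * Real.pi * Complex.I * ((k + a) * w)) -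
        Real.pi * y * (k + a) ^ 2) = E * jacobiTheta₂_term k z T := by
      rw [hE, jacobiTheta₂_term, ← Complex.exp_add]
      congr 1
      rw [hT, hz]
      linear_combination (-(2 * Real.pi * k * y * a + Real.pi * k ^ 2 * y) : ℂ) * hI2
    rw [h1, jacobiTheta₂'_term]
    field_simp
    ring
  have hr : ∀ n : ℤ, (B - Complex.I * A / y * (n + w)) *
      Complex.exp (2 * Real.pi * Complex.I * (n * a) - Real.pi / y * (n + w) ^ 2) =
      E' * (A / (2 * Real.pi * Complex.I * T) * jacobiTheta₂'_term n (z / T) (-1 / T) +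
        (A * a + B - A / T * z) * jacobiTheta₂_term n (z / T) (-1 / T)) := by
    intro n
    have h1 : Complex.exp (2 * Real.pi * Complex.I * (n * a) - Real.pi / y * (n + w) ^ 2) =
        E' * jacobiTheta₂_term n (z / T) (-1 / T) := by
      rw [hE', jacobiTheta₂_term, ← Complex.exp_add]
      congr 1
      rw [hzT, hT']
      field_simp
      linear_combination (-(2 * n * w + n ^ 2) : ℂ) * hI2
    rw [h1, jacobiTheta₂'_term]
    have h2 : B - Complex.I * A / y * (n + w) =
        A / (2 * Real.pi * Complex.I * T) * (2 * Real.pi * Complex.I * n) +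
          (A * a + B - A / T * z) := by
      rw [hT, hz]
      field_simp
      linear_combination (-(A * (n + w)) : ℂ) * hI2
    rw [h2]
    ring
  have s1 := ((hasSum_jacobiTheta₂'_term z hTim).mul_left (A / (2 * Real.pi * Complex.I))).add
    ((hasSum_jacobiTheta₂_term z hTim).mul_left (A * a + B))
  have s2 := ((hasSum_jacobiTheta₂'_term (z / T) hTim').mul_left
    (A / (2 * Real.pi * Complex.I * T))).add
    ((hasSum_jacobiTheta₂_term (z / T) hTim').mul_left (A * a + B - A / T * z))
  rw [tsum_congr hl, tsum_congr hr, (s1.mul_left E).tsum_eq, (s2.mul_left E').tsum_eq,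
    jacobiTheta₂_functional_equation z T, jacobiTheta₂'_functional_equation z T, hsq, ← hEE]
  have hsy : ((√y : ℝ) : ℂ) ≠ 0 := by exact_mod_cast (Real.sqrt_pos.2 hy).ne'
  push_cast
  field_simp
  ring

/-! ### The equivariant double series -/

section Modularity

variable {N : ℕ} [NeZero N]

/-- The summand of the double series obtained from `Ψ_h` by Poisson summation. -/
noncomputable def eisTerm (N : ℕ) (τ : ℂ) (t : ℝ) (X : ℤ × ℤ) : ℂ :=
  -2 * Complex.I / (N * τ.im * t ^ 2) * (starRingEnd ℂ) (X.1 * τ + X.2) *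
    (Real.exp (-(Real.pi * ‖(X.1 * τ + X.2 : ℂ)‖ ^ 2 / (N * τ.im * t ^ 2))) : ℝ)

/-- Combine `x ≤ e^x` with `2x ≤ cx² + 1/c`. -/
theorem mul_exp_neg_sq_le {c x : ℝ} (hc : 0 < c) :
    x * Real.exp (-(c * x ^ 2)) ≤ Real.exp c⁻¹ * Real.exp (-x) := by
  have h1 : x ≤ Real.exp x := by linarith [Real.add_one_le_exp x]
  calc x * Real.exp (-(c * x ^ 2)) ≤ Real.exp x * Real.exp (-(c * x ^ 2)) := by gcongr
    _ = Real.exp (x - c * x ^ 2) := by rw [← Real.exp_add]; ring_nf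
    _ ≤ Real.exp (c⁻¹ - x) := by
        refine Real.exp_le_exp.2 ?_
        have h2 : 0 ≤ c * (x - c⁻¹) ^ 2 := by positivity
        have h3 : c * (x - c⁻¹) ^ 2 = c * x ^ 2 - 2 * x + c⁻¹ := by
          field_simp
          ring
        linarith
    _ = _ := by rw [← Real.exp_add]; ring_nf

/-- A lower bound of `|mτ + n|` by a multiple of `max(|m|, |n|)` reduces to a product of two
one-dimensional exponential series. -/
theorem summable_eisTerm (τ : UpperHalfPlane) {t : ℝ} (ht : 0 < t) :
    Summable (eisTerm N τ t) := by
  have hN := natCast_pos_real (N := N)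
  have hv : 0 < (τ : ℂ).im := τ.im_pos
  have hr := EisensteinSeries.r_pos τ
  set r := EisensteinSeries.r τ
  have hs := summable_pow_mul_exp_neg_abs 0 (half_pos hr)
  have hs2 := hs.mul_of_nonneg hs (fun n => by positivity) (fun n => by positivity)
  set c : ℝ := Real.pi / (N * (τ : ℂ).im * t ^ 2) with hc
  have hc0 : 0 < c := by positivity
  refine Summable.of_norm_bounded (hs2.mul_left
    (2 / (N * (τ : ℂ).im * t ^ 2) * Real.exp c⁻¹)) fun X => ?_
  have hX : r * max |(X.1 : ℝ)| |(X.2 : ℝ)| ≤ ‖(X.1 * (τ : ℂ) + X.2 : ℂ)‖ := by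
    by_cases h0 : X = 0
    · simp [h0]
    · have h1 := EisensteinSeries.r_mul_max_le τ (x := ![X.1, X.2]) (by
        intro h
        apply h0
        have e0 := congrFun h 0
        have e1 := congrFun h 1
        simp only [Matrix.cons_val_zero, Matrix.cons_val_one, Pi.zero_apply] at e0 e1
        exact Prod.ext e0 e1)
      simpa [EisensteinSeries.norm_eq_max_natAbs] using h1
  have e1 : ‖(-2 * Complex.I / (N * (τ : ℂ).im * t ^ 2) : ℂ)‖ =
      2 / (N * (τ : ℂ).im * t ^ 2) := by
    rw [norm_div, norm_mul, norm_neg, Complex.norm_I]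
    simp [abs_of_pos τ.im_pos]
  rw [eisTerm, norm_mul, norm_mul, e1, RCLike.norm_conj, Complex.norm_real,
    Real.norm_of_nonneg (Real.exp_pos _).le, mul_assoc, mul_assoc (2 / (N * (τ : ℂ).im * t ^ 2))]
  refine mul_le_mul_of_nonneg_left ?_ (by positivity : 0 ≤ 2 / (N * (τ : ℂ).im * t ^ 2))
  have e2 : Real.pi * ‖(X.1 * (τ : ℂ) + X.2 : ℂ)‖ ^ 2 / (N * (τ : ℂ).im * t ^ 2) =
      c * ‖(X.1 * (τ : ℂ) + X.2 : ℂ)‖ ^ 2 := by rw [hc]; ring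
  rw [e2]
  refine (mul_exp_neg_sq_le hc0).trans (mul_le_mul_of_nonneg_left ?_ (Real.exp_pos _).le)
  simp only [pow_zero, one_mul]
  rw [← Real.exp_add]
  refine Real.exp_le_exp.2 ?_
  have h2 : |(X.1 : ℝ)| + |(X.2 : ℝ)| ≤ 2 * max |(X.1 : ℝ)| |(X.2 : ℝ)| := by
    linarith [le_max_left |(X.1 : ℝ)| |(X.2 : ℝ)|, le_max_right |(X.1 : ℝ)| |(X.2 : ℝ)|]
  nlinarith

/-- The sum of `eisTerm` over a coset. -/
noncomputable def eisKernel (N : ℕ) (τ : ℂ) (t : ℝ) (x : DiscGroup N) : ℂ :=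
  ∑' X : latticeCoset x, eisTerm N τ t X

theorem hasSum_eisTerm_fst (τ : UpperHalfPlane) (h : DiscGroup N) {t : ℝ} (ht : 0 < t) :
    HasSum (fun p : ℤ × ℤ => (ZMod.stdAddChar ((p.2 : ZMod N) * h.2) : ℂ) *
        eisTerm N τ t ((h.1.val : ℤ) + N * p.1, p.2))
      (∑ j : ZMod N, ZMod.stdAddChar (j * h.2) * eisKernel N τ t (h.1, j)) := by
  have hs := summable_eisTerm (N := N) τ ht
  have h1 : ∀ j : ZMod N, HasSum ((latticeCoset (h.1, j)).indicator fun X : ℤ × ℤ =>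
      (ZMod.stdAddChar ((X.2 : ZMod N) * h.2) : ℂ) * eisTerm N τ t X)
      (ZMod.stdAddChar (j * h.2) * eisKernel N τ t (h.1, j)) := by
    intro j
    rw [← hasSum_subtype_iff_indicator]
    refine ((hs.subtype _).hasSum.mul_left _).congr_fun ?_
    rintro ⟨X, hX⟩
    have hX2 : (X.2 : ZMod N) = j := hX.2
    simp [hX2]
  have h2 := hasSum_sum fun (j : ZMod N) (_ : j ∈ Finset.univ) => h1 j
  have hinj : Function.Injective fun p : ℤ × ℤ => (((h.1.val : ℤ) + N * p.1, p.2) : ℤ × ℤ) := by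
    rintro ⟨a, b⟩ ⟨c, d⟩ e
    simp only [Prod.mk.injEq] at e
    exact Prod.ext (injective_val_add_mul h.1 e.1) e.2
  refine ((hinj.hasSum_iff fun X hX => ?_).2 h2).congr_fun ?_
  · refine Finset.sum_eq_zero fun j _ => indicator_of_notMem (fun hm => hX ?_) _
    obtain ⟨n, hn⟩ := (intCast_eq_iff_exists X.1 h.1).1 hm.1
    exact ⟨(n, X.2), Prod.ext hn rfl⟩
  · rintro ⟨a, b⟩
    simp only [Function.comp]
    rw [Finset.sum_eq_single (b : ZMod N)]
    · rw [indicator_of_mem]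
      exact ⟨by simp, rfl⟩
    · intro j _ hj
      exact indicator_of_notMem (fun hm => hj hm.2.symm) _
    · simp

/-- For fixed `x₁` the sum over `x₂` is a linear polynomial times a Gaussian with a phase. Poisson
summation replaces `x₂` by a dual integer `n` weighted by `e(n h₂/N)`, and `x₁u + n` and `x₁v`
combine into `x₁τ + n`. Absolute convergence of both double series allows the iterated sums. -/
theorem psiKernel_eq_sum_eisKernel (τ : UpperHalfPlane) (h : DiscGroup N) {t : ℝ} (ht : 0 < t) :
    psiKernel N τ t h = ∑ j : ZMod N, ZMod.stdAddChar (j * h.2) * eisKernel N τ t (h.1, j) := by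
  have hτ : 0 < (τ : ℂ).im := τ.im_pos
  have hN := natCast_pos_real (N := N)
  have hNC : (N : ℂ) ≠ 0 := by exact_mod_cast hN.ne'
  have hs := (hasSum_psiKernel (N := N) hτ h ht).summable
  have hE := hasSum_eisTerm_fst τ h ht
  let e : ℤ × ℤ ≃ latticeCoset h := Equiv.ofBijective
    (fun p => ⟨((h.1.val : ℤ) + N * p.1, (h.2.val : ℤ) + N * p.2), by simp [latticeCoset]⟩) (by
      constructor
      · rintro ⟨a, b⟩ ⟨c, d⟩ hab
        have hab := Prod.mk.inj (congrArg Subtype.val hab)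
        exact Prod.ext (injective_val_add_mul h.1 hab.1) (injective_val_add_mul h.2 hab.2)
      · rintro ⟨X, hX⟩
        obtain ⟨m, hm⟩ := (intCast_eq_iff_exists X.1 h.1).1 hX.1
        obtain ⟨n, hn⟩ := (intCast_eq_iff_exists X.2 h.2).1 hX.2
        exact ⟨(m, n), Subtype.ext (Prod.ext hm hn)⟩)
  have hse := (e.summable_iff).2 hs
  rw [psiKernel, ← e.tsum_eq, ← hE.tsum_eq, hE.summable.tsum_prod]
  refine hse.tsum_prod.trans ?_
  refine tsum_congr fun m => ?_
  set x : ℤ := (h.1.val : ℤ) + N * m with hx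
  set v : ℝ := (τ : ℂ).im with hv
  set u : ℝ := (τ : ℂ).re with hu
  set y : ℝ := v * N * t ^ 2 with hy
  have hy0 : 0 < y := by positivity
  set a : ℝ := valDiv h.2 with ha
  have hκ := kappa_sq (N := N) hτ
  have hpi : √Real.pi ≠ 0 := (Real.sqrt_pos.2 Real.pi_pos).ne'
  -- The factor `√v` from `κ` cancels against the `1/√y` produced by Poisson summation.
  have hκ0 : (2 * kappa N τ / √Real.pi) * (1 / √y) = 2 / (N * t) := by
    have hsy : √y = axisScale N τ * t := by
      rw [hy, axisScale, Real.sqrt_mul (by positivity), Real.sqrt_sq ht.le, mul_comm v]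
    have hb := (axisScale_pos (N := N) hτ).ne'
    have hk := kappa_mul (N := N) hτ
    rw [hsy]
    field_simp
    linear_combination hk
  have hP := tsum_linear_mul_gaussian hy0 a (x * u) (N * t : ℝ) (-x / t : ℝ)
  have hl : ∀ k : ℤ, (starRingEnd ℂ) (phase N τ (x, (h.2.val : ℤ) + N * k)) *
      (psiTerm (kappa N τ) x (((h.2.val : ℤ) + N * k : ℤ) : ℝ) t : ℂ) =
      ((2 * kappa N τ / √Real.pi : ℝ) * (Real.exp (-(kappa N τ * (x / t)) ^ 2) : ℝ)) *
      ((((N * t : ℝ) : ℂ) * (k + a) + (-x / t : ℝ)) *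
        Complex.exp (-(2 * Real.pi * Complex.I * ((k + a) * (x * u : ℝ))) -
        Real.pi * y * (k + a) ^ 2)) := by
    intro k
    have hx2 : (((h.2.val : ℤ) + N * k : ℤ) : ℝ) = N * (k + a) := by
      rw [ha, valDiv]
      push_cast
      field_simp
      ring
    have h1 : (starRingEnd ℂ) (phase N τ (x, (h.2.val : ℤ) + N * k)) =
        Complex.exp (-(2 * Real.pi * Complex.I * ((k + a) * (x * u : ℝ)))) := by
      rw [phase, expTwoPiI, ← Complex.exp_conj]
      congr 1
      simp only [hx2, map_mul, Complex.conj_I, Complex.conj_ofReal, map_ofNat]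
      rw [← hu]
      push_cast
      field_simp
    have h2 : gaussTerm (kappa N τ) x (((h.2.val : ℤ) + N * k : ℤ) : ℝ) t =
        Real.exp (-(kappa N τ * (x / t)) ^ 2) * Real.exp (-(Real.pi * y * (k + a) ^ 2)) := by
      rw [gaussTerm, hx2, ← Real.exp_add]
      congr 1
      rw [mul_pow _ (N * (k + a) * t), hκ]
      field_simp
      ring
    have h3 : Complex.exp (-(2 * Real.pi * Complex.I * ((k + a) * (x * u : ℝ))) -
        Real.pi * y * (k + a) ^ 2) =
        Complex.exp (-(2 * Real.pi * Complex.I * ((k + a) * (x * u : ℝ)))) *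
          (Real.exp (-(Real.pi * y * (k + a) ^ 2)) : ℝ) := by
      rw [sub_eq_add_neg, Complex.exp_add]
      push_cast
      rfl
    rw [psiTerm, h1, h2, hx2, h3]
    push_cast
    ring
  have hr : ∀ n : ℤ, (ZMod.stdAddChar ((n : ZMod N) * h.2) : ℂ) * eisTerm N τ t (x, n) =
      ((2 / (N * t) : ℝ) * (Real.exp (-(kappa N τ * (x / t)) ^ 2) : ℝ)) *
      ((((-x / t : ℝ) : ℂ) - Complex.I * (N * t : ℝ) / y * (n + (x * u : ℝ))) *
        Complex.exp (2 * Real.pi * Complex.I * (n * a) -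
          Real.pi / y * (n + (x * u : ℝ)) ^ 2)) := by
    intro n
    have h1 : (ZMod.stdAddChar ((n : ZMod N) * h.2) : ℂ) =
        Complex.exp (2 * Real.pi * Complex.I * (n * a)) := by
      have : (n : ZMod N) * h.2 = ((n * (h.2.val : ℤ) : ℤ) : ZMod N) := by simp
      rw [this, ZMod.stdAddChar_coe, ha, valDiv]
      congr 1
      push_cast
      ring
    have hre : ((x : ℂ) * τ + n) = ((x * u + n : ℝ) : ℂ) + ((x * v : ℝ) : ℂ) * Complex.I := by
      conv_lhs => rw [← Complex.re_add_im (τ : ℂ)]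
      push_cast
      ring
    have h2 : Real.exp (-(Real.pi * ‖((x : ℂ) * τ + n)‖ ^ 2 / (N * v * t ^ 2))) =
        Real.exp (-(kappa N τ * (x / t)) ^ 2) *
          Real.exp (-(Real.pi / y * (n + x * u) ^ 2)) := by
      rw [← Real.exp_add, ← Complex.normSq_eq_norm_sq, hre, Complex.normSq_add_mul_I]
      congr 1
      rw [mul_pow _ (x / t), hκ]
      field_simp
      ring
    have hy1 : (y : ℂ) = v * N * t ^ 2 := by rw [hy]; push_cast; ring
    have hvC : (v : ℂ) ≠ 0 := by exact_mod_cast hτ.ne'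
    have htC : (t : ℂ) ≠ 0 := by exact_mod_cast ht.ne'
    have e1 : Complex.exp (2 * Real.pi * Complex.I * (n * a) -
          Real.pi / y * (n + (x * u : ℝ)) ^ 2) = Complex.exp (2 * Real.pi * Complex.I * (n * a)) *
          (Real.exp (-(Real.pi / y * (n + x * u) ^ 2)) : ℝ) := by
      rw [sub_eq_add_neg, Complex.exp_add]
      push_cast
      rfl
    rw [h1, e1, eisTerm, ← hv, h2, hre]
    simp only [map_add, map_mul, Complex.conj_ofReal, Complex.conj_I, hy1]
    push_cast
    field_simp
    linear_combination (x * v : ℂ) * Complex.I_sq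
  refine (tsum_congr hl).trans ?_
  rw [tsum_mul_left, hP, tsum_congr hr, tsum_mul_left, ← hκ0]
  push_cast
  ring

/-! ### Equivariance of the double series and transfer to the Weil representation. -/

/-- The matrix `γ` acts on `ℤ²` from the right. -/
def vecMulEquiv (γ : SL(2, ℤ)) : ℤ × ℤ ≃ ℤ × ℤ where
  toFun X := (X.1 * γ 0 0 + X.2 * γ 1 0, X.1 * γ 0 1 + X.2 * γ 1 1)
  invFun X := (X.1 * γ 1 1 - X.2 * γ 1 0, -X.1 * γ 0 1 + X.2 * γ 0 0)
  left_inv X := by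
    have hd := γ.det_coe
    rw [Matrix.det_fin_two] at hd
    refine Prod.ext ?_ ?_
    · linear_combination X.1 * hd
    · linear_combination X.2 * hd
  right_inv X := by
    have hd := γ.det_coe
    rw [Matrix.det_fin_two] at hd
    refine Prod.ext ?_ ?_
    · linear_combination X.1 * hd
    · linear_combination X.2 * hd

/-- With `D = cτ + d`, both `|x₁τ + x₂|²` and `v` are divided by `|D|²`, so the exponential is
invariant. The prefactor acquires `|D|²/conj(D) = D`. -/
theorem eisTerm_smul (γ : SL(2, ℤ)) (τ : UpperHalfPlane) (t : ℝ) (X : ℤ × ℤ) :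
    eisTerm N ((γ • τ : UpperHalfPlane) : ℂ) t X =
      (((γ 1 0 : ℤ) : ℂ) * τ + ((γ 1 1 : ℤ) : ℂ)) * eisTerm N τ t (vecMulEquiv γ X) := by
  have hden : (((γ 1 0 : ℤ) : ℂ) * τ + ((γ 1 1 : ℤ) : ℂ)) ≠ 0 := by
    rw [← ModularGroup.denom_apply]
    exact UpperHalfPlane.denom_ne_zero γ τ
  set D : ℂ := ((γ 1 0 : ℤ) : ℂ) * τ + ((γ 1 1 : ℤ) : ℂ) with hD
  have hD0 : 0 < Complex.normSq D := Complex.normSq_pos.2 hden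
  have hcoe : ((γ • τ : UpperHalfPlane) : ℂ) =
      (((γ 0 0 : ℤ) : ℂ) * τ + ((γ 0 1 : ℤ) : ℂ)) / D := by
    rw [UpperHalfPlane.specialLinearGroup_apply]
    simp [hD]
  have him : (((γ • τ : UpperHalfPlane) : ℂ)).im = (τ : ℂ).im / Complex.normSq D := by
    have := ModularGroup.im_smul_eq_div_normSq γ τ
    simpa [hD, UpperHalfPlane.denom] using this
  have hv : (τ : ℂ).im ≠ 0 := τ.im_ne_zero
  have hlin : (X.1 : ℂ) * ((γ • τ : UpperHalfPlane) : ℂ) + X.2 =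
      ((vecMulEquiv γ X).1 * τ + (vecMulEquiv γ X).2) / D := by
    rw [hcoe, vecMulEquiv]
    field_simp
    rw [hD]
    simp only [Equiv.coe_fn_mk]
    push_cast
    ring
  set Y := ((vecMulEquiv γ X).1 * (τ : ℂ) + (vecMulEquiv γ X).2 : ℂ) with hY
  have hn : ‖Y / D‖ ^ 2 = ‖Y‖ ^ 2 / Complex.normSq D := by
    rw [norm_div, div_pow, Complex.normSq_eq_norm_sq]
  have hc : (starRingEnd ℂ) D * D = Complex.normSq D := by
    rw [mul_comm, Complex.mul_conj]
  have hcD : (starRingEnd ℂ) D ≠ 0 := (map_ne_zero _).2 hden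
  have hNC : (N : ℂ) ≠ 0 := NeZero.ne _
  have hvC : ((τ : ℂ).im : ℂ) ≠ 0 := by exact_mod_cast hv
  have hexp : Real.pi * (‖Y‖ ^ 2 / Complex.normSq D) /
      (N * ((τ : ℂ).im / Complex.normSq D) * t ^ 2) =
      Real.pi * ‖Y‖ ^ 2 / (N * (τ : ℂ).im * t ^ 2) := by
    field_simp
  rw [eisTerm, eisTerm, hlin, him, hn, hexp, map_div₀, Complex.ofReal_div, ← hc, ← hY]
  rcases eq_or_ne t 0 with rfl | ht
  · simp
  · have htC : (t : ℂ) ≠ 0 := by exact_mod_cast ht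
    field_simp

theorem eisKernel_smul (γ : SL(2, ℤ)) (τ : UpperHalfPlane) (t : ℝ) (x : DiscGroup N) :
    eisKernel N ((γ • τ : UpperHalfPlane) : ℂ) t x =
      (((γ 1 0 : ℤ) : ℂ) * τ + ((γ 1 1 : ℤ) : ℂ)) *
        translationRep N γ (eisKernel N τ t) x := by
  have hd : ((γ 0 0 : ℤ) : ZMod N) * (γ 1 1 : ℤ) - (γ 0 1 : ℤ) * (γ 1 0 : ℤ) = 1 := by
    have hd := γ.det_coe
    rw [Matrix.det_fin_two] at hd
    have := congrArg (Int.cast : ℤ → ZMod N) hd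
    push_cast at this
    exact this
  have hmem : ∀ X : ℤ × ℤ, X ∈ latticeCoset x ↔ vecMulEquiv γ X ∈ latticeCoset
      ((x.1 * (γ 0 0 : ℤ) + x.2 * (γ 1 0 : ℤ), x.1 * (γ 0 1 : ℤ) + x.2 * (γ 1 1 : ℤ)) :
        DiscGroup N) := by
    intro X
    simp only [latticeCoset, mem_ofPred_eq, vecMulEquiv, Equiv.coe_fn_mk]
    push_cast
    constructor
    · rintro ⟨h1, h2⟩
      rw [h1, h2]
      exact ⟨rfl, rfl⟩
    · rintro ⟨h1, h2⟩
      constructor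
      · linear_combination (γ 1 1 : ZMod N) * h1 - (γ 1 0 : ZMod N) * h2 +
          (x.1 - X.1) * hd
      · linear_combination (-(γ 0 1 : ZMod N)) * h1 + (γ 0 0 : ZMod N) * h2 +
          (x.2 - X.2) * hd
  rw [eisKernel, tsum_congr fun X : latticeCoset x => eisTerm_smul γ τ t X, tsum_mul_left]
  congr 1
  change _ = ∑' X : latticeCoset _, eisTerm N τ t X
  exact ((vecMulEquiv γ).subtypeEquiv hmem).tsum_eq
    (fun X : latticeCoset _ => eisTerm N τ t X)

/-- The Weil representation is conjugate to the translation action by a partial Fourier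
transform. -/
theorem isWeilRepNeg_conj (N : ℕ) [NeZero N] : IsWeilRepNeg N
    (((partialDFT N).symm.conjRingEquiv : _ →* _).comp (translationRep N)) := by
  have hN : (N : ℂ) ≠ 0 := NeZero.ne _
  refine ⟨?_, ?_⟩
  · intro h
    apply (partialDFT N).injective
    change partialDFT N ((partialDFT N).symm
      (translationRep N ModularGroup.T (partialDFT N (Pi.single h 1)))) = _
    rw [LinearEquiv.apply_symm_apply]
    ext x
    rw [map_smul, Pi.smul_apply, partialDFT_single]
    change partialDFT N (Pi.single h 1) (_, _) = _
    rw [partialDFT_single]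
    by_cases hx : x.1 = h.1
    · simp only [ModularGroup.coe_T, hx]
      simp only [Matrix.of_apply, Matrix.cons_val', Matrix.cons_val_zero, Matrix.cons_val_one,
        Matrix.cons_val_fin_one, Int.cast_one, Int.cast_zero, mul_one, mul_zero, add_zero, if_true,
        smul_eq_mul, ← AddChar.map_add_eq_mul]
      congr 1
      ring
    · simp [ModularGroup.coe_T, hx]
  · intro h
    apply (partialDFT N).injective
    change partialDFT N ((partialDFT N).symm
      (translationRep N ModularGroup.S (partialDFT N (Pi.single h 1)))) = _
    rw [LinearEquiv.apply_symm_apply]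
    ext x
    rw [map_smul, map_sum, Pi.smul_apply, Finset.sum_apply]
    simp only [map_smul, Pi.smul_apply, partialDFT_single]
    change partialDFT N (Pi.single h 1) (_, _) = _
    rw [partialDFT_single, Fintype.sum_prod_type, Finset.sum_eq_single x.1]
    · have key : ∀ y : ZMod N,
          (ZMod.stdAddChar (x.1 * h.2 + y * h.1) : ℂ) * ZMod.stdAddChar (-(y * x.2)) =
            ZMod.stdAddChar (x.1 * h.2) * ZMod.stdAddChar (y * (h.1 - x.2)) := by
        intro y
        rw [← AddChar.map_add_eq_mul, ← AddChar.map_add_eq_mul]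
        congr 1
        ring
      simp only [if_true, smul_eq_mul, key, ← Finset.mul_sum]
      rw [AddChar.sum_mulShift _ (ZMod.isPrimitive_stdAddChar N)]
      by_cases hx : x.2 = h.1
      · simp [ModularGroup.coe_S, hx, ZMod.card]
        field_simp
        rw [mul_comm]
      · have : h.1 - x.2 ≠ 0 := fun e => hx (sub_eq_zero.mp e).symm
        simp [ModularGroup.coe_S, hx, this]
    · intro y _ hy
      simp [Ne.symm hy]
    · simp

theorem weilRepNeg_apply (γ : SL(2, ℤ)) (f : DiscGroup N → ℂ) :
    weilRepNeg N γ f = (partialDFT N).symm (translationRep N γ (partialDFT N f)) := by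
  rw [(weilRepNeg_spec N).unique (isWeilRepNeg_conj N)]
  rfl

theorem psiKernel_eq_partialDFT (τ : UpperHalfPlane) {t : ℝ} (ht : 0 < t) :
    psiKernel N τ t = (N : ℂ) • (partialDFT N).symm (eisKernel N τ t) := by
  have hN : (N : ℂ) ≠ 0 := NeZero.ne _
  ext h
  rw [psiKernel_eq_sum_eisKernel τ h ht, Pi.smul_apply]
  change _ = (N : ℂ) • ZMod.dft.symm (fun j => eisKernel N τ t (h.1, j)) h.2
  rw [ZMod.invDFT_apply]
  simp only [smul_eq_mul]
  rw [mul_inv_cancel_left₀ hN]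

theorem psiKernel_smul (γ : SL(2, ℤ)) (τ : UpperHalfPlane) {t : ℝ} (ht : 0 < t) :
    psiKernel N ((γ • τ : UpperHalfPlane) : ℂ) t =
      (((γ 1 0 : ℤ) : ℂ) * τ + ((γ 1 1 : ℤ) : ℂ)) • weilRepNeg N γ (psiKernel N τ t) := by
  have h : eisKernel N ((γ • τ : UpperHalfPlane) : ℂ) t =
      (((γ 1 0 : ℤ) : ℂ) * τ + ((γ 1 1 : ℤ) : ℂ)) • translationRep N γ (eisKernel N τ t) :=
    funext fun x => eisKernel_smul γ τ t x
  rw [psiKernel_eq_partialDFT _ ht, psiKernel_eq_partialDFT _ ht, h, weilRepNeg_apply, map_smul,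
    map_smul, map_smul, map_smul, LinearEquiv.apply_symm_apply, smul_comm]

/-- On a finite-dimensional space a linear map is a finite combination of coordinates, so it
commutes with the integral. -/
theorem mellin_log_linearMap {ι : Type*} [Fintype ι] (L : (ι → ℂ) →ₗ[ℂ] (ι → ℂ))
    {f : ℝ → ι → ℂ} (hf : ∀ i, RapidDecay fun t => f t i) (i : ι) :
    mellin (fun t => Real.log t • L (f t) i) 0 =
      L (fun j => mellin (fun t => Real.log t • f t j) 0) i := by
  classical
  have e : ∀ (g : ι → ℂ), L g i = ∑ j, L (Pi.single j 1) i * g j := by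
    intro g
    conv_lhs => rw [pi_eq_sum_univ g, map_sum, Finset.sum_apply]
    refine Finset.sum_congr rfl fun j _ => ?_
    rw [map_smul, Pi.smul_apply, smul_eq_mul, mul_comm]
    have hj : (fun k => if j = k then (1 : ℂ) else 0) = Pi.single j 1 := by
      ext k
      simp [Pi.single_apply, eq_comm]
    rw [hj]
  rw [e, mellin]
  have e2 : ∀ t : ℝ, (t : ℂ) ^ ((0 : ℂ) - 1) • (Real.log t • L (f t) i) =
      ∑ j, L (Pi.single j 1) i * ((t : ℂ) ^ ((0 : ℂ) - 1) • (Real.log t • f t j)) := by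
    intro t
    rw [e, Finset.smul_sum, Finset.smul_sum]
    refine Finset.sum_congr rfl fun j _ => ?_
    rw [← mul_smul_comm, ← mul_smul_comm]
  simp only [e2]
  rw [integral_finsetSum]
  · refine Finset.sum_congr rfl fun j _ => ?_
    exact integral_const_mul _ _
  · intro j _
    exact ((hf j).log_smul.mellinConvergent 0).const_mul _

theorem varthetaTilde_smul (γ : SL(2, ℤ)) (τ : UpperHalfPlane) :
    varthetaTilde N ((γ • τ : UpperHalfPlane) : ℂ) =
      (((γ 1 0 : ℤ) : ℂ) * (τ : ℂ) + ((γ 1 1 : ℤ) : ℂ)) ^ (1 : ℤ) •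
        weilRepNeg N γ (varthetaTilde N (τ : ℂ)) := by
  have hv : ∀ τ : UpperHalfPlane, varthetaTilde N (τ : ℂ) =
      -fun h => mellin (fun t => Real.log t • psiKernel N τ t h) 0 :=
    fun τ => funext fun h => varthetaTilde_eq τ.im_pos h
  ext h
  rw [zpow_one, hv, hv, map_neg, Pi.neg_apply, Pi.smul_apply, Pi.neg_apply,
    ← mellin_log_linearMap _ (fun i => rapidDecay_psiKernel τ.im_pos i), smul_neg, smul_eq_mul,
    ← mellin_log_mul]
  congr 1
  rw [mellin, mellin]
  refine setIntegral_congr_fun measurableSet_Ioi fun t ht => ?_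
  rw [psiKernel_smul γ τ ht]
  rfl

end Modularity

/-! ### The exponential integral -/

/-- The exponential integral `∫_1^∞ e^{-wr} dr/r`. -/
noncomputable def expIntegral (w : ℂ) : ℂ := ∫ r in Ioi (1 : ℝ), Complex.exp (-w * r) / r

theorem incompleteGamma_zero_eq_expIntegral {y : ℝ} (hy : 0 < y) :
    (incompleteGamma 0 y : ℂ) = expIntegral y := by
  have h := integral_comp_mul_left_Ioi (fun r : ℝ => r ^ ((0 : ℝ) - 1) * Real.exp (-r)) 1 hy
  rw [mul_one] at h
  have h2 : incompleteGamma 0 y = y • ∫ x in Ioi (1 : ℝ),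
      (y * x) ^ ((0 : ℝ) - 1) * Real.exp (-(y * x)) := by
    rw [h, smul_smul, mul_inv_cancel₀ hy.ne', one_smul, incompleteGamma]
  rw [h2, smul_eq_mul, ← integral_const_mul, expIntegral, ← integral_complex_ofReal]
  refine setIntegral_congr_fun measurableSet_Ioi fun r hr => ?_
  have hr' : (1 : ℝ) < r := hr
  have hr0 : (r : ℂ) ≠ 0 := by exact_mod_cast (by linarith : r ≠ 0)
  have hy0 : (y : ℂ) ≠ 0 := by exact_mod_cast hy.ne'
  simp only [zero_sub, Real.rpow_neg_one]
  push_cast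
  rw [neg_mul]
  field_simp

theorem norm_exp_neg_mul_ofReal (w : ℂ) (r : ℝ) :
    ‖Complex.exp (-w * r)‖ = Real.exp (-w.re * r) := by
  rw [Complex.norm_exp]
  simp

theorem continuousOn_exp_neg_mul_div (w : ℂ) :
    ContinuousOn (fun r : ℝ => Complex.exp (-w * r) / r) (Ioi 1) := by
  refine ContinuousOn.div (by fun_prop) (by fun_prop) fun r hr => ?_
  have hr' : (1 : ℝ) < r := hr
  exact_mod_cast (by linarith : r ≠ 0)

theorem norm_exp_neg_mul_div_le (w : ℂ) {r : ℝ} (hr : r ∈ Ioi (1 : ℝ)) :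
    ‖Complex.exp (-w * r) / r‖ ≤ Real.exp (-w.re * r) := by
  have hr' : (1 : ℝ) < r := hr
  rw [norm_div, norm_exp_neg_mul_ofReal, Complex.norm_real, Real.norm_of_nonneg (by linarith)]
  exact div_le_self (Real.exp_pos _).le hr'.le

theorem integrableOn_exp_neg_mul_div {w : ℂ} (hw : 0 < w.re) :
    IntegrableOn (fun r : ℝ => Complex.exp (-w * r) / r) (Ioi 1) := by
  refine Integrable.mono' (integrableOn_exp_mul_Ioi (neg_lt_zero.2 hw) 1)
    ((continuousOn_exp_neg_mul_div w).aestronglyMeasurable measurableSet_Ioi) ?_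
  exact (ae_restrict_mem measurableSet_Ioi).mono fun r hr => norm_exp_neg_mul_div_le w hr

theorem norm_expIntegral_le {w : ℂ} (hw : 0 < w.re) :
    ‖expIntegral w‖ ≤ Real.exp (-w.re) / w.re := by
  have h := norm_integral_le_of_norm_le (f := fun r : ℝ => Complex.exp (-w * r) / r)
    (integrableOn_exp_mul_Ioi (neg_lt_zero.2 hw) 1)
    ((ae_restrict_mem measurableSet_Ioi).mono fun r hr => norm_exp_neg_mul_div_le w hr)
  rw [integral_exp_mul_Ioi (neg_lt_zero.2 hw)] at h
  refine h.trans_eq ?_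
  rw [mul_one, neg_div_neg_eq]

/-- Differentiation under the integral cancels `1/r`; the domination is uniform on the half-plane
`Re z > Re w / 2`. -/
theorem hasDerivAt_expIntegral {w : ℂ} (hw : 0 < w.re) :
    HasDerivAt expIntegral (-(Complex.exp (-w) / w)) w := by
  have ho : IsOpen {z : ℂ | w.re / 2 < z.re} := isOpen_lt continuous_const Complex.continuous_re
  have h := hasDerivAt_integral_of_dominated_loc_of_deriv_le
    (μ := volume.restrict (Ioi (1 : ℝ)))
    (F := fun (z : ℂ) (r : ℝ) => Complex.exp (-z * r) / r)
    (F' := fun (z : ℂ) (r : ℝ) => -Complex.exp (-z * r))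
    (bound := fun r => Real.exp (-(w.re / 2) * r))
    (ho.mem_nhds (by simpa using hw : w ∈ {z : ℂ | w.re / 2 < z.re}))
    (Eventually.of_forall fun z =>
      (continuousOn_exp_neg_mul_div z).aestronglyMeasurable measurableSet_Ioi)
    (integrableOn_exp_neg_mul_div hw)
    (by
      have : Continuous fun r : ℝ => -Complex.exp (-w * r) := by fun_prop
      exact this.aestronglyMeasurable)
    ((ae_restrict_mem measurableSet_Ioi).mono fun r hr z hz => by
      have hr' : (1 : ℝ) < r := hr
      have hz' : w.re / 2 < z.re := hz
      rw [norm_neg, norm_exp_neg_mul_ofReal]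
      refine Real.exp_le_exp.2 ?_
      nlinarith)
    (integrableOn_exp_mul_Ioi (by linarith) 1)
    ((ae_restrict_mem measurableSet_Ioi).mono fun r hr z _ => by
      have hr' : (1 : ℝ) < r := hr
      have hr0 : (r : ℂ) ≠ 0 := by exact_mod_cast (by linarith : r ≠ 0)
      have h1 : HasDerivAt (fun z : ℂ => -z * r) (-1 * r) z :=
        (hasDerivAt_id z).neg.mul_const _
      refine (h1.cexp.div_const _).congr_deriv ?_
      field_simp)
  refine h.2.congr_deriv ?_
  rw [integral_neg, integral_exp_mul_complex_Ioi (by simpa using hw)]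
  simp [div_neg, neg_div]

/-! ### Real analyticity of non-holomorphic series -/

section Pairing

variable {ι : Type*}

theorem memℓp_two_of_norm_le {a : ι → ℂ} {u : ι → ℝ} (hu : Summable u) (ha : ∀ i, ‖a i‖ ≤ u i) :
    Memℓp a 2 := by
  have h1 : Memℓp a 1 := by
    refine memℓp_gen ?_
    simpa using Summable.of_nonneg_of_le (fun i => norm_nonneg _) ha hu
  exact h1.of_exponent_ge (by norm_num)

variable [DecidableEq ι]

/-- A series of vectors in `ℓ²` is given by its coordinates. -/
theorem tsum_single_apply {a : ι → ℂ} {u : ι → ℝ} (hu : Summable u) (ha : ∀ i, ‖a i‖ ≤ u i)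
    (i : ι) : (∑' j, lp.single (E := fun _ : ι => ℂ) 2 j (a j) : lp (fun _ : ι => ℂ) 2) i =
      a i := by
  have h := (lp.hasSum_single (p := 2) (by norm_num)
    (⟨a, memℓp_two_of_norm_le hu ha⟩ : lp (fun _ : ι => ℂ) 2)).tsum_eq
  change (∑' j, lp.single (E := fun _ : ι => ℂ) 2 j (a j)) = _ at h
  rw [h]

/-- A summable majorant makes the coordinates into a normally convergent series of holomorphic maps
with values in `ℓ²`. -/
theorem analyticAt_tsum_single {a : ι → ℂ → ℂ} {u : ι → ℝ} (hu : Summable u) {U : Set ℂ}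
    (hU : IsOpen U) (hd : ∀ i, DifferentiableOn ℂ (a i) U) (ha : ∀ i, ∀ z ∈ U, ‖a i z‖ ≤ u i)
    {z : ℂ} (hz : z ∈ U) :
    AnalyticAt ℂ (fun z => ∑' j, lp.single (E := fun _ : ι => ℂ) 2 j (a j z)) z := by
  have h : DifferentiableOn ℂ (fun z => ∑' j, lp.single (E := fun _ : ι => ℂ) 2 j (a j z)) U := by
    refine Complex.differentiableOn_tsum_of_summable_norm hu (fun i => ?_) hU fun i z hz => ?_
    · exact (lp.singleContinuousLinearMap ℂ (fun _ : ι => ℂ) 2 i).differentiable.comp_differentiableOn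
        (hd i)
    · rw [lp.norm_single (by norm_num)]
      exact ha i z hz
  exact h.analyticAt (hU.mem_nhds hz)

/-- Real analyticity of a series of products of a holomorphic function and a real-analytic
function of the imaginary part. -/
theorem analyticAt_tsum_mul {a b : ι → ℂ → ℂ} {u : ι → ℝ} (hu : Summable u) {U V : Set ℂ}
    (hU : IsOpen U) (hV : IsOpen V) (hda : ∀ i, DifferentiableOn ℂ (a i) U)
    (hdb : ∀ i, DifferentiableOn ℂ (b i) V) (ha : ∀ i, ∀ z ∈ U, ‖a i z‖ ≤ u i)
    (hb : ∀ i, ∀ z ∈ V, ‖b i z‖ ≤ u i)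
    (hreal : ∀ i (v : ℝ), (v : ℂ) ∈ V → (starRingEnd ℂ) (b i v) = b i v)
    {z : ℂ} (hzU : z ∈ U) (hzV : (z.im : ℂ) ∈ V) :
    AnalyticAt ℝ (fun z : ℂ => ∑' i, b i z.im * a i z) z := by
  have hA := (analyticAt_tsum_single hu hU hda ha hzU).restrictScalars (𝕜 := ℝ)
  have hB := (analyticAt_tsum_single hu hV hdb hb hzV).restrictScalars (𝕜 := ℝ)
  have him : AnalyticAt ℝ (fun z : ℂ => (z.im : ℂ)) z :=
    (Complex.ofRealCLM.comp Complex.imCLM).analyticAt z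
  have hB' := hB.comp_of_eq him rfl
  -- The complex inner product is conjugate-linear in one slot, so it is analytic only over `ℝ`. The
  -- conjugation disappears because `b` is real on the real points of `V`. Smoothness of order `⊤`
  -- is analyticity.
  have h := (ContDiffAt.inner ℂ (hB'.contDiffAt (n := ⊤)) (hA.contDiffAt (n := ⊤))).analyticAt
  refine h.congr ?_
  have hc : ContinuousAt (fun z : ℂ => (z.im : ℂ)) z := him.continuousAt
  filter_upwards [hU.mem_nhds hzU, hc.preimage_mem_nhds (hV.mem_nhds hzV)] with y hyU hyV
  simp only [Function.comp, lp.inner_eq_tsum]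
  refine tsum_congr fun i => ?_
  rw [tsum_single_apply hu fun i => ha i y hyU, tsum_single_apply hu fun i => hb i _ hyV,
    RCLike.inner_apply, hreal i _ hyV, mul_comm]

end Pairing

/-! ### The Fourier expansion -/

section Fourier

theorem hasSum_nonneg_of_hasSum_pos {f : ℚ → ℂ} {s : ℂ}
    (hs : HasSum (fun n : {n : ℚ // 0 < n} => f n) s) :
    HasSum (fun n : {n : ℚ // 0 ≤ n} => f n) (f 0 + s) := by
  have h1 : HasSum (fun n : ({0} : Set ℚ) => f n) (f 0) := by
    simpa using hasSum_unique fun n : ({0} : Set ℚ) => f n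
  have hd : Disjoint ({0} : Set ℚ) {n : ℚ | 0 < n} := by simp
  have h2 := h1.add_disjoint hd hs
  have e : ({0} : Set ℚ) ∪ {n : ℚ | 0 < n} = {n : ℚ | 0 ≤ n} := by
    ext n
    simp [le_iff_eq_or_lt, eq_comm]
  rw [e] at h2
  exact h2

variable {N : ℕ}

/-- The vectors of a coset whose norm has the sign of `ε`. -/
def signCoset (h : DiscGroup N) (ε : ℤ) : Set (ℤ × ℤ) :=
  {X | X ∈ latticeCoset h ∧ 0 < ε * (X.1 * X.2)}

theorem ne_zero_of_mem_signCoset (h : DiscGroup N) (ε : ℤ) :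
    ∀ X ∈ signCoset h ε, X.1 ≠ 0 ∧ X.2 ≠ 0 := by
  rintro X ⟨-, hX⟩
  exact ⟨fun h => by simp [h] at hX, fun h => by simp [h] at hX⟩

theorem anisoCoset_eq_union (h : DiscGroup N) :
    anisoCoset h = signCoset h 1 ∪ signCoset h (-1) := by
  ext X
  simp only [anisoCoset, signCoset, mem_union, mem_ofPred_eq, ← and_or_left]
  refine and_congr_right fun _ => ?_
  rw [← mul_ne_zero_iff, ne_iff_lt_or_gt, or_comm]
  refine or_congr ?_ ?_ <;> constructor <;> intro h <;> linarith

theorem disjoint_signCoset (h : DiscGroup N) : Disjoint (signCoset h 1) (signCoset h (-1)) := by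
  rw [Set.disjoint_left]
  rintro X ⟨-, h1⟩ ⟨-, h2⟩
  linarith

/-- Positive norms carry the non-holomorphic part of `ϑ̃` and all non-constant terms of `ϑ`;
negative norms carry the holomorphic logarithmic part. -/
theorem eq_add_of_hasSum_anisoCoset {h : DiscGroup N} {f : ℤ × ℤ → ℂ} {s : ℂ}
    (hs : HasSum (fun X : anisoCoset h => f X) s) :
    Summable (fun X : signCoset h 1 => f X) ∧ Summable (fun X : signCoset h (-1) => f X) ∧
    s = (∑' X : signCoset h 1, f X) + ∑' X : signCoset h (-1), f X := by
  rw [anisoCoset_eq_union] at hs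
  have h1 : Summable (fun X : signCoset h 1 => f X) := hs.summable.comp_injective
    (i := Set.inclusion subset_union_left) (Set.inclusion_injective _)
  have h2 : Summable (fun X : signCoset h (-1) => f X) := hs.summable.comp_injective
    (i := Set.inclusion subset_union_right) (Set.inclusion_injective _)
  exact ⟨h1, h2, hs.unique (HasSum.add_disjoint (disjoint_signCoset h) h1.hasSum h2.hasSum)⟩

/-- The norm `Q(X) = x₁x₂/N`. -/
noncomputable def normQ (N : ℕ) (X : ℤ × ℤ) : ℝ := X.1 * X.2 / N

/-- The contribution of a vector of negative norm to `ϑ̃`. -/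
noncomputable def holTerm (N : ℕ) (X : ℤ × ℤ) (τ : ℂ) : ℂ :=
  ((Real.sign X.1 * Real.log |(X.1 : ℝ) / X.2| : ℝ) : ℂ) * expTwoPiI (-(normQ N X : ℂ) * τ)

/-- The contribution of a vector of positive norm to `ϑ̃`, up to sign. -/
noncomputable def nonholTerm (N : ℕ) (X : ℤ × ℤ) (τ : ℂ) : ℂ :=
  (Real.sign X.1 : ℂ) * expIntegral (4 * Real.pi * (normQ N X : ℂ) * τ.im) *
    expTwoPiI (-(normQ N X : ℂ) * τ)

/-- The contribution of a vector of positive norm to `ϑ`. -/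
noncomputable def thetaTerm (N : ℕ) (X : ℤ × ℤ) (τ : ℂ) : ℂ :=
  (Real.sign X.1 : ℂ) * expTwoPiI ((normQ N X : ℂ) * τ)

variable [NeZero N] {τ : ℂ}

theorem normQ_pos {h : DiscGroup N} (X : signCoset h 1) : 0 < normQ N X := by
  have hX := X.2.2
  rw [one_mul] at hX
  exact div_pos (by exact_mod_cast hX) natCast_pos_real

theorem normQ_neg {h : DiscGroup N} (X : signCoset h (-1)) : normQ N X < 0 := by
  have hX := X.2.2
  rw [neg_one_mul, neg_pos] at hX
  exact div_neg_of_neg_of_pos (by exact_mod_cast hX) natCast_pos_real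

theorem expTwoPiI_normQ_mul (hτ : 0 < τ.im) (X : ℤ × ℤ) :
    expTwoPiI ((normQ N X : ℂ) * τ) =
      phase N τ X * (Real.exp (-(2 * kappa N τ ^ 2 * (X.1 * X.2))) : ℝ) := by
  have h := expTwoPiI_mul_tau (N := N) hτ X 1
  simpa only [one_mul, normQ, phase] using h

theorem expTwoPiI_neg_normQ_mul (hτ : 0 < τ.im) (X : ℤ × ℤ) :
    expTwoPiI (-(normQ N X : ℂ) * τ) =
      (starRingEnd ℂ) (phase N τ X) * (Real.exp (2 * kappa N τ ^ 2 * (X.1 * X.2)) : ℝ) := by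
  have h := expTwoPiI_mul_tau (N := N) hτ X (-1)
  have hc : (starRingEnd ℂ) (phase N τ X) =
      expTwoPiI ((-1 * (X.1 * X.2 / N) * τ.re : ℝ) : ℂ) := by
    rw [phase, expTwoPiI, expTwoPiI, ← Complex.exp_conj]
    congr 1
    simp only [map_mul, Complex.conj_I, Complex.conj_ofReal, map_ofNat]
    push_cast
    ring
  rw [hc]
  simpa only [neg_one_mul, neg_neg, normQ, Complex.ofReal_neg] using h

theorem four_mul_kappa_sq (hτ : 0 < τ.im) (X : ℤ × ℤ) :
    4 * kappa N τ ^ 2 * (X.1 * X.2) = 4 * Real.pi * normQ N X * τ.im := by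
  rw [kappa_sq hτ, normQ]
  ring

/-- Vectors of negative norm integrate to zero, their kernel being odd after unfolding, so `ϑ` is
holomorphic. -/
theorem vartheta_eq_tsum (hτ : 0 < τ.im) (h : DiscGroup N) :
    vartheta N τ h = (coeffC h 0 : ℂ) + ∑' X : signCoset h 1, thetaTerm N X τ := by
  obtain ⟨-, -, hs⟩ := eq_add_of_hasSum_anisoCoset
    (f := fun X => phase N τ X * mellin (fun t => (phiTerm (kappa N τ) X.1 X.2 t : ℂ)) 0)
    (hasSum_vartheta hτ h)
  have h1 : ∀ X : signCoset h 1, phase N τ X *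
      mellin (fun t => (phiTerm (kappa N τ) X.1.1 X.1.2 t : ℂ)) 0 = thetaTerm N X τ := by
    intro X
    have hX : (0 : ℝ) < X.1.1 * X.1.2 := by have := X.2.2; rw [one_mul] at this; exact_mod_cast this
    have hne := ne_zero_of_mem_signCoset h 1 X.1 X.2
    rw [mellin_phiTerm (kappa_pos hτ) (by exact_mod_cast hne.1) (by exact_mod_cast hne.2),
      if_pos hX, thetaTerm, expTwoPiI_normQ_mul hτ]
    push_cast
    ring
  have h2 : ∀ X : signCoset h (-1), phase N τ X *
      mellin (fun t => (phiTerm (kappa N τ) X.1.1 X.1.2 t : ℂ)) 0 = 0 := by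
    intro X
    have hX : (X.1.1 * X.1.2 : ℝ) < 0 := by
      have := X.2.2
      rw [neg_one_mul, neg_pos] at this
      exact_mod_cast this
    have hne := ne_zero_of_mem_signCoset h (-1) X.1 X.2
    rw [mellin_phiTerm (kappa_pos hτ) (by exact_mod_cast hne.1) (by exact_mod_cast hne.2),
      if_neg hX.not_gt]
    simp
  rw [tsum_congr h1, tsum_congr h2, tsum_zero, add_zero] at hs
  rw [← hs]
  ring

theorem varthetaTilde_eq_tsum (hτ : 0 < τ.im) (h : DiscGroup N) :
    Summable (fun X : signCoset h 1 => nonholTerm N X τ) ∧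
    Summable (fun X : signCoset h (-1) => holTerm N X τ) ∧
    varthetaTilde N τ h = (coeffCTilde h 0 : ℂ) + (coeffC h 0 : ℂ) * (Real.log τ.im : ℂ) +
      (∑' X : signCoset h (-1), holTerm N X τ) - ∑' X : signCoset h 1, nonholTerm N X τ := by
  obtain ⟨s1, s2, hs⟩ := eq_add_of_hasSum_anisoCoset
    (f := fun X => (starRingEnd ℂ) (phase N τ X) * (logCoeff (kappa N τ) X.1 X.2 : ℂ))
    (hasSum_varthetaTilde hτ h)
  have h1 : ∀ X : signCoset h 1, (starRingEnd ℂ) (phase N τ X) *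
      (logCoeff (kappa N τ) X.1.1 X.1.2 : ℂ) = -nonholTerm N X τ := by
    intro X
    have hX : (0 : ℝ) < X.1.1 * X.1.2 := by have := X.2.2; rw [one_mul] at this; exact_mod_cast this
    have hq := normQ_pos X
    have he := incompleteGamma_zero_eq_expIntegral
      (by positivity : 0 < 4 * Real.pi * normQ N X * τ.im)
    push_cast at he
    rw [logCoeff, if_pos hX, nonholTerm, expTwoPiI_neg_normQ_mul hτ, four_mul_kappa_sq hτ, ← he]
    push_cast
    ring
  have h2 : ∀ X : signCoset h (-1), (starRingEnd ℂ) (phase N τ X) *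
      (logCoeff (kappa N τ) X.1.1 X.1.2 : ℂ) = holTerm N X τ := by
    intro X
    have hX : (X.1.1 * X.1.2 : ℝ) < 0 := by
      have := X.2.2
      rw [neg_one_mul, neg_pos] at this
      exact_mod_cast this
    rw [logCoeff, if_neg hX.not_gt, holTerm, expTwoPiI_neg_normQ_mul hτ]
    push_cast
    ring
  refine ⟨s1.neg.congr fun X => by rw [h1 X, neg_neg], s2.congr fun X => h2 X, ?_⟩
  rw [tsum_congr h1, tsum_congr h2, tsum_neg] at hs
  linear_combination hs

/-- Regrouping a sum over the vectors of positive or negative norm by the norm. -/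
theorem hasSum_norm_fiberwise {h : DiscGroup N} {ε : ℤ} (hε : ε * ε = 1) {c : ℤ × ℤ → ℂ}
    {F : ℚ → ℂ} {s : ℂ}
    (hs : HasSum (fun X : signCoset h ε => c X * F (ε * ((X.1.1 : ℚ) * X.1.2 / N))) s) :
    HasSum (fun n : {n : ℚ // 0 < n} =>
      (∑ᶠ X ∈ vectorsOfNorm h (ε * n), c X) * F n) s := by
  have hN : (0 : ℚ) < N := by exact_mod_cast Nat.pos_of_ne_zero (NeZero.ne N)
  have hεQ : (ε : ℚ) * ε = 1 := by exact_mod_cast hε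
  have hε0 : (ε : ℚ) ≠ 0 := left_ne_zero_of_mul_eq_one hεQ
  have hmem : ∀ (n : {n : ℚ // 0 < n}) (X : vectorsOfNorm h (ε * n)), X.1 ∈ signCoset h ε := by
    intro n X
    refine ⟨X.2.1, ?_⟩
    have h1 : (X.1.1 : ℚ) * X.1.2 = ε * n * N :=
      (div_eq_iff hN.ne').1 X.2.2
    have h2 : (0 : ℚ) < ε * (X.1.1 * X.1.2) := by
      rw [h1, mul_assoc, ← mul_assoc (ε : ℚ), hεQ, one_mul]
      exact mul_pos n.2 hN
    exact_mod_cast h2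
  let e : (Σ n : {n : ℚ // 0 < n}, vectorsOfNorm h (ε * n)) ≃ signCoset h ε :=
    Equiv.ofBijective (fun p => ⟨p.2.1, hmem p.1 p.2⟩) (by
      constructor
      · rintro ⟨⟨n, hn⟩, X, hX⟩ ⟨⟨m, hm⟩, Y, hY⟩ hXY
        have hXY : X = Y := congrArg Subtype.val hXY
        subst hXY
        have : n = m := mul_left_cancel₀ hε0 (hX.2.symm.trans hY.2)
        subst this
        rfl
      · rintro ⟨X, hX⟩
        have hX2 : (0 : ℚ) < ε * (X.1 * X.2) := by exact_mod_cast hX.2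
        refine ⟨⟨⟨ε * ((X.1 : ℚ) * X.2 / N), ?_⟩, X, hX.1, ?_⟩, rfl⟩
        · rw [← mul_div_assoc]
          positivity
        · simp only
          rw [← mul_assoc, hεQ, one_mul])
  refine ((e.hasSum_iff).2 hs).sigma fun n => ?_
  -- The fibres of the norm are finite, so the inner sums are finite sums and agree with the
  -- `finsum` of the coefficients.
  have hfin := finite_vectorsOfNorm h (mul_ne_zero hε0 n.2.ne')
  have := hfin.fintype
  rw [← finsum_set_coe_eq_finsum_mem, finsum_eq_sum_of_fintype, Finset.sum_mul]
  refine (hasSum_fintype _).congr_fun fun X => ?_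
  have hX : (ε : ℚ) * ((X.1.1 : ℚ) * X.1.2 / N) = n := by
    rw [X.2.2, ← mul_assoc, hεQ, one_mul]
  change c X * F (ε * ((X.1.1 : ℚ) * X.1.2 / N)) = c X * F n
  rw [hX]

theorem hasSum_nonholTerm_fiberwise (hτ : 0 < τ.im) (h : DiscGroup N) :
    HasSum (fun n : {n : ℚ // 0 < n} =>
        (coeffC h n : ℂ) * (incompleteGamma 0 (4 * Real.pi * τ.im * ((n : ℚ) : ℝ)) : ℂ) *
          expTwoPiI (-((n : ℚ) : ℂ) * τ)) (∑' X : signCoset h 1, nonholTerm N X τ) := by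
  have hs := (varthetaTilde_eq_tsum hτ h).1.hasSum
  have hs' : HasSum (fun X : signCoset h 1 => ((Int.sign X.1.1 : ℤ) : ℂ) *
      (fun q : ℚ => expIntegral (4 * Real.pi * (q : ℂ) * τ.im) * expTwoPiI (-(q : ℂ) * τ))
        ((1 : ℤ) * ((X.1.1 : ℚ) * X.1.2 / N))) (∑' X : signCoset h 1, nonholTerm N X τ) := by
    refine hs.congr_fun fun X => ?_
    rw [nonholTerm, Real.sign_intCast, normQ]
    push_cast
    rw [one_mul]
    ring_nf
  have key := hasSum_norm_fiberwise (ε := 1) (c := fun X => ((Int.sign X.1 : ℤ) : ℂ))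
    (F := fun q : ℚ => expIntegral (4 * Real.pi * (q : ℂ) * τ.im) * expTwoPiI (-(q : ℂ) * τ))
    (one_mul 1) hs'
  refine key.congr_fun fun n => ?_
  have hn : (0 : ℝ) < ((n : ℚ) : ℝ) := by exact_mod_cast n.2
  have he := incompleteGamma_zero_eq_expIntegral
    (by positivity : 0 < 4 * Real.pi * τ.im * ((n : ℚ) : ℝ))
  have hc : (coeffC h n : ℂ) = ∑ᶠ X ∈ vectorsOfNorm h (((1 : ℤ) : ℚ) * n),
      ((Int.sign X.1 : ℤ) : ℂ) := by
    rw [coeffC, if_neg n.2.ne', Int.cast_one, one_mul]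
    have := (Rat.castHom ℂ).toAddMonoidHom.map_finsum_mem
      (fun X : ℤ × ℤ => ((Int.sign X.1 : ℤ) : ℚ)) (finite_vectorsOfNorm h n.2.ne')
    refine this.trans (finsum_mem_congr rfl fun X _ => ?_)
    simp
  rw [hc, he, mul_assoc]
  congr 3
  push_cast
  ring

theorem hasSum_holTerm_fiberwise (hτ : 0 < τ.im) (h : DiscGroup N) :
    HasSum (fun n : {n : ℚ // 0 < n} => (coeffCTilde h n : ℂ) * expTwoPiI (((n : ℚ) : ℂ) * τ))
      (∑' X : signCoset h (-1), holTerm N X τ) := by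
  have hs := (varthetaTilde_eq_tsum hτ h).2.1.hasSum
  have hs' : HasSum (fun X : signCoset h (-1) =>
      ((((Int.sign X.1.1 : ℤ) : ℝ) * Real.log |(X.1.1 : ℝ) / X.1.2| : ℝ) : ℂ) *
      (fun q : ℚ => expTwoPiI ((q : ℂ) * τ)) ((-1 : ℤ) * ((X.1.1 : ℚ) * X.1.2 / N)))
      (∑' X : signCoset h (-1), holTerm N X τ) := by
    refine hs.congr_fun fun X => ?_
    rw [holTerm, Real.sign_intCast, normQ]
    push_cast
    rw [neg_one_mul]
  have key := hasSum_norm_fiberwise (ε := -1) (c := fun X =>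
    ((((Int.sign X.1 : ℤ) : ℝ) * Real.log |(X.1 : ℝ) / X.2| : ℝ) : ℂ))
    (F := fun q : ℚ => expTwoPiI ((q : ℂ) * τ)) (by norm_num) hs'
  refine key.congr_fun fun n => ?_
  have hc : (coeffCTilde h n : ℂ) = ∑ᶠ X ∈ vectorsOfNorm h (((-1 : ℤ) : ℚ) * n),
      ((((Int.sign X.1 : ℤ) : ℝ) * Real.log |(X.1 : ℝ) / X.2| : ℝ) : ℂ) := by
    rw [coeffCTilde, if_neg n.2.ne', Int.cast_neg, Int.cast_one, neg_one_mul]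
    exact Complex.ofRealHom.toAddMonoidHom.map_finsum_mem
      (fun X : ℤ × ℤ => ((Int.sign X.1 : ℤ) : ℝ) * Real.log |(X.1 : ℝ) / X.2|)
      (finite_vectorsOfNorm h (neg_ne_zero.2 n.2.ne'))
  rw [hc]

/-- The Fourier expansion of `ϑ̃`. -/
theorem varthetaTilde_fourier (hτ : 0 < τ.im) (h : DiscGroup N) :
    Summable (fun n : {n : ℚ // 0 ≤ n} =>
        (coeffCTilde h n : ℂ) * expTwoPiI (((n : ℚ) : ℂ) * τ)) ∧
      Summable (fun n : {n : ℚ // 0 < n} =>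
        (coeffC h n : ℂ) * (incompleteGamma 0 (4 * Real.pi * τ.im * ((n : ℚ) : ℝ)) : ℂ) *
          expTwoPiI (-((n : ℚ) : ℂ) * τ)) ∧
      varthetaTilde N τ h =
        (∑' n : {n : ℚ // 0 ≤ n}, (coeffCTilde h n : ℂ) * expTwoPiI (((n : ℚ) : ℂ) * τ))
          + (coeffC h 0 : ℂ) * (Real.log τ.im : ℂ)
          - ∑' n : {n : ℚ // 0 < n},
              (coeffC h n : ℂ) * (incompleteGamma 0 (4 * Real.pi * τ.im * ((n : ℚ) : ℝ)) : ℂ) *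
                expTwoPiI (-((n : ℚ) : ℂ) * τ) := by
  have h1 := hasSum_nonneg_of_hasSum_pos
    (f := fun n : ℚ => (coeffCTilde h n : ℂ) * expTwoPiI ((n : ℂ) * τ))
    (hasSum_holTerm_fiberwise hτ h)
  have h2 := hasSum_nonholTerm_fiberwise hτ h
  refine ⟨h1.summable, h2.summable, ?_⟩
  rw [h1.tsum_eq, h2.tsum_eq, (varthetaTilde_eq_tsum hτ h).2.2]
  have e0 : expTwoPiI (((0 : ℚ) : ℂ) * τ) = 1 := by simp [expTwoPiI]
  rw [e0]
  ring

end Fourier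

/-! ### Analytic properties of the Fourier series -/

section Analytic

variable {N : ℕ} [NeZero N] {τ : ℂ} {h : DiscGroup N}

theorem isOpen_lt_im (c : ℝ) : IsOpen {τ : ℂ | c < τ.im} :=
  isOpen_lt continuous_const Complex.continuous_im

theorem norm_expTwoPiI_ofReal_mul (r : ℝ) (τ : ℂ) :
    ‖expTwoPiI (r * τ)‖ = Real.exp (-(2 * Real.pi * (r * τ.im))) := by
  rw [norm_expTwoPiI, Complex.im_ofReal_mul]

theorem norm_expTwoPiI_neg_ofReal_mul (r : ℝ) (τ : ℂ) :
    ‖expTwoPiI (-(r : ℂ) * τ)‖ = Real.exp (2 * Real.pi * (r * τ.im)) := by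
  rw [← Complex.ofReal_neg, norm_expTwoPiI_ofReal_mul]
  ring_nf

theorem norm_sign_le (x : ℝ) : ‖(Real.sign x : ℂ)‖ ≤ 1 := by
  rw [Complex.norm_real]
  rcases Real.sign_apply_eq x with h | h | h <;> rw [h] <;> simp

theorem differentiable_expTwoPiI_mul (c : ℂ) : Differentiable ℂ fun τ => expTwoPiI (c * τ) := by
  unfold expTwoPiI
  fun_prop

theorem hasDerivAt_expTwoPiI_mul (c τ : ℂ) : HasDerivAt (fun τ => expTwoPiI (c * τ))
    (2 * Real.pi * Complex.I * c * expTwoPiI (c * τ)) τ := by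
  unfold expTwoPiI
  have h1 : HasDerivAt (fun τ : ℂ => 2 * Real.pi * Complex.I * (c * τ))
      (2 * Real.pi * Complex.I * c) τ := by
    simpa using ((hasDerivAt_id τ).const_mul c).const_mul (2 * Real.pi * Complex.I)
  exact h1.cexp.congr_deriv (by ring)

theorem normQ_eq_abs (X : signCoset h 1) : normQ N X = |(X.1.1 : ℝ) * X.1.2| / N := by
  have h1 := normQ_pos X
  have hN := natCast_pos_real (N := N)
  rw [← abs_of_pos h1, normQ, abs_div, abs_of_pos hN]

theorem normQ_eq_neg_abs (X : signCoset h (-1)) : normQ N X = -(|(X.1.1 : ℝ) * X.1.2| / N) := by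
  have h1 := normQ_neg X
  have hN := natCast_pos_real (N := N)
  rw [← neg_neg (normQ N X), ← abs_of_neg h1, normQ, abs_div, abs_of_pos hN]

theorem one_le_mul_normQ (X : signCoset h 1) : 1 ≤ N * normQ N X := by
  have hN := natCast_pos_real (N := N)
  rw [normQ_eq_abs, mul_div_cancel₀ _ hN.ne']
  exact one_le_abs_mul_of_mem (ne_zero_of_mem_signCoset h 1) X

theorem summable_exp_neg_normQ (h : DiscGroup N) {c : ℝ} (hc : 0 < c) :
    Summable fun X : signCoset h 1 => Real.exp (-(c * normQ N X)) := by
  have hN := natCast_pos_real (N := N)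
  refine (summable_exp_neg_subtype (ne_zero_of_mem_signCoset h 1)
    (by positivity : 0 < c / N)).congr fun X => ?_
  rw [normQ_eq_abs]
  ring_nf

theorem norm_thetaTerm_le {v₀ : ℝ} (hv : v₀ ≤ τ.im) (X : signCoset h 1) :
    ‖thetaTerm N X τ‖ ≤ Real.exp (-(2 * Real.pi * v₀ * normQ N X)) := by
  have hq := normQ_pos X
  have hpi := Real.pi_pos
  rw [thetaTerm, norm_mul, norm_expTwoPiI_ofReal_mul]
  refine (mul_le_of_le_one_left (Real.exp_pos _).le (norm_sign_le _)).trans ?_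
  refine Real.exp_le_exp.2 ?_
  have : normQ N X * v₀ ≤ normQ N X * τ.im := by gcongr
  nlinarith

theorem norm_nonholTerm_le {v₀ : ℝ} (hv₀ : 0 < v₀) (hv : v₀ ≤ τ.im) (X : signCoset h 1) :
    ‖nonholTerm N X τ‖ ≤ N / (4 * Real.pi * v₀) *
      Real.exp (-(2 * Real.pi * v₀ * normQ N X)) := by
  have hq := normQ_pos X
  have hq1 := one_le_mul_normQ X
  have hpi := Real.pi_pos
  have hN := natCast_pos_real (N := N)
  have hτ : 0 < τ.im := hv₀.trans_le hv
  have hw : (4 * Real.pi * (normQ N X : ℂ) * τ.im) = ((4 * Real.pi * normQ N X * τ.im : ℝ) : ℂ) := by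
    push_cast
    rfl
  have hE := norm_expIntegral_le (w := ((4 * Real.pi * normQ N X * τ.im : ℝ) : ℂ))
    (by rw [Complex.ofReal_re]; positivity)
  rw [Complex.ofReal_re] at hE
  rw [nonholTerm, norm_mul, norm_mul, norm_expTwoPiI_neg_ofReal_mul, hw]
  calc ‖(Real.sign X.1.1 : ℂ)‖ * ‖expIntegral ((4 * Real.pi * normQ N X * τ.im : ℝ) : ℂ)‖ *
        Real.exp (2 * Real.pi * (normQ N X * τ.im))
      ≤ 1 * (Real.exp (-(4 * Real.pi * normQ N X * τ.im)) / (4 * Real.pi * normQ N X * τ.im)) *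
        Real.exp (2 * Real.pi * (normQ N X * τ.im)) := by
        gcongr
        exact norm_sign_le _
    _ = (4 * Real.pi * normQ N X * τ.im)⁻¹ * Real.exp (-(2 * Real.pi * (normQ N X * τ.im))) := by
        rw [one_mul, div_eq_inv_mul, mul_assoc, ← Real.exp_add]
        ring_nf
    _ ≤ _ := by
        gcongr ?_ * ?_
        · rw [inv_eq_one_div, div_le_div_iff₀ (by positivity) (by positivity)]
          have : 1 * v₀ ≤ N * normQ N X * τ.im := by gcongr
          nlinarith
        · refine Real.exp_le_exp.2 ?_
          have : normQ N X * v₀ ≤ normQ N X * τ.im := by gcongr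
          nlinarith

/-- Both logarithms are non-negative and at most `|x| - 1` and `|y| - 1`. The logarithmic
coefficients thus grow no faster than the norm. -/
theorem abs_log_div_le {x y : ℝ} (hx : 1 ≤ |x|) (hy : 1 ≤ |y|) :
    |Real.log (|x / y|)| ≤ |x * y| := by
  have hx0 : 0 < |x| := by linarith
  have hy0 : 0 < |y| := by linarith
  have h1 := Real.log_le_sub_one_of_pos hx0
  have h2 := Real.log_le_sub_one_of_pos hy0
  have h3 := Real.log_nonneg hx
  have h4 := Real.log_nonneg hy
  rw [abs_div, Real.log_div hx0.ne' hy0.ne', abs_mul, abs_le]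
  constructor <;> nlinarith

theorem norm_holTerm_le {v₀ : ℝ} (hv : v₀ ≤ τ.im) (X : signCoset h (-1)) :
    ‖holTerm N X τ‖ ≤ |(X.1.1 : ℝ) * X.1.2| *
      Real.exp (-(2 * Real.pi * v₀ / N * |(X.1.1 : ℝ) * X.1.2|)) := by
  have hpi := Real.pi_pos
  have hN := natCast_pos_real (N := N)
  have hX := one_le_abs_of_mem (ne_zero_of_mem_signCoset h (-1)) X
  rw [holTerm, norm_mul, norm_expTwoPiI_neg_ofReal_mul, normQ_eq_neg_abs]
  refine mul_le_mul ?_ (Real.exp_le_exp.2 ?_) (Real.exp_pos _).le (abs_nonneg _)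
  · rw [Complex.ofReal_mul, norm_mul]
    refine (mul_le_of_le_one_left (norm_nonneg _) (norm_sign_le _)).trans ?_
    rw [Complex.norm_real]
    exact abs_log_div_le hX.1 hX.2
  · have : |(X.1.1 : ℝ) * X.1.2| / N * v₀ ≤ |(X.1.1 : ℝ) * X.1.2| / N * τ.im := by gcongr
    have e : 2 * Real.pi * v₀ / N * |(X.1.1 : ℝ) * X.1.2| =
      2 * Real.pi * (|(X.1.1 : ℝ) * X.1.2| / N * v₀) := by ring
    rw [e]
    nlinarith

theorem differentiableAt_tsum_holTerm (hτ : 0 < τ.im) (h : DiscGroup N) :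
    DifferentiableOn ℂ (fun τ => ∑' X : signCoset h (-1), holTerm N X τ) {z | τ.im / 2 < z.im} := by
  have hpi := Real.pi_pos
  have hN := natCast_pos_real (N := N)
  refine Complex.differentiableOn_tsum_of_summable_norm
    (summable_norm_mul_exp_neg_subtype (ne_zero_of_mem_signCoset h (-1))
      (by positivity : 0 < 2 * Real.pi * (τ.im / 2) / N)) (fun X => ?_) (isOpen_lt_im _)
    fun X z hz => norm_holTerm_le (le_of_lt hz) X
  exact ((differentiable_expTwoPiI_mul _).const_mul _).differentiableOn

theorem differentiableAt_tsum_thetaTerm (hτ : 0 < τ.im) (h : DiscGroup N) :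
    DifferentiableAt ℂ (fun τ => ∑' X : signCoset h 1, thetaTerm N X τ) τ := by
  have hpi := Real.pi_pos
  have hd : DifferentiableOn ℂ (fun τ => ∑' X : signCoset h 1, thetaTerm N X τ)
      {z | τ.im / 2 < z.im} := by
    refine Complex.differentiableOn_tsum_of_summable_norm
      (summable_exp_neg_normQ h (by positivity : 0 < 2 * Real.pi * (τ.im / 2))) (fun X => ?_)
      (isOpen_lt_im _) fun X z hz => norm_thetaTerm_le (le_of_lt hz) X
    exact ((differentiable_expTwoPiI_mul _).const_mul _).differentiableOn
  exact hd.differentiableAt ((isOpen_lt_im _).mem_nhds (half_lt_self hτ))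

/-- The terms grow like `e^{2πqv}` in the exponential and decay like `e^{-4πqv}` in `Γ(0, ·)`. To
make both factors small separately, the weight `e^{∓3πv₀q}`, halfway between, is moved from one to
the other. -/
theorem analyticAt_tsum_nonholTerm (hτ : 0 < τ.im) (h : DiscGroup N) :
    AnalyticAt ℝ (fun τ => ∑' X : signCoset h 1, nonholTerm N X τ) τ := by
  classical
  have hpi := Real.pi_pos
  have hN := natCast_pos_real (N := N)
  set v₀ : ℝ := τ.im with hv₀
  -- The margins make the exponents negative: `-3 + 2·(7/6) = -2/3` for the holomorphic factor and
  -- `3 - 4·(5/6) = -1/3` for the exponential integral, in units of `πv₀q`.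
  have hV : IsOpen {w : ℂ | 5 / 6 * v₀ < w.re} := isOpen_lt continuous_const Complex.continuous_re
  have hU : IsOpen {z : ℂ | z.im < 7 / 6 * v₀} := isOpen_lt Complex.continuous_im continuous_const
  have hu := (summable_exp_neg_normQ h (by positivity : 0 < Real.pi / 3 * v₀)).mul_left
    (1 + N / v₀)
  have key := analyticAt_tsum_mul
    (a := fun (X : signCoset h 1) (z : ℂ) => (Real.sign X.1.1 : ℂ) *
      (Real.exp (-(3 * Real.pi * v₀ * normQ N X)) : ℝ) * expTwoPiI (-(normQ N X : ℂ) * z))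
    (b := fun (X : signCoset h 1) (w : ℂ) => (Real.exp (3 * Real.pi * v₀ * normQ N X) : ℝ) *
      expIntegral (4 * Real.pi * (normQ N X : ℂ) * w)) hu hU hV
    (fun X => ((differentiable_expTwoPiI_mul _).const_mul _).differentiableOn)
    (fun X w hw => ?_) (fun X z hz => ?_) (fun X w hw => ?_) (fun X v hv => ?_)
    (z := τ) (show v₀ < 7 / 6 * v₀ by linarith)
    (show 5 / 6 * v₀ < ((v₀ : ℂ)).re by rw [Complex.ofReal_re]; linarith)
  · refine key.congr (Eventually.of_forall fun z => tsum_congr fun X => ?_)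
    have he : (Real.exp (3 * Real.pi * v₀ * normQ N X) : ℂ) *
        (Real.exp (-(3 * Real.pi * v₀ * normQ N X)) : ℂ) = 1 := by
      rw [← Complex.ofReal_mul, ← Real.exp_add]
      simp
    simp only [nonholTerm]
    linear_combination ((Real.sign X.1.1 : ℂ) * expIntegral (4 * Real.pi * (normQ N X : ℂ) * z.im) *
      expTwoPiI (-(normQ N X : ℂ) * z)) * he
  · have hq := normQ_pos X
    have hw' : 5 / 6 * v₀ < w.re := hw
    have hw0 : 0 < w.re := lt_trans (by positivity) hw'
    have hre : 0 < (4 * Real.pi * (normQ N X : ℂ) * w).re := by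
      have : (4 * Real.pi * (normQ N X : ℂ) * w).re = 4 * Real.pi * normQ N X * w.re := by
        rw [show (4 * Real.pi * (normQ N X : ℂ) * w) = ((4 * Real.pi * normQ N X : ℝ) : ℂ) * w by
          push_cast; rfl, Complex.re_ofReal_mul]
      rw [this]
      positivity
    have h1 := (hasDerivAt_expIntegral hre).differentiableAt
    exact ((h1.comp w (by fun_prop)).const_mul _).differentiableWithinAt
  · have hq := normQ_pos X
    have hz' : z.im < 7 / 6 * v₀ := hz
    rw [norm_mul, norm_mul, norm_expTwoPiI_neg_ofReal_mul, Complex.norm_real (Real.exp _),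
      Real.norm_of_nonneg (Real.exp_pos _).le, mul_assoc, ← Real.exp_add]
    refine (mul_le_of_le_one_left (Real.exp_pos _).le (norm_sign_le _)).trans ?_
    refine le_trans (Real.exp_le_exp.2 ?_) (le_mul_of_one_le_left (Real.exp_pos _).le
      (le_add_of_nonneg_right (by positivity)))
    have h1 : normQ N X * z.im ≤ normQ N X * (7 / 6 * v₀) := by gcongr
    have h2 : 2 * Real.pi * (normQ N X * z.im) ≤ 2 * Real.pi * (normQ N X * (7 / 6 * v₀)) := by
      gcongr
    have h3 : 0 ≤ Real.pi * v₀ * normQ N X := by positivity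
    nlinarith
  · have hq := normQ_pos X
    have hq1 := one_le_mul_normQ X
    have hw' : 5 / 6 * v₀ < w.re := hw
    have hw0 : 0 < w.re := lt_trans (by positivity) hw'
    have hre : (4 * Real.pi * (normQ N X : ℂ) * w).re = 4 * Real.pi * normQ N X * w.re := by
      rw [show (4 * Real.pi * (normQ N X : ℂ) * w) = ((4 * Real.pi * normQ N X : ℝ) : ℂ) * w by
        push_cast; rfl, Complex.re_ofReal_mul]
    have hE := norm_expIntegral_le (w := 4 * Real.pi * (normQ N X : ℂ) * w)
      (by rw [hre]; positivity)
    rw [hre] at hE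
    rw [norm_mul, Complex.norm_real, Real.norm_of_nonneg (Real.exp_pos _).le]
    have h1 : normQ N X * (5 / 6 * v₀) ≤ normQ N X * w.re := by gcongr
    calc Real.exp (3 * Real.pi * v₀ * normQ N X) *
          ‖expIntegral (4 * Real.pi * (normQ N X : ℂ) * w)‖
        ≤ Real.exp (3 * Real.pi * v₀ * normQ N X) *
          (Real.exp (-(4 * Real.pi * normQ N X * w.re)) / (4 * Real.pi * normQ N X * w.re)) := by
          gcongr
      _ = (4 * Real.pi * normQ N X * w.re)⁻¹ *
          Real.exp (3 * Real.pi * v₀ * normQ N X - 4 * Real.pi * normQ N X * w.re) := by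
          rw [sub_eq_add_neg, Real.exp_add]
          ring
      _ ≤ (1 + N / v₀) * Real.exp (-(Real.pi / 3 * v₀ * normQ N X)) := by
          gcongr ?_ * ?_
          · refine le_trans ?_ (le_add_of_nonneg_left zero_le_one)
            rw [inv_eq_one_div, div_le_div_iff₀ (by positivity) (by positivity)]
            have h2 : 1 * (5 / 6 * v₀) ≤ N * normQ N X * w.re := by gcongr
            have h3 : 0 ≤ N * normQ N X * w.re := by positivity
            nlinarith [Real.pi_gt_three]
          · refine Real.exp_le_exp.2 ?_
            nlinarith
  · have hq := normQ_pos X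
    have hv' : 5 / 6 * v₀ < v := by
      have : 5 / 6 * v₀ < ((v : ℂ)).re := hv
      rwa [Complex.ofReal_re] at this
    have hv0 : 0 < v := lt_trans (by positivity) hv'
    have he := incompleteGamma_zero_eq_expIntegral
      (by positivity : 0 < 4 * Real.pi * normQ N X * v)
    push_cast at he
    simp only [map_mul, Complex.conj_ofReal, ← he]

theorem analyticAt_varthetaTilde (hτ : 0 < τ.im) (h : DiscGroup N) :
    AnalyticAt ℝ (fun τ => varthetaTilde N τ h) τ := by
  have h0 : AnalyticAt ℝ (fun τ : ℂ => Real.log τ.im) τ :=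
    (show AnalyticAt ℝ Real.log (Complex.imCLM τ) from analyticAt_log hτ).comp
      (Complex.imCLM.analyticAt τ)
  have h1 : AnalyticAt ℝ (fun τ : ℂ => (Real.log τ.im : ℂ)) τ :=
    (Complex.ofRealCLM.analyticAt _).comp h0
  have h2 : AnalyticAt ℝ (fun τ => ∑' X : signCoset h (-1), holTerm N X τ) τ :=
    ((differentiableAt_tsum_holTerm hτ h).analyticAt
      ((isOpen_lt_im _).mem_nhds (half_lt_self hτ))).restrictScalars
  have h3 := ((((analyticAt_const (v := (coeffCTilde h 0 : ℂ))).add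
    ((analyticAt_const (v := (coeffC h 0 : ℂ))).mul h1)).add h2).sub
    (analyticAt_tsum_nonholTerm hτ h))
  refine h3.congr ?_
  filter_upwards [(isOpen_lt_im 0).mem_nhds hτ] with z hz
  exact (varthetaTilde_eq_tsum hz h).2.2.symm

theorem varthetaTilde_growth (h : DiscGroup N) :
    (fun τ => varthetaTilde N τ h) =O[comap Complex.im atTop]
      (fun τ : ℂ => Real.exp (1 * τ.im)) := by
  have hpi := Real.pi_pos
  have hN := natCast_pos_real (N := N)
  have s1 := summable_norm_mul_exp_neg_subtype (ne_zero_of_mem_signCoset h (-1))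
      (by positivity : 0 < 2 * Real.pi * 1 / N)
  have s2 := (summable_exp_neg_normQ h (by positivity : 0 < 2 * Real.pi * 1)).mul_left
    (N / (4 * Real.pi * 1))
  refine IsBigO.of_bound (‖(coeffCTilde h 0 : ℂ)‖ + ‖(coeffC h 0 : ℂ)‖ +
    (∑' X : signCoset h (-1), |(X.1.1 : ℝ) * X.1.2| *
      Real.exp (-(2 * Real.pi * 1 / N * |(X.1.1 : ℝ) * X.1.2|))) +
    ∑' X : signCoset h 1, N / (4 * Real.pi * 1) *
      Real.exp (-(2 * Real.pi * 1 * normQ N X))) ?_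
  filter_upwards [tendsto_comap.eventually (eventually_ge_atTop (1 : ℝ))] with τ hτ
  have hτ0 : 0 < τ.im := by linarith
  have b1 := tsum_of_norm_bounded s1.hasSum fun X => norm_holTerm_le hτ X
  have b2 := tsum_of_norm_bounded s2.hasSum fun X => norm_nonholTerm_le one_pos hτ X
  have n1 := (norm_nonneg _).trans b1
  have n2 := (norm_nonneg _).trans b2
  have hexp : 1 ≤ Real.exp τ.im := Real.one_le_exp hτ0.le
  have hlog : ‖(Real.log τ.im : ℂ)‖ ≤ Real.exp τ.im := by
    rw [Complex.norm_real, Real.norm_of_nonneg (Real.log_nonneg hτ)]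
    linarith [Real.log_le_sub_one_of_pos hτ0, Real.add_one_le_exp τ.im]
  rw [one_mul, Real.norm_of_nonneg (Real.exp_pos _).le, (varthetaTilde_eq_tsum hτ0 h).2.2]
  refine (norm_sub_le _ _).trans ?_
  rw [add_mul]
  refine add_le_add ?_ (b2.trans (le_mul_of_one_le_right n2 hexp))
  refine (norm_add_le _ _).trans ?_
  rw [add_mul]
  refine add_le_add ?_ (b1.trans (le_mul_of_one_le_right n1 hexp))
  refine (norm_add_le _ _).trans ?_
  rw [add_mul, norm_mul]
  exact add_le_add (le_mul_of_one_le_right (norm_nonneg _) hexp)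
    (mul_le_mul_of_nonneg_left hlog (norm_nonneg _))

end Analytic

/-! ### The differential operators -/

section Dbar

variable {τ : ℂ}

/-- The functional `L ↦ (L(1) + i L(i)) / 2`. -/
noncomputable def dbarCLM : (ℂ →L[ℝ] ℂ) →L[ℝ] ℂ :=
  (2⁻¹ : ℂ) • (ContinuousLinearMap.apply ℝ ℂ (1 : ℂ) +
    Complex.I • ContinuousLinearMap.apply ℝ ℂ Complex.I)

theorem dbarCLM_apply (L : ℂ →L[ℝ] ℂ) : dbarCLM L = (L 1 + Complex.I * L Complex.I) / 2 := by
  simp [dbarCLM]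
  ring

theorem HasFDerivAt.dbar_eq {f : ℂ → ℂ} {f' : ℂ →L[ℝ] ℂ} (hf : HasFDerivAt f f' τ) :
    dbar f τ = dbarCLM f' := by
  rw [dbar, hf.fderiv, dbarCLM_apply]

theorem dbarCLM_restrictScalars (c : ℂ) : dbarCLM (c • ContinuousLinearMap.id ℝ ℂ) = 0 := by
  rw [dbarCLM_apply]
  simp
  linear_combination c * Complex.I_sq

/-- The Cauchy–Riemann equations, for a real derivative that is multiplication by a complex number.
-/
theorem DifferentiableAt.hasFDerivAt_dbar {f : ℂ → ℂ} (hf : DifferentiableAt ℂ f τ) :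
    ∃ f' : ℂ →L[ℝ] ℂ, HasFDerivAt f f' τ ∧ dbarCLM f' = 0 := by
  have h := hf.hasDerivAt.complexToReal_fderiv
  exact ⟨_, h, dbarCLM_restrictScalars _⟩

/-- The real derivative of `nonholTerm`. -/
noncomputable def nonholDeriv (N : ℕ) (X : ℤ × ℤ) (τ : ℂ) : ℂ →L[ℝ] ℂ :=
  (-((starRingEnd ℂ) (thetaTerm N X τ) / τ.im)) • (Complex.ofRealCLM.comp Complex.imCLM) +
    (-(2 * Real.pi * Complex.I * normQ N X) * nonholTerm N X τ) • ContinuousLinearMap.id ℝ ℂ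

theorem dbarCLM_nonholDeriv (N : ℕ) (X : ℤ × ℤ) (τ : ℂ) : dbarCLM (nonholDeriv N X τ) =
    -(Complex.I / (2 * τ.im)) * (starRingEnd ℂ) (thetaTerm N X τ) := by
  rw [nonholDeriv, map_add, dbarCLM_restrictScalars, dbarCLM_apply]
  simp
  ring

variable {N : ℕ} [NeZero N] {h : DiscGroup N}

/-- Differentiating `Γ(0, 4πqv)` gives `-e^{-4πqv}/v`, and `e^{-4πqv} e(-qτ)` is the conjugate of
`e(qτ)`. The derivative of the exponential factor is complex linear and is invisible to `∂/∂τ̄`. -/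
theorem hasFDerivAt_nonholTerm (hτ : 0 < τ.im) (X : signCoset h 1) :
    HasFDerivAt (nonholTerm N X) (nonholDeriv N X τ) τ := by
  have hq := normQ_pos X
  have hpi := Real.pi_pos
  set q : ℝ := normQ N X with hqdef
  have hq0 : (q : ℂ) ≠ 0 := by exact_mod_cast hq.ne'
  have hpi0 : (Real.pi : ℂ) ≠ 0 := by exact_mod_cast hpi.ne'
  have hv0 : (τ.im : ℂ) ≠ 0 := by exact_mod_cast hτ.ne'
  have hre : 0 < (4 * Real.pi * (q : ℂ) * τ.im).re := by
    have : (4 * Real.pi * (q : ℂ) * τ.im) = ((4 * Real.pi * q * τ.im : ℝ) : ℂ) := by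
      push_cast
      rfl
    rw [this, Complex.ofReal_re]
    positivity
  have h1 : HasFDerivAt (fun z : ℂ => 4 * Real.pi * (q : ℂ) * z.im)
      ((4 * Real.pi * (q : ℂ)) • (Complex.ofRealCLM.comp Complex.imCLM)) τ :=
    ((Complex.ofRealCLM.comp Complex.imCLM).hasFDerivAt).const_mul (4 * Real.pi * (q : ℂ))
  have h2 := ((hasDerivAt_expIntegral hre).complexToReal_fderiv).comp τ h1
  have h3 := (hasDerivAt_expTwoPiI_mul (-(q : ℂ)) τ).complexToReal_fderiv
  have h4 := (h2.const_mul (Real.sign X.1.1 : ℂ)).mul h3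
  refine h4.congr_fderiv ?_
  have hconj : (starRingEnd ℂ) (thetaTerm N X τ) = (Real.sign X.1.1 : ℂ) *
      (Complex.exp (-(4 * Real.pi * (q : ℂ) * τ.im)) * expTwoPiI (-(q : ℂ) * τ)) := by
    rw [thetaTerm, map_mul, Complex.conj_ofReal, expTwoPiI, expTwoPiI, ← Complex.exp_conj,
      ← Complex.exp_add, ← hqdef]
    congr 2
    simp only [map_mul, Complex.conj_I, Complex.conj_ofReal, map_ofNat]
    have hc : (starRingEnd ℂ) τ = τ - 2 * τ.im * Complex.I := by
      refine Complex.ext ?_ ?_ <;> simp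
      ring
    rw [hc]
    linear_combination (4 * Real.pi * q * τ.im : ℂ) * Complex.I_sq
  refine ContinuousLinearMap.ext fun z => ?_
  rw [nonholDeriv, hconj, nonholTerm, ← hqdef]
  simp
  field_simp
  ring

theorem norm_nonholDeriv_le {v₀ : ℝ} (hv₀ : 0 < v₀) (hv : v₀ ≤ τ.im) (X : signCoset h 1) :
    ‖nonholDeriv N X τ‖ ≤ (v₀⁻¹ + N / (2 * v₀)) *
      (normQ N X * N * Real.exp (-(2 * Real.pi * v₀ * normQ N X))) := by
  have hq := normQ_pos X
  have hq1 := one_le_mul_normQ X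
  have hpi := Real.pi_pos
  have hN := natCast_pos_real (N := N)
  have hN1 : (1 : ℝ) ≤ N := by exact_mod_cast NeZero.one_le
  have hτ : 0 < τ.im := hv₀.trans_le hv
  set e := Real.exp (-(2 * Real.pi * v₀ * normQ N X)) with he
  have he0 : 0 < e := Real.exp_pos _
  have him : ‖Complex.ofRealCLM.comp Complex.imCLM‖ ≤ 1 :=
    ContinuousLinearMap.opNorm_le_bound _ zero_le_one fun z => by
      simpa using Complex.abs_im_le_norm z
  have hid : ‖ContinuousLinearMap.id ℝ ℂ‖ ≤ 1 := ContinuousLinearMap.norm_id_le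
  have h1 : ‖-((starRingEnd ℂ) (thetaTerm N X τ) / τ.im)‖ ≤ v₀⁻¹ * (normQ N X * N * e) := by
    rw [norm_neg, norm_div, RCLike.norm_conj, Complex.norm_real, Real.norm_of_nonneg hτ.le,
      div_eq_inv_mul]
    refine mul_le_mul (inv_anti₀ hv₀ hv) ((norm_thetaTerm_le hv X).trans ?_)
      (norm_nonneg _) (inv_nonneg.2 hv₀.le)
    rw [mul_comm (normQ N X)]
    exact le_mul_of_one_le_left he0.le hq1
  have h2 : ‖-(2 * Real.pi * Complex.I * normQ N X) * nonholTerm N X τ‖ ≤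
      N / (2 * v₀) * (normQ N X * N * e) := by
    have hc : ‖-(2 * Real.pi * Complex.I * (normQ N X : ℂ))‖ = 2 * Real.pi * normQ N X := by
      simp [abs_of_pos hq, abs_of_pos hpi]
    rw [norm_mul, hc]
    calc _ ≤ 2 * Real.pi * normQ N X * (N / (4 * Real.pi * v₀) * e) := by
          gcongr
          exact norm_nonholTerm_le hv₀ hv X
      _ = N / (2 * v₀) * (normQ N X * 1 * e) := by
          field_simp
          norm_num
      _ ≤ _ := by gcongr
  rw [nonholDeriv, add_mul]
  refine (norm_add_le _ _).trans (add_le_add ?_ ?_)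
  · rw [norm_smul]
    exact (mul_le_of_le_one_right (norm_nonneg _) him).trans h1
  · rw [norm_smul]
    exact (mul_le_of_le_one_right (norm_nonneg _) hid).trans h2

/-- The series of real derivatives converges normally near `τ`. As `∂/∂τ̄` is a continuous
functional of the derivative, it may be applied term by term. -/
theorem hasFDerivAt_tsum_nonholTerm (hτ : 0 < τ.im) (h : DiscGroup N) :
    ∃ f' : ℂ →L[ℝ] ℂ, HasFDerivAt (fun τ => ∑' X : signCoset h 1, nonholTerm N X τ) f' τ ∧
      dbarCLM f' = -(Complex.I / (2 * τ.im)) *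
        (starRingEnd ℂ) (∑' X : signCoset h 1, thetaTerm N X τ) := by
  have hpi := Real.pi_pos
  have hN := natCast_pos_real (N := N)
  have hv₀ : 0 < τ.im / 2 := by positivity
  have hu : Summable fun X : signCoset h 1 => ((τ.im / 2)⁻¹ + N / (2 * (τ.im / 2))) *
      (normQ N X * N * Real.exp (-(2 * Real.pi * (τ.im / 2) * normQ N X))) := by
    refine ((summable_norm_mul_exp_neg_subtype (ne_zero_of_mem_signCoset h 1)
      (by positivity : 0 < 2 * Real.pi * (τ.im / 2) / N)).congr fun X => ?_).mul_left _
    rw [normQ_eq_abs]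
    field_simp
  have hpre : IsPreconnected {z : ℂ | τ.im / 2 < z.im} :=
    (convex_halfSpace_im_gt _).isPreconnected
  have hmem : τ ∈ {z : ℂ | τ.im / 2 < z.im} := half_lt_self hτ
  have hf := hasFDerivAt_tsum_of_isPreconnected hu (isOpen_lt_im (τ.im / 2)) hpre
    (f := fun (X : signCoset h 1) z => nonholTerm N X z)
    (f' := fun X z => nonholDeriv N X z)
    (fun X z hz => hasFDerivAt_nonholTerm (hv₀.trans hz) X)
    (fun X z hz => norm_nonholDeriv_le hv₀ (le_of_lt hz) X) hmem
    (varthetaTilde_eq_tsum hτ h).1 hmem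
  refine ⟨_, hf, ?_⟩
  have hsum : Summable fun X : signCoset h 1 => nonholDeriv N X τ :=
    Summable.of_norm_bounded hu fun X => norm_nonholDeriv_le hv₀ (half_le_self hτ.le) X
  rw [dbarCLM.map_tsum hsum]
  simp only [dbarCLM_nonholDeriv]
  rw [tsum_mul_left, ← Complex.conj_tsum]

theorem hasFDerivAt_log_im (hτ : 0 < τ.im) :
    HasFDerivAt (fun τ : ℂ => (Real.log τ.im : ℂ))
      ((τ.im : ℂ)⁻¹ • (Complex.ofRealCLM.comp Complex.imCLM)) τ := by
  have h1 : HasFDerivAt (fun z : ℂ => Real.log z.im) (τ.im⁻¹ • Complex.imCLM) τ :=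
    (Complex.imCLM.hasFDerivAt (x := τ)).log hτ.ne'
  refine (Complex.ofRealCLM.hasFDerivAt.comp τ h1).congr_fderiv ?_
  ext
  · simp

/-- Since `∂(log v)/∂τ̄ = i/(2v)` and `c_h(0)` is real, the logarithm accounts for the constant term
of `ϑ_h`; the incomplete Gamma terms account for the others. -/
theorem dbar_varthetaTilde (hτ : 0 < τ.im) (h : DiscGroup N) :
    dbar (fun z => varthetaTilde N z h) τ =
      Complex.I / (2 * τ.im) * (starRingEnd ℂ) (vartheta N τ h) := by
  obtain ⟨f₁, h1, e1⟩ := hasFDerivAt_tsum_nonholTerm hτ h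
  obtain ⟨f₂, h2, e2⟩ := ((differentiableAt_tsum_holTerm hτ h).differentiableAt
    ((isOpen_lt_im _).mem_nhds (half_lt_self hτ))).hasFDerivAt_dbar
  have h3 := ((((hasFDerivAt_log_im hτ).const_mul (coeffC h 0 : ℂ)).const_add
    (coeffCTilde h 0 : ℂ)).add h2).sub h1
  have h4 : HasFDerivAt (fun z => varthetaTilde N z h) _ τ := h3.congr_of_eventuallyEq (by
    filter_upwards [(isOpen_lt_im 0).mem_nhds hτ] with z hz
    exact (varthetaTilde_eq_tsum hz h).2.2)
  rw [h4.dbar_eq, map_sub, map_add, e1, e2, vartheta_eq_tsum hτ, map_add, dbarCLM_apply,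
    map_ratCast]
  simp
  ring

theorem xiOp_varthetaTilde (hτ : 0 < τ.im) (h : DiscGroup N) :
    xiOp 1 (fun z => varthetaTilde N z h) τ = vartheta N τ h := by
  have hv0 : (τ.im : ℂ) ≠ 0 := by exact_mod_cast hτ.ne'
  rw [xiOp, dbar_varthetaTilde hτ]
  simp only [map_mul, map_div₀, Complex.conj_I, Complex.conj_conj, Complex.conj_ofReal, map_ofNat,
    zpow_one]
  field_simp
  linear_combination (-vartheta N τ h) * Complex.I_sq

/-- In weight one the second operator is `ξ₁` again, and it kills the holomorphic function `ϑ_h`. -/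
theorem hypLaplacian_varthetaTilde (hτ : 0 < τ.im) (h : DiscGroup N) :
    hypLaplacian 1 (fun z => varthetaTilde N z h) τ = 0 := by
  obtain ⟨f', h1, e1⟩ := (differentiableAt_tsum_thetaTerm hτ h).hasFDerivAt_dbar
  have h2 : HasFDerivAt (xiOp 1 fun z => varthetaTilde N z h) f' τ :=
    (h1.const_add (coeffC h 0 : ℂ)).congr_of_eventuallyEq (by
      filter_upwards [(isOpen_lt_im 0).mem_nhds hτ] with z hz
      rw [xiOp_varthetaTilde hz, vartheta_eq_tsum hz])
  rw [hypLaplacian, xiOp, h2.dbar_eq, e1]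
  simp

end Dbar

theorem isHarmonicMaassForm_varthetaTilde (N : ℕ) [NeZero N] :
    IsHarmonicMaassForm 1 (weilRepNeg N) (varthetaTilde N) where
  realAnalytic h _ hτ := analyticAt_varthetaTilde hτ h
  modular := varthetaTilde_smul
  harmonic h _ hτ := hypLaplacian_varthetaTilde hτ h
  growth := ⟨1, varthetaTilde_growth⟩

end

theorem mainTheorem1 (N : ℕ) [NeZero N] :
    -- the two theta series converge absolutely
    (∀ τ : ℂ, 0 < τ.im → ∀ (h : DiscGroup N) (t : ℝ), 0 < t →
      Summable (fun X : latticeCoset h => phi τ (iota N t (toRealVec X))) ∧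
      Summable (fun X : latticeCoset h => phiTilde τ (iota N t (toRealVec X)))) ∧
    -- `ϑ_h(τ)` is the constant term at `s = 0` of the continuation of a convergent integral
    (∀ τ : ℂ, 0 < τ.im → ∀ h : DiscGroup N,
      (∀ s : ℂ, 0 < s.re → RegIntegralConverges (fun t => thetaKernel N τ t h) s) ∧
      (∃ F : ℂ → ℂ, Differentiable ℂ F ∧
        ∀ s : ℂ, 0 < s.re → F s = regIntegral (fun t => thetaKernel N τ t h) s) ∧
      IsConstTermAtZero (regIntegral fun t => thetaKernel N τ t h) (vartheta N τ h)) ∧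
    -- and so is `ϑ̃_h(τ)`
    (∀ τ : ℂ, 0 < τ.im → ∀ h : DiscGroup N,
      (∀ s : ℂ, 0 < s.re → RegIntegralConverges (fun t => thetaKernelTilde N τ t h) s) ∧
      (∃ F : ℂ → ℂ, Differentiable ℂ F ∧
        ∀ s : ℂ, 0 < s.re → F s = regIntegral (fun t => thetaKernelTilde N τ t h) s) ∧
      IsConstTermAtZero (regIntegral fun t => thetaKernelTilde N τ t h) (varthetaTilde N τ h)) ∧
    -- `ϑ̃` is a harmonic Maass form of weight one for `ρ_{-L}`
    IsHarmonicMaassForm 1 (weilRepNeg N) (varthetaTilde N) ∧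
    -- `ξ ϑ̃ = ϑ`
    (∀ τ : ℂ, 0 < τ.im → ∀ h : DiscGroup N,
      xiOp 1 (fun z => varthetaTilde N z h) τ = vartheta N τ h) ∧
    -- the Fourier expansion, where `q^r = e(rτ)`
    (∀ τ : ℂ, 0 < τ.im → ∀ h : DiscGroup N,
      Summable (fun n : {n : ℚ // 0 ≤ n} =>
        (coeffCTilde h n : ℂ) * expTwoPiI (((n : ℚ) : ℂ) * τ)) ∧
      Summable (fun n : {n : ℚ // 0 < n} =>
        (coeffC h n : ℂ) * (incompleteGamma 0 (4 * Real.pi * τ.im * ((n : ℚ) : ℝ)) : ℂ) *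
          expTwoPiI (-((n : ℚ) : ℂ) * τ)) ∧
      varthetaTilde N τ h =
        (∑' n : {n : ℚ // 0 ≤ n}, (coeffCTilde h n : ℂ) * expTwoPiI (((n : ℚ) : ℂ) * τ))
          + (coeffC h 0 : ℂ) * (Real.log τ.im : ℂ)
          - ∑' n : {n : ℚ // 0 < n},
              (coeffC h n : ℂ) * (incompleteGamma 0 (4 * Real.pi * τ.im * ((n : ℚ) : ℝ)) : ℂ) *
                expTwoPiI (-((n : ℚ) : ℂ) * τ)) := by
  refine ⟨fun τ hτ h t ht => ⟨(hasSum_phi hτ h ht).summable, (hasSum_phiTilde hτ h ht).summable⟩,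
    fun τ hτ h => ?_, fun τ hτ h => ?_, isHarmonicMaassForm_varthetaTilde N,
    fun τ hτ h => xiOp_varthetaTilde hτ h, fun τ hτ h => varthetaTilde_fourier hτ h⟩
  · obtain ⟨a, ha, -⟩ := hasRegConst_thetaKernel hτ h
    obtain ⟨F, hF, hs, -⟩ := ha.exists_continuation
    refine ⟨fun s hs => ha.converges hs, ⟨F, hF, hs⟩, ?_⟩
    rw [vartheta, ha.constTermAtZero_eq]
    exact ha.isConstTermAtZero
  · obtain ⟨a, ha⟩ := hasRegConst_thetaKernelTilde hτ h
    obtain ⟨F, hF, hs, -⟩ := ha.exists_continuation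
    refine ⟨fun s hs => ha.converges hs, ⟨F, hF, hs⟩, ?_⟩
    rw [varthetaTilde, ha.constTermAtZero_eq]
    exact ha.isConstTermAtZero
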